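/- Let $d\ge 1$, $T>0$, $\mathbb T^d=\mathbb R^d/\mathbb Z^d$, and let $p,q\in(2,\infty]$ satisfy $\gamma:=\frac2q+\frac dp<1$. Let $b:[0,T]\times\mathbb T^d\to\mathbb R^d$ and $c:[0,T]\times\mathbb T^d\to\mathbb R$ belong to $L^q(0,T;L^p(\mathbb T^d))$. Consider $$\partial_t h=\Delta h+b\cdot\nabla h+c\,h,\qquad h|_{t=0}=h_0 .$$ For $h_0\in L^\infty(\mathbb T^d)$, a function $h$ on $[0,T]\times\mathbb T^d$ with $h_t\in C^1(\mathbb T^d)$ for $t\in(0,T]$ is a weak solution if $h_t\in L^1(\mathbb T^d)$ for every $t\in[0,T]$, $h$ and $b\cdot\nabla h+c\,h$ are integrable on $[0,T]\times\mathbb T^d$, and $$\langle h_t,\varphi\rangle=\langle h_0,\varphi\rangle+\int_0^t\big(\langle h_s,\Delta\varphi\rangle+\langle b_s\cdot\nabla h_s+c_sh_s,\varphi\rangle\big)\,ds$$ for all $\varphi\in C^\infty(\mathbb T^d)$ and $t\in[0,T]$. Let $P_t=e^{t\Delta}$ be the heat semigroup and $\|\cdot\|_{C^\delta}$, $\delta\ge0$,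 the Hölder norm: with $k=\lfloor\delta\rfloor$, the sum of the sup norms of the derivatives up to order $k$ and, if $\delta\notin\mathbb N$, of the $(\delta-k)$-Hölder seminorm of the $k$-th derivative. There are a constant $C$, and for every $\delta\in[0,2-\gamma)$ a constant $K_\delta$, depending on $d,p,q,T,b,c$ but not on $h_0$, such that for every $h_0\in L^\infty(\mathbb T^d)$ the following hold. 1. (Existence.) There is a weak solution of the form $h_t=P_th_0+v_t$, $t\in[0,T]$, with $v\in C([0,T];C(\mathbb T^d))$, $v_0=0$ and $$\sup_{t\in[0,T]}t^{\gamma/2}\|v_t\|_{C^1}\le C\,\|h_0\|_{L^\infty}.$$ 2. (Uniqueness.) If $h'$ is a weak solution of the form $h'_t=P_th_0+v'_t$ with $v'\in C([0,T];C(\mathbb T^d))$, $v'_0=0$ and $\sup_{t\in[0,T]}t^{\gamma/2}\|v'_t\|_{C^1}<\infty$, then $h'=h$ and $v'=v$ on $[0,T]$. 3. For every $\delta\in[0,2-\gamma)$, $$\sup_{t\in[0,T]}t^{\frac{\gamma+\delta-1}{2}}\|v_t\|_{C^\delta}\le K_\delta\,\|h_0\|_{L^\infty},$$ where the term at $t=0$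 is $0$ (as $v_0=0$). 4. In particular, $v\in L^\infty(0,T;C^\delta(\mathbb T^d))$ for every $\delta\in[0,1-\gamma]$, and $v\in L^2(0,T;C^\delta(\mathbb T^d))$ for every $\delta\in[0,2-\gamma)$. -/

import Mathlib

open MeasureTheory ProbabilityTheory Set Filter Topology
open scoped ENNReal NNReal ContDiff

noncomputable section

namespace ParabolicTorus

/-- The flat torus `ℝ^d / ℤ^d`; its `volume` is Lebesgue measure (of total mass one). -/
abbrev Torus (d : ℕ) : Type := UnitAddTorus (Fin d)

/-- The projection `ℝ^d → ℝ^d / ℤ^d`. -/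
def proj {d : ℕ} (x : EuclideanSpace ℝ (Fin d)) : Torus d := fun i => (x i : UnitAddCircle)

/-- The periodic lift of a function on the torus. -/
def lift {d : ℕ} (f : Torus d → ℝ) : EuclideanSpace ℝ (Fin d) → ℝ := fun x => f (proj x)

/-- Smooth functions on the torus. -/
def IsSmooth {d : ℕ} (f : Torus d → ℝ) : Prop := ContDiff ℝ ∞ (lift f)

/-- Partial derivative `∂ᵢ f` of a function on the torus. -/
def pderiv {d : ℕ} (i : Fin d) (f : Torus d → ℝ) (x : Torus d) : ℝ :=
  deriv (fun s : ℝ => f (x + Pi.single i (s : UnitAddCircle))) 0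

/-- The Laplacian `Δ f = ∑ᵢ ∂ᵢ ∂ᵢ f`. -/
def laplacian {d : ℕ} (f : Torus d → ℝ) (x : Torus d) : ℝ :=
  ∑ i, pderiv i (pderiv i f) x

open Classical in
/-- The Hölder norm `‖f‖_{C^δ}` for `δ ≥ 0`, with value `∞` if `f ∉ C^δ`. With `k = ⌊δ⌋` it is the
sum of the supremum norms of the derivatives up to order `k` and, if `δ` is not an integer, of
the `(δ - k)`-Hölder seminorm of the `k`-th derivative. (Supremum norms and Hölder seminorms of
periodic lifts agree with the ones on the torus.) -/
def holderNorm {d : ℕ} (δ : ℝ) (f : Torus d → ℝ) : ℝ≥0∞ :=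
  if ContDiff ℝ (⌊δ⌋₊ : ℕ∞) (lift f) then
    (∑ j ∈ Finset.range (⌊δ⌋₊ + 1), ⨆ x, ‖iteratedFDeriv ℝ j (lift f) x‖ₑ) +
      (if (⌊δ⌋₊ : ℝ) = δ then 0
        else eHolderNorm (δ - ⌊δ⌋₊).toNNReal (iteratedFDeriv ℝ ⌊δ⌋₊ (lift f)))
  else ⊤

/-- The heat semigroup `P_t = e^{tΔ}` on the torus, for `t ≥ 0`: convolution with the heat kernel of
`ℝ^d`, which is the centred Gaussian law with covariance matrix `2t·Id` (a Dirac mass at `0` for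
`t = 0`, so that `P_0 f = f`). -/
def heat {d : ℕ} (t : ℝ) (f : Torus d → ℝ) (x : Torus d) : ℝ :=
  ∫ y : Fin d → ℝ, f (x + fun i => (y i : UnitAddCircle))
    ∂(Measure.pi fun _ : Fin d => gaussianReal 0 (2 * t).toNNReal)

/-- Lebesgue measure on the time-space cylinder `[0,T] × 𝕋^d`. -/
def cylinder (d : ℕ) (T : ℝ) : Measure (ℝ × Torus d) :=
  (volume.restrict (Icc 0 T)).prod volume

/-- `f ∈ L^q(0,T; L^p(𝕋^d, E))`: `f` is measurable in time and space, with finite mixed norm. -/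
def MemLqLp {d : ℕ} {E : Type*} [NormedAddCommGroup E] (T : ℝ) (q p : ℝ≥0∞)
    (f : ℝ → Torus d → E) : Prop :=
  AEStronglyMeasurable (fun z : ℝ × Torus d => f z.1 z.2) (cylinder d T) ∧
    eLpNorm (fun t => eLpNorm (f t) p volume) q (volume.restrict (Icc 0 T)) < ⊤

/-- `γ = 2/q + d/p`, with `1/∞ = 0`. -/
def krExponent (d : ℕ) (p q : ℝ≥0∞) : ℝ := 2 * (q⁻¹).toReal + d * (p⁻¹).toReal

/-- The lower order term `b·∇h + c h` at time `t`. -/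
def lowerOrder {d : ℕ} (b : ℝ → Torus d → EuclideanSpace ℝ (Fin d)) (c : ℝ → Torus d → ℝ)
    (h : ℝ → Torus d → ℝ) (t : ℝ) (x : Torus d) : ℝ :=
  (∑ i, b t x i * pderiv i (h t) x) + c t x * h t x

/-- `h`, with `h_t ∈ C^1` for `t ∈ (0,T]`, is a weak solution on `[0,T]` of
`∂_t h = Δ h + b·∇h + c h`, `h|_{t=0} = h₀`: the terms of the equation are integrable, and for all
smooth `φ` and all `t ∈ [0,T]`,
`⟨h_t, φ⟩ = ⟨h₀, φ⟩ + ∫_0^t (⟨h_s, Δφ⟩ + ⟨b_s·∇h_s + c_s h_s, φ⟩) ds`. -/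
structure IsWeakSolution {d : ℕ} (T : ℝ) (b : ℝ → Torus d → EuclideanSpace ℝ (Fin d))
    (c : ℝ → Torus d → ℝ) (h₀ : Torus d → ℝ) (h : ℝ → Torus d → ℝ) : Prop where
  contDiff : ∀ t ∈ Ioc 0 T, ContDiff ℝ 1 (lift (h t))
  integrable_slice : ∀ t ∈ Icc 0 T, Integrable (h t) volume
  integrable : Integrable (fun z : ℝ × Torus d => h z.1 z.2) (cylinder d T)
  integrable_lowerOrder :
    Integrable (fun z : ℝ × Torus d => lowerOrder b c h z.1 z.2) (cylinder d T)
  weak : ∀ φ : Torus d → ℝ, IsSmooth φ → ∀ t ∈ Icc 0 T,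
    ∫ x, h t x * φ x =
      (∫ x, h₀ x * φ x) +
        ∫ s in (0 : ℝ)..t, ((∫ x, h s x * laplacian φ x) + ∫ x, lowerOrder b c h s x * φ x)

/-- `sup_{t ∈ [0,T]} t^a ‖v_t‖_{C^δ}`. -/
def weightedSup {d : ℕ} (T a δ : ℝ) (v : ℝ → Torus d → ℝ) : ℝ≥0∞ :=
  ⨆ t ∈ Icc 0 T, ENNReal.ofReal (t ^ a) * holderNorm δ (v t)

/-- `h` is a weak solution of the form `h_t = P_t h₀ + v_t` with `v ∈ C([0,T]; C(𝕋^d))`, `v_0 = 0`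
and `sup_{t ∈ [0,T]} t^{γ/2} ‖v_t‖_{C^1} < ∞`. -/
structure IsStructuredSolution {d : ℕ} (T γ : ℝ) (b : ℝ → Torus d → EuclideanSpace ℝ (Fin d))
    (c : ℝ → Torus d → ℝ) (h₀ : Torus d → ℝ) (h v : ℝ → Torus d → ℝ) : Prop where
  weakSolution : IsWeakSolution T b c h₀ h
  decomp : ∀ t ∈ Icc 0 T, ∀ x, h t x = heat t h₀ x + v t x
  continuous : ContinuousOn (fun z : ℝ × Torus d => v z.1 z.2) (Icc 0 T ×ˢ univ)
  initial : ∀ x, v 0 x = 0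
  finite : weightedSup T (γ / 2) 1 v < ⊤

/-- `v ∈ L^r(0,T; C^δ(𝕋^d))` in the sense of Bochner: `t ↦ v_t` is almost everywhere a limit in `C^δ` of
simple functions with values in `C^δ`, and `t ↦ ‖v_t‖_{C^δ}` has finite `L^r` norm. -/
def MemLrHolder {d : ℕ} (T : ℝ) (r : ℝ≥0∞) (δ : ℝ) (v : ℝ → Torus d → ℝ) : Prop :=
  (∃ s : ℕ → SimpleFunc ℝ (Torus d → ℝ), (∀ n t, holderNorm δ (s n t) < ⊤) ∧
      ∀ᵐ t ∂(volume.restrict (Icc 0 T)),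
        Tendsto (fun n => holderNorm δ (s n t - v t)) atTop (𝓝 0)) ∧
    eLpNorm (fun t => holderNorm δ (v t)) r (volume.restrict (Icc 0 T)) < ⊤

end ParabolicTorus

end

open ParabolicTorus

noncomputable section

namespace ParabolicTorus

open UnitAddTorus

variable {d : ℕ}

/-! The equation is solved in mild form. With `g = b·∇h + c h`, Duhamel's formula reads `h_t = P_t
h₀ + ∫₀ᵗ P_{t-s} g_s ds`, so `v` is the heat potential of `g`. Since `∂ᵢ P_t h₀` is of size
`t^{-1/2} ‖h₀‖_∞`, one expects `h` and its gradient to be `O(t^{-1/2})`, hence `|g_s| ≤ N s^{-1/2}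
β_s` with `β ∈ L^q L^p` the sum of the absolute values of the coefficients. The heat semigroup maps
`L^p` to `L^∞` at the price `τ^{-d/(2p)}`; a derivative costs a further `τ^{-1/2}` and a `θ`-Hölder
seminorm a further `τ^{-θ/2}` (`exists_abs_conv_le`). Hölder's inequality in time
(`exists_lintegral_time_le`) bounds `∫₀ᵗ (t-s)^{-a} s^{-1/2} ‖β_s‖_p ds` by a multiple of
`t^{1/2-1/q-a}` when `a < 1 - 1/q`. For one derivative, `a = d/(2p) + 1/2`, this is exactly `γ < 1`;
for regularity `δ`, `a = d/(2p) + δ/2`, it is exactly `δ < 2 - γ`, and the resulting power of `t` is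
the weight of statement 3.

Existence: the unknowns are `h` and its `d` partial derivatives, treated as independent functions.
In the norm weighted by `e^{-Lt} t^{1/2}` with `L` large, the Duhamel map is a contraction on all of
`[0,T]` (`exists_contraction`, `exists_mild_solution`), so the bounds are linear in `‖h₀‖_∞`. The
fixed point equation itself then shows that the components are a function and its gradient
(`hasFDerivAt_potential`). Fubini and Duhamel's formula for smooth test functions turn the mild
equation into the weak one (`integral_potential_mul_smooth`, `isWeakSolution_of_mild`).

Uniqueness: the difference of two structured solutions, minus the potential of its own lower order
term, is a continuous weak solution of the heat equation with zero initial value. It vanishes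
because its Fourier coefficients do (`eq_zero_of_weak_heat`). The difference thus solves the
homogeneous mild equation and is zero by the contraction estimate (`eq_zero_of_eq_potential`).

The heat kernel is built as a Fourier series; its identification with the Gaussian convolution
`heat` is checked on characters, whose span is dense. -/

instance instIsProbabilityMeasureCircle :
    IsProbabilityMeasure (volume : Measure UnitAddCircle) :=
  ⟨by simp [AddCircle.measure_univ]⟩

/-! ### Characters of the torus and their density. -/

lemma mFourier_add_apply (n : Fin d → ℤ) (x y : Torus d) :
    mFourier n (x + y) = mFourier n x * mFourier n y := by
  simp [mFourier, fourier_apply, smul_add, AddCircle.toCircle_add, Finset.prod_mul_distrib]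

lemma mFourier_neg_apply (n : Fin d → ℤ) (x : Torus d) :
    mFourier n (-x) = mFourier (-n) x := by
  simp [mFourier, fourier_apply]

lemma mFourier_sub_apply (n : Fin d → ℤ) (x y : Torus d) :
    mFourier n (x - y) = mFourier n x * mFourier (-n) y := by
  rw [sub_eq_add_neg, mFourier_add_apply, mFourier_neg_apply]

lemma norm_mFourier_apply (n : Fin d → ℤ) (x : Torus d) : ‖mFourier n x‖ = 1 := by
  simp only [mFourier, fourier_apply, ContinuousMap.coe_mk, norm_prod, Circle.norm_coe,
    Finset.prod_const_one]

lemma mFourier_coe (n : Fin d → ℤ) (x : Fin d → ℝ) :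
    mFourier n (fun i => (x i : UnitAddCircle)) =
      Complex.exp (2 * Real.pi * Complex.I * ∑ i, (n i : ℂ) * x i) := by
  simp only [mFourier, ContinuousMap.coe_mk, fourier_coe_apply]
  rw [← Complex.exp_sum, Finset.mul_sum]
  congr 1
  refine Finset.sum_congr rfl fun i _ => ?_
  simp; ring

/-- For `n ≠ 0`, translation by a point `a` with `mFourier n a = -1` preserves the integral and also
changes its sign. -/
lemma integral_mFourier (n : Fin d → ℤ) :
    ∫ x : Torus d, mFourier n x = if n = 0 then 1 else 0 := by
  split_ifs with h
  · subst h; simp [mFourier_zero]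
  · obtain ⟨i, hi⟩ := Function.ne_iff.mp h
    have hi' : (n i : ℝ) ≠ 0 := by exact_mod_cast hi
    set a : Torus d := fun j => (((Pi.single i (1 / (2 * n i : ℝ)) : Fin d → ℝ) j : ℝ) : UnitAddCircle)
    have ha : mFourier n a = -1 := by
      rw [mFourier_coe, Finset.sum_eq_single i]
      · have hc : (n i : ℂ) ≠ 0 := by exact_mod_cast hi
        rw [← Complex.exp_pi_mul_I]
        congr 1
        simp
        field_simp
      · intro j _ hj; simp [hj]
      · simp
    have := integral_add_right_eq_self (μ := (volume : Measure (Torus d)))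
      (fun x => mFourier n x) a
    simp only [mFourier_add_apply, ha, integral_mul_const] at this
    have h2 : (2 : ℂ) * ∫ x : Torus d, mFourier n x = 0 := by linear_combination -this
    simpa using h2

/-- The characters span a dense subspace of the continuous functions, so identities between
continuous functionals need checking on characters only. The convolution and Gaussian formulas below
are all obtained in this way. -/
lemma clm_ext_mFourier {E : Type*} [NormedAddCommGroup E] [NormedSpace ℂ E]
    {L M : C(Torus d, ℂ) →L[ℂ] E}
    (h : ∀ n, L (mFourier n) = M (mFourier n)) : L = M := by
  refine ContinuousLinearMap.ext_on (s := range (mFourier (d := Fin d))) ?_ ?_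
  · rw [Submodule.dense_iff_topologicalClosure_eq_top]
    exact span_mFourier_closure_eq_top
  · rintro _ ⟨n, rfl⟩; exact h n

/-- The functional `F ↦ ∫ F(φ w) ρ(w) dμ(w)` on continuous functions on the torus. -/
def pairing {Ω : Type*} [MeasurableSpace Ω] (μ : Measure Ω) (φ : Ω → Torus d) (hφ : Measurable φ)
    (ρ : Ω → ℂ) (hρ : Integrable ρ μ) : C(Torus d, ℂ) →L[ℂ] ℂ :=
  have hint : ∀ F : C(Torus d, ℂ), Integrable (fun w => F (φ w) * ρ w) μ := fun F =>
    hρ.bdd_mul (F.continuous.measurable.comp hφ).aestronglyMeasurable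
      (Eventually.of_forall fun w => F.norm_coe_le_norm (φ w))
  LinearMap.mkContinuous
    { toFun := fun F => ∫ w, F (φ w) * ρ w ∂μ
      map_add' := fun F G => by
        simp only [ContinuousMap.add_apply, add_mul]
        exact integral_add (hint F) (hint G)
      map_smul' := fun c F => by
        simp only [ContinuousMap.smul_apply, smul_eq_mul, mul_assoc, integral_const_mul,
          RingHom.id_apply] }
    (∫ w, ‖ρ w‖ ∂μ) fun F => by
      refine (norm_integral_le_integral_norm _).trans ?_
      rw [mul_comm, ← integral_const_mul]
      refine integral_mono (hint F).norm (hρ.norm.const_mul _) fun w => ?_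
      simp only [norm_mul]
      gcongr
      exact F.norm_coe_le_norm _

lemma pairing_apply {Ω : Type*} [MeasurableSpace Ω] (μ : Measure Ω) (φ : Ω → Torus d)
    (hφ : Measurable φ) (ρ : Ω → ℂ) (hρ : Integrable ρ μ) (F : C(Torus d, ℂ)) :
    pairing μ φ hφ ρ hρ F = ∫ w, F (φ w) * ρ w ∂μ := rfl

lemma continuous_integrable_torus {E : Type*} [NormedAddCommGroup E] {f : Torus d → E}
    (hf : Continuous f) : Integrable f volume :=
  hf.integrable_of_hasCompactSupport (HasCompactSupport.of_compactSpace f)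

/-- A continuous function on the torus all of whose Fourier coefficients vanish is zero. -/
lemma eq_zero_of_integral_mFourier (f : C(Torus d, ℂ))
    (h : ∀ n, ∫ x, mFourier n x * f x = 0) : f = 0 := by
  have hp : pairing volume id measurable_id f (continuous_integrable_torus f.continuous) = 0 :=
    clm_ext_mFourier fun n => by rw [pairing_apply]; exact h n
  -- The pairing with `f` kills all characters, hence every continuous function; applied to the
  -- conjugate of `f` it gives the square of the `L²` norm.
  have h1 : ∫ x, star (f x) * f x = 0 := by
    have := congrArg (fun L => L (star f)) hp
    simpa [pairing_apply] using this
  have h2 : ∫ x, ‖f x‖ ^ 2 = 0 := by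
    have h3 : ∀ x, star (f x) * f x = ((‖f x‖ ^ 2 : ℝ) : ℂ) := fun x => by
      rw [mul_comm]
      simpa using Complex.mul_conj' (f x)
    simp_rw [h3] at h1
    rw [integral_complex_ofReal] at h1
    exact_mod_cast h1
  have h4 : (fun x => ‖f x‖ ^ 2) = 0 := by
    have h5 := (integral_eq_zero_iff_of_nonneg (fun x => sq_nonneg ‖f x‖)
      (continuous_integrable_torus (f.continuous.norm.pow 2))).mp h2
    exact (Continuous.ae_eq_iff_eq volume (f.continuous.norm.pow 2) continuous_const).mp h5
  ext x
  simpa using congrFun h4 x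

/-! ### Absolutely convergent trigonometric series and their convolutions. -/

/-- The trigonometric series with coefficients `a`. -/
def trigSeries (a : (Fin d → ℤ) → ℂ) : C(Torus d, ℂ) := ∑' n, a n • mFourier n

lemma hasSum_trigSeries {a : (Fin d → ℤ) → ℂ} (ha : Summable fun n => ‖a n‖) :
    HasSum (fun n => a n • mFourier n) (trigSeries a) := by
  refine Summable.hasSum (Summable.of_norm ?_)
  simpa [norm_smul, mFourier_norm] using ha

lemma norm_trigSeries_le {a : (Fin d → ℤ) → ℂ} (ha : Summable fun n => ‖a n‖) :
    ‖trigSeries a‖ ≤ ∑' n, ‖a n‖ := by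
  have := norm_tsum_le_tsum_norm (f := fun n => a n • mFourier (d := Fin d) n)
    (by simpa [norm_smul, mFourier_norm] using ha)
  simp only [norm_smul, mFourier_norm, mul_one] at this
  exact this

lemma trigSeries_apply {a : (Fin d → ℤ) → ℂ} (ha : Summable fun n => ‖a n‖) (x : Torus d) :
    HasSum (fun n => a n * mFourier n x) (trigSeries a x) := by
  simpa using (ContinuousMap.evalCLM ℂ x).hasSum (hasSum_trigSeries ha)

lemma clm_trigSeries {a : (Fin d → ℤ) → ℂ} (ha : Summable fun n => ‖a n‖)
    (L : C(Torus d, ℂ) →L[ℂ] ℂ) :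
    L (trigSeries a) = ∑' n, a n * L (mFourier n) := by
  rw [← (L.hasSum (hasSum_trigSeries ha)).tsum_eq]
  simp

lemma integral_mFourier_mul_trigSeries {a : (Fin d → ℤ) → ℂ} (ha : Summable fun n => ‖a n‖)
    (n : Fin d → ℤ) (x : Torus d) :
    ∫ y, mFourier n y * trigSeries a (x - y) = a n * mFourier n x := by
  have h := clm_trigSeries ha (pairing volume (fun y => x - y) (by fun_prop) (mFourier n)
    (continuous_integrable_torus (mFourier n).continuous))
  simp only [pairing_apply] at h
  simp_rw [mul_comm (mFourier n _)]
  rw [h, tsum_eq_single n]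
  · congr 1
    simp_rw [mFourier_sub_apply, mul_assoc, ← mFourier_add]
    simp [mFourier_zero]
  · intro m hm
    simp_rw [mFourier_sub_apply, mul_assoc, ← mFourier_add]
    rw [integral_const_mul, integral_mFourier, if_neg]
    · simp
    · intro h0
      apply hm
      have := neg_add_eq_zero.mp h0
      exact this

/-- Convolution multiplies Fourier coefficients: expand the series of `b` and use the case of a
single character. -/
lemma integral_trigSeries_mul_trigSeries {a b : (Fin d → ℤ) → ℂ}
    (ha : Summable fun n => ‖a n‖) (hb : Summable fun n => ‖b n‖)
    (x : Torus d) :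
    ∫ y, trigSeries b y * trigSeries a (x - y) = trigSeries (fun n => a n * b n) x := by
  have hab : Summable fun n => ‖a n * b n‖ := by
    simp_rw [norm_mul]
    exact ha.mul_norm hb |>.comp_injective (i := fun n => (n, n)) (fun _ _ h => (Prod.ext_iff.1 h).1)
      |>.congr fun n => by simp
  have h := clm_trigSeries hb (pairing volume id measurable_id (fun y => trigSeries a (x - y))
    (continuous_integrable_torus (by fun_prop)))
  simp only [pairing_apply, id] at h
  rw [h, ← (trigSeries_apply hab x).tsum_eq]
  refine tsum_congr fun n => ?_
  rw [integral_mFourier_mul_trigSeries ha]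
  ring

/-! ### Theta series and the small-time size of the heat trace. -/

lemma summable_exp_neg_mul_int_sq {a : ℝ} (ha : 0 < a) :
    Summable fun m : ℤ => Real.exp (-a * (m : ℝ) ^ 2) := by
  have h : Summable fun m : ℕ => Real.exp (-a * (m : ℝ) ^ 2) := by
    refine Summable.of_nonneg_of_le (fun _ => (Real.exp_pos _).le) (fun m => ?_)
      (Real.summable_exp_nat_mul_iff.mpr (neg_lt_zero.mpr ha))
    rw [Real.exp_le_exp]
    have h1 : (m : ℝ) ≤ (m : ℝ) ^ 2 := by
      exact_mod_cast Nat.le_self_pow two_ne_zero m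
    nlinarith
  refine Summable.of_nat_of_neg (by simpa using h) (by simpa using h)

/-- The one-dimensional theta series `∑ exp (-a m²)`. -/
def thetaSum (a : ℝ) : ℝ := ∑' m : ℤ, Real.exp (-a * (m : ℝ) ^ 2)

lemma thetaSum_nonneg (a : ℝ) : 0 ≤ thetaSum a := tsum_nonneg fun _ => (Real.exp_pos _).le

lemma thetaSum_anti {a b : ℝ} (ha : 0 < a) (hab : a ≤ b) : thetaSum b ≤ thetaSum a := by
  refine Summable.tsum_le_tsum (fun m => ?_) (summable_exp_neg_mul_int_sq (ha.trans_le hab))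
    (summable_exp_neg_mul_int_sq ha)
  rw [Real.exp_le_exp]
  nlinarith [sq_nonneg (m : ℝ)]

/-- Poisson summation exchanges the parameter `4π²τ` for `1/(4τ)` at the price `(4πτ)^{-1/2} ≤
τ^{-1/2}`. For `τ ≤ T` the dual series is at most its value at `1/(4T)`. -/
lemma thetaSum_le {T τ : ℝ} (hτ : 0 < τ) (hτT : τ ≤ T) :
    thetaSum (4 * Real.pi ^ 2 * τ) ≤ thetaSum (1 / (4 * T)) * τ ^ (-(1 / 2) : ℝ) := by
  have hT := hτ.trans_le hτT
  have hpi := Real.pi_gt_three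
  have h := Real.tsum_exp_neg_mul_int_sq (a := 4 * Real.pi * τ) (by positivity)
  have h1 : thetaSum (4 * Real.pi ^ 2 * τ) =
      1 / (4 * Real.pi * τ) ^ (1 / 2 : ℝ) * thetaSum (1 / (4 * τ)) := by
    unfold thetaSum
    convert h using 3
    · congr 1; ring
    · ext m; congr 1; field_simp
  rw [h1, mul_comm]
  have h2 : 1 / (4 * Real.pi * τ) ^ (1 / 2 : ℝ) ≤ τ ^ (-(1 / 2) : ℝ) := by
    rw [Real.rpow_neg hτ.le, one_div]
    gcongr
    nlinarith
  gcongr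
  · exact thetaSum_nonneg _
  · exact thetaSum_anti (by positivity) (by gcongr)

/-- The eigenvalues of `-Δ` on the torus. -/
def lam (n : Fin d → ℤ) : ℝ := 4 * Real.pi ^ 2 * ∑ i, (n i : ℝ) ^ 2

lemma lam_nonneg (n : Fin d → ℤ) : 0 ≤ lam n := by unfold lam; positivity

/-- A finite set of frequencies lies in a box, over which the sum factors into `d` one-dimensional
theta sums. -/
lemma sum_exp_lam_le {τ : ℝ} (hτ : 0 < τ) (u : Finset (Fin d → ℤ)) :
    ∑ n ∈ u, Real.exp (-lam n * τ) ≤ thetaSum (4 * Real.pi ^ 2 * τ) ^ d := by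
  classical
  have hpi := Real.pi_pos
  set S : Fin d → Finset ℤ := fun i => u.image fun n => n i
  have hsub : u ⊆ Fintype.piFinset S := fun n hn => by
    rw [Fintype.mem_piFinset]
    exact fun i => Finset.mem_image_of_mem _ hn
  have hexp : ∀ n : Fin d → ℤ, Real.exp (-lam n * τ) =
      ∏ i, Real.exp (-(4 * Real.pi ^ 2 * τ) * (n i : ℝ) ^ 2) := fun n => by
    rw [← Real.exp_sum, ← Finset.mul_sum, lam]
    congr 1; ring
  calc ∑ n ∈ u, Real.exp (-lam n * τ)
      ≤ ∑ n ∈ Fintype.piFinset S, Real.exp (-lam n * τ) :=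
        Finset.sum_le_sum_of_subset_of_nonneg hsub fun _ _ _ => (Real.exp_pos _).le
    _ = ∏ i, ∑ m ∈ S i, Real.exp (-(4 * Real.pi ^ 2 * τ) * (m : ℝ) ^ 2) := by
        rw [Finset.prod_univ_sum]
        exact Finset.sum_congr rfl fun n _ => hexp n
    _ ≤ ∏ _i : Fin d, thetaSum (4 * Real.pi ^ 2 * τ) := by
        refine Finset.prod_le_prod (fun i _ => Finset.sum_nonneg fun _ _ => (Real.exp_pos _).le)
          fun i _ => ?_
        exact (summable_exp_neg_mul_int_sq (by positivity)).sum_le_tsum _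
          fun _ _ => (Real.exp_pos _).le
    _ = _ := by simp

lemma summable_exp_lam {τ : ℝ} (hτ : 0 < τ) :
    Summable fun n : Fin d → ℤ => Real.exp (-lam n * τ) :=
  summable_of_sum_le (fun _ => (Real.exp_pos _).le) (sum_exp_lam_le hτ)

lemma exists_tsum_exp_lam_le (d : ℕ) (T : ℝ) : ∃ C : ℝ, 0 ≤ C ∧ ∀ τ, 0 < τ → τ ≤ T →
    ∑' n : Fin d → ℤ, Real.exp (-lam n * τ) ≤ C * τ ^ (-(d / 2 : ℝ)) := by
  refine ⟨thetaSum (1 / (4 * T)) ^ d, pow_nonneg (thetaSum_nonneg _) _, fun τ hτ hτT => ?_⟩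
  have h1 : ∑' n : Fin d → ℤ, Real.exp (-lam n * τ) ≤ thetaSum (4 * Real.pi ^ 2 * τ) ^ d :=
    (summable_exp_lam hτ).tsum_le_of_sum_le (sum_exp_lam_le hτ)
  have h2 := pow_le_pow_left₀ (thetaSum_nonneg _) (thetaSum_le hτ hτT) d
  refine h1.trans (h2.trans (le_of_eq ?_))
  rw [mul_pow, ← Real.rpow_natCast (τ ^ _), ← Real.rpow_mul hτ.le]
  congr 2; ring

/-! ### The heat kernel and its first derivatives as Fourier series. -/

/-- The Fourier multiplier of the identity (`none`) and of `∂ᵢ` (`some i`). -/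
def freq (j : Option (Fin d)) (n : Fin d → ℤ) : ℂ :=
  match j with
  | none => 1
  | some i => 2 * Real.pi * Complex.I * n i

/-- The Fourier coefficients of the heat kernel (`none`) and its derivatives (`some i`). -/
def coef (j : Option (Fin d)) (τ : ℝ) (n : Fin d → ℤ) : ℂ :=
  freq j n * (Real.exp (-lam n * τ) : ℝ)

lemma norm_freq_le (j : Option (Fin d)) (n : Fin d → ℤ) : ‖freq j n‖ ≤ 1 + lam n := by
  rcases j with _ | i
  · simpa [freq] using lam_nonneg n
  · have hpi := Real.pi_pos
    have h1 : (n i : ℝ) ^ 2 ≤ ∑ i, (n i : ℝ) ^ 2 :=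
      Finset.single_le_sum (f := fun i => (n i : ℝ) ^ 2) (fun _ _ => sq_nonneg _)
        (Finset.mem_univ i)
    have h2 : ‖freq (some i) n‖ = 2 * Real.pi * |(n i : ℝ)| := by
      simp [freq, abs_of_pos hpi]
    have h3 : (2 * Real.pi * |(n i : ℝ)|) ^ 2 ≤ lam n := by
      rw [mul_pow, sq_abs, lam, mul_pow]
      have : 0 ≤ Real.pi ^ 2 := by positivity
      nlinarith
    rw [h2]
    nlinarith [sq_nonneg (2 * Real.pi * |(n i : ℝ)| - 1)]

lemma norm_coef (j : Option (Fin d)) (τ : ℝ) (n : Fin d → ℤ) :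
    ‖coef j τ n‖ = ‖freq j n‖ * Real.exp (-lam n * τ) := by
  rw [coef, norm_mul, Complex.norm_real, Real.norm_of_nonneg (Real.exp_pos _).le]

/-- Half of the exponential decay absorbs the frequency factor, since `lam n ≤ (2/τ) exp (lam n ·
τ/2)`; the other half is summable. -/
lemma summable_norm_coef (j : Option (Fin d)) {τ : ℝ} (hτ : 0 < τ) :
    Summable fun n => ‖coef j τ n‖ := by
  refine Summable.of_nonneg_of_le (fun _ => norm_nonneg _) (fun n => ?_)
    ((summable_exp_lam (half_pos hτ)).mul_left (1 + 2 / τ))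
  rw [norm_coef]
  have h1 : lam n * (τ / 2) + 1 ≤ Real.exp (lam n * (τ / 2)) := Real.add_one_le_exp _
  have hl := lam_nonneg n
  have h2 : 1 + lam n ≤ (1 + 2 / τ) * Real.exp (lam n * (τ / 2)) := by
    have h3 : lam n ≤ 2 / τ * Real.exp (lam n * (τ / 2)) := by
      have : 2 / τ * (lam n * (τ / 2)) ≤ 2 / τ * Real.exp (lam n * (τ / 2)) := by
        gcongr; linarith
      calc lam n = 2 / τ * (lam n * (τ / 2)) := by field_simp
        _ ≤ _ := this
    have h4 : 0 ≤ lam n * (τ / 2) := by positivity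
    linarith
  calc ‖freq j n‖ * Real.exp (-lam n * τ)
      ≤ ((1 + 2 / τ) * Real.exp (lam n * (τ / 2))) * Real.exp (-lam n * τ) := by
        gcongr
        exact (norm_freq_le j n).trans h2
    _ = _ := by
        rw [mul_assoc, ← Real.exp_add]
        congr 2; ring

lemma norm_coef_anti (j : Option (Fin d)) {σ τ : ℝ} (h : σ ≤ τ) (n : Fin d → ℤ) :
    ‖coef j τ n‖ ≤ ‖coef j σ n‖ := by
  rw [norm_coef, norm_coef]
  gcongr 1
  rw [Real.exp_le_exp]
  nlinarith [lam_nonneg n]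

/-- The complex heat kernel on the torus and its derivatives. -/
def kernelC (j : Option (Fin d)) (τ : ℝ) : C(Torus d, ℂ) := trigSeries (coef j τ)

/-- The heat kernel on the torus (`none`) and its derivatives (`some i`). -/
def kernel (j : Option (Fin d)) (τ : ℝ) (x : Torus d) : ℝ := (kernelC j τ x).re

/-- Continuity in the supremum norm: on `(τ/2, ∞)` the terms are dominated by their values at time
`τ/2`. -/
lemma continuousOn_kernelC (j : Option (Fin d)) :
    ContinuousOn (kernelC j) (Ioi (0 : ℝ)) := by
  intro τ hτ
  have hτ' : 0 < τ := hτ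
  have h : ContinuousOn (kernelC j) (Ioi (τ / 2)) := by
    unfold kernelC trigSeries
    refine continuousOn_tsum (u := fun n => ‖coef j (τ / 2) n‖) (fun n => ?_)
      (summable_norm_coef j (half_pos hτ')) (fun n σ hσ => ?_)
    · refine Continuous.continuousOn ?_
      unfold coef
      fun_prop
    · rw [norm_smul, mFourier_norm, mul_one]
      exact norm_coef_anti j (le_of_lt hσ) n
  exact (h.continuousAt (Ioi_mem_nhds (half_lt_self hτ'))).continuousWithinAt

lemma continuousOn_kernel (j : Option (Fin d)) :
    ContinuousOn (fun z : ℝ × Torus d => kernel j z.1 z.2) (Ioi (0 : ℝ) ×ˢ univ) := by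
  have h : ContinuousOn (fun z : ℝ × Torus d => kernelC j z.1 z.2) (Ioi (0 : ℝ) ×ˢ univ) := by
    have h1 : ContinuousOn (fun z : ℝ × Torus d => (kernelC j z.1, z.2)) (Ioi (0 : ℝ) ×ˢ univ) :=
      ((continuousOn_kernelC j).comp continuousOn_fst fun z hz => hz.1).prodMk continuousOn_snd
    exact continuous_eval.comp_continuousOn h1
  exact Complex.continuous_re.comp_continuousOn h

lemma continuous_kernel (j : Option (Fin d)) (τ : ℝ) : Continuous (kernel j τ) :=
  Complex.continuous_re.comp (kernelC j τ).continuous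

/-- A bound for the kernels on `[τ, ∞)`. -/
def kernelBound (j : Option (Fin d)) (τ : ℝ) : ℝ := ∑' n, ‖coef j τ n‖

lemma kernelBound_nonneg (j : Option (Fin d)) (τ : ℝ) : 0 ≤ kernelBound j τ :=
  tsum_nonneg fun _ => norm_nonneg _

lemma abs_kernel_le (j : Option (Fin d)) {σ τ : ℝ} (hσ : 0 < σ) (h : σ ≤ τ) (x : Torus d) :
    |kernel j τ x| ≤ kernelBound j σ := by
  have hτ := hσ.trans_le h
  calc |kernel j τ x| ≤ ‖kernelC j τ x‖ := Complex.abs_re_le_norm _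
    _ ≤ ‖kernelC j τ‖ := (kernelC j τ).norm_coe_le_norm x
    _ ≤ ∑' n, ‖coef j τ n‖ := norm_trigSeries_le (summable_norm_coef j hτ)
    _ ≤ _ := Summable.tsum_le_tsum (norm_coef_anti j h) (summable_norm_coef j hτ)
        (summable_norm_coef j hσ)

lemma conj_freq (j : Option (Fin d)) (n : Fin d → ℤ) :
    (starRingEnd ℂ) (freq j n) = freq j (-n) := by
  rcases j with _ | i <;> simp [freq, map_ofNat]

lemma lam_neg (n : Fin d → ℤ) : lam (-n) = lam n := by simp [lam]

/-- The coefficients at `n` and `-n` are complex conjugates, so the series is real. No information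
is lost by taking real parts. -/
lemma ofReal_kernel (j : Option (Fin d)) {τ : ℝ} (hτ : 0 < τ) (x : Torus d) :
    (kernel j τ x : ℂ) = kernelC j τ x := by
  rw [kernel, ← Complex.conj_eq_iff_re]
  have h := trigSeries_apply (summable_norm_coef j hτ) x
  have h1 := (Complex.hasSum_conj'.mpr h)
  have h2 : HasSum (fun n => coef j τ n * mFourier n x)
      ((starRingEnd ℂ) (trigSeries (coef j τ) x)) := by
    rw [← (Equiv.neg (Fin d → ℤ)).hasSum_iff]
    convert h1 using 1
    ext n
    simp only [Function.comp_apply, Equiv.neg_apply, coef, map_mul, conj_freq, lam_neg,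
      Complex.conj_ofReal, mFourier_neg]
  exact h2.unique h

/-- The covector with components `a`. -/
def covector (a : Fin d → ℝ) : EuclideanSpace ℝ (Fin d) →L[ℝ] ℝ :=
  ∑ i, a i • EuclideanSpace.proj i

lemma covector_apply (a : Fin d → ℝ) (x : EuclideanSpace ℝ (Fin d)) :
    covector a x = ∑ i, a i * x i := by
  simp [covector]

lemma norm_proj_le (i : Fin d) :
    ‖(EuclideanSpace.proj i : EuclideanSpace ℝ (Fin d) →L[ℝ] ℝ)‖ ≤ 1 :=
  ContinuousLinearMap.opNorm_le_bound _ zero_le_one fun x => by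
    simpa using PiLp.norm_apply_le x i

lemma norm_covector_le (a : Fin d → ℝ) : ‖covector a‖ ≤ ∑ i, |a i| := by
  refine (norm_sum_le _ _).trans (Finset.sum_le_sum fun i _ => ?_)
  rw [norm_smul, Real.norm_eq_abs]
  exact mul_le_of_le_one_right (abs_nonneg _) (norm_proj_le i)

lemma covector_sub (a b : Fin d → ℝ) : covector a - covector b = covector (a - b) := by
  ext x; simp [covector_apply, sub_mul]

lemma hasFDerivAt_mFourier_proj (n : Fin d → ℤ) (y : EuclideanSpace ℝ (Fin d)) :
    HasFDerivAt (fun y : EuclideanSpace ℝ (Fin d) => mFourier n (proj y))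
      (∑ i, (freq (some i) n * mFourier n (proj y)) •
        (Complex.ofRealCLM.comp (EuclideanSpace.proj i))) y := by
  set l : EuclideanSpace ℝ (Fin d) →L[ℝ] ℂ :=
    ∑ i, freq (some i) n • (Complex.ofRealCLM.comp (EuclideanSpace.proj i)) with hl
  have h1 : ∀ y : EuclideanSpace ℝ (Fin d), mFourier n (proj y) = Complex.exp (l y) := fun y => by
    have := mFourier_coe n (fun i => y i)
    refine this.trans ?_
    congr 1
    simp [hl, freq, Finset.mul_sum, mul_assoc]
  simp_rw [h1]
  refine l.hasFDerivAt.cexp.congr_fderiv ?_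
  rw [hl, Finset.smul_sum]
  refine Finset.sum_congr rfl fun i _ => ?_
  rw [smul_smul, mul_comm]

/-- Termwise differentiation; the differentiated series is dominated by the coefficients of the
derivative kernels. -/
lemma hasFDerivAt_kernelC {τ : ℝ} (hτ : 0 < τ) (y : EuclideanSpace ℝ (Fin d)) :
    HasFDerivAt (fun y : EuclideanSpace ℝ (Fin d) => kernelC none τ (proj y))
      (∑ i, kernelC (some i) τ (proj y) • (Complex.ofRealCLM.comp (EuclideanSpace.proj i))) y := by
  have h0 : ∀ y : EuclideanSpace ℝ (Fin d), kernelC none τ (proj y) =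
      ∑' n, coef none τ n * mFourier n (proj y) := fun y =>
    (trigSeries_apply (summable_norm_coef none hτ) _).tsum_eq.symm
  simp_rw [h0]
  have hnorm : ∀ i : Fin d, ‖Complex.ofRealCLM.comp
      (EuclideanSpace.proj i : EuclideanSpace ℝ (Fin d) →L[ℝ] ℝ)‖ ≤ 1 := fun i => by
    refine (ContinuousLinearMap.opNorm_comp_le _ _).trans ?_
    rw [Complex.ofRealCLM_norm, one_mul]
    exact norm_proj_le i
  have h := hasFDerivAt_tsum (𝕜 := ℝ) (u := fun n => ∑ i, ‖coef (some i) τ n‖)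
    (f := fun n (y : EuclideanSpace ℝ (Fin d)) => coef none τ n * mFourier n (proj y))
    (f' := fun n y => coef none τ n • ∑ i, (freq (some i) n * mFourier n (proj y)) •
        (Complex.ofRealCLM.comp (EuclideanSpace.proj i)))
    (x₀ := y)
    (summable_sum fun i _ => summable_norm_coef (some i) hτ)
    (fun n y => (hasFDerivAt_mFourier_proj n y).const_mul _)
    (fun n y => ?_) (trigSeries_apply (summable_norm_coef none hτ) _).summable y
  · refine h.congr_fderiv ?_
    refine HasSum.tsum_eq ?_
    simp_rw [Finset.smul_sum]
    refine hasSum_sum fun i _ => ?_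
    have h2 := (trigSeries_apply (summable_norm_coef (some i) hτ) (proj y)).smul_const
      (Complex.ofRealCLM.comp (EuclideanSpace.proj i : EuclideanSpace ℝ (Fin d) →L[ℝ] ℝ))
    convert h2 using 1
    · ext1 n
      rw [smul_smul]
      congr 1
      simp [coef, freq]; ring
    · rfl
  · rw [Finset.smul_sum]
    refine (norm_sum_le _ _).trans (Finset.sum_le_sum fun i _ => ?_)
    rw [smul_smul, norm_smul]
    refine (mul_le_of_le_one_right (norm_nonneg _) (hnorm i)).trans (le_of_eq ?_)
    rw [norm_mul, norm_mul, norm_mFourier_apply, norm_coef, norm_coef]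
    simp [freq]; ring

lemma hasFDerivAt_kernel {τ : ℝ} (hτ : 0 < τ) (y : EuclideanSpace ℝ (Fin d)) :
    HasFDerivAt (fun y : EuclideanSpace ℝ (Fin d) => kernel none τ (proj y))
      (covector fun i => kernel (some i) τ (proj y)) y := by
  have h := Complex.reCLM.hasFDerivAt.comp y (hasFDerivAt_kernelC hτ y)
  refine h.congr_fderiv ?_
  ext v
  simp [covector_apply, kernel]

lemma proj_surjective : Function.Surjective (proj (d := d)) := fun x => by
  choose y hy using fun i => QuotientAddGroup.mk_surjective (x i)
  exact ⟨WithLp.toLp 2 y, funext hy⟩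

lemma continuous_proj : Continuous (proj (d := d)) := by
  unfold proj
  refine continuous_pi fun i => ?_
  exact (AddCircle.continuous_mk' 1).comp (EuclideanSpace.proj i).continuous

lemma proj_sub (x y : EuclideanSpace ℝ (Fin d)) : proj (x - y) = proj x - proj y := rfl

lemma hasFDerivAt_kernel_sub {τ : ℝ} (hτ : 0 < τ) (y : Torus d) (x : EuclideanSpace ℝ (Fin d)) :
    HasFDerivAt (fun x : EuclideanSpace ℝ (Fin d) => kernel none τ (proj x - y))
      (covector fun i => kernel (some i) τ (proj x - y)) x := by
  obtain ⟨y, rfl⟩ := proj_surjective y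
  have h := (hasFDerivAt_kernel hτ (x - y)).comp x ((hasFDerivAt_id x).sub_const y)
  simpa [proj_sub, Function.comp_def] using h

/-! ### Gaussian representation of the heat semigroup and its gradient. -/

lemma integral_cexp_gaussianReal (v : ℝ≥0) (z : ℂ) :
    ∫ y, Complex.exp (z * y) ∂(gaussianReal 0 v) = Complex.exp (v * z ^ 2 / 2) := by
  have := complexMGF_id_gaussianReal (μ := 0) (v := v) z
  simpa [complexMGF] using this

/-- This is the `z`-derivative of the Gaussian exponential moment `exp (v z² / 2)`. -/
lemma integral_id_mul_cexp_gaussianReal (v : ℝ≥0) (z : ℂ) :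
    ∫ y : ℝ, (y : ℂ) * Complex.exp (z * y) ∂(gaussianReal 0 v) =
      v * z * Complex.exp (v * z ^ 2 / 2) := by
  have h1 := hasDerivAt_complexMGF (X := id) (μ := gaussianReal 0 v) (z := z)
    (by simp [integrableExpSet_id_gaussianReal])
  have h2 : HasDerivAt (complexMGF id (gaussianReal 0 v))
      (Complex.exp (v * z ^ 2 / 2) * (v * z)) z := by
    have : complexMGF id (gaussianReal 0 v) = fun z : ℂ => Complex.exp (v * z ^ 2 / 2) := by
      ext z; simpa using complexMGF_id_gaussianReal (μ := 0) (v := v) z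
    rw [this]
    have h3 : HasDerivAt (fun z : ℂ => (v : ℂ) * z ^ 2 / 2) (v * z) z := by
      have := (((hasDerivAt_id z).pow 2).const_mul (v : ℂ)).div_const 2
      refine this.congr_deriv ?_
      simp; ring
    exact h3.cexp
  rw [mul_comm, ← h1.unique h2]
  simp

/-- The Gaussian law with covariance `2τ·Id`. -/
def gaussN (d : ℕ) (τ : ℝ) : Measure (Fin d → ℝ) :=
  Measure.pi fun _ : Fin d => gaussianReal 0 (2 * τ).toNNReal

instance (d : ℕ) (τ : ℝ) : IsProbabilityMeasure (gaussN d τ) := by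
  unfold gaussN; infer_instance

/-- The projection `ℝ^d → ℝ^d / ℤ^d` on plain tuples. -/
def coeTorus (y : Fin d → ℝ) : Torus d := fun i => (y i : UnitAddCircle)

lemma measurable_coeTorus : Measurable (coeTorus (d := d)) :=
  measurable_pi_lambda _ fun i => AddCircle.measurable_mk'.comp (measurable_pi_apply i)

/-- The weights in the Gaussian representation of the heat semigroup and its derivatives. -/
def weight (j : Option (Fin d)) (τ : ℝ) (y : Fin d → ℝ) : ℝ :=
  match j with
  | none => 1
  | some i => y i / (2 * τ)

lemma integrable_apply_sq_gaussN (τ : ℝ) (i : Fin d) :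
    MemLp (fun y : Fin d → ℝ => y i) 2 (gaussN d τ) := by
  have h := memLp_id_gaussianReal' (μ := 0) (v := (2 * τ).toNNReal) 2 (by simp)
  exact h.comp_measurePreserving (measurePreserving_eval _ i)

lemma integrable_weight (j : Option (Fin d)) (τ : ℝ) :
    Integrable (weight j τ) (gaussN d τ) := by
  rcases j with _ | i
  · exact integrable_const (1 : ℝ)
  · exact ((integrable_apply_sq_gaussN τ i).integrable one_le_two).div_const _

lemma integral_abs_weight_none (τ : ℝ) : ∫ y, |weight none τ y| ∂(gaussN d τ) = 1 := by
  simp [weight]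

/-- The inequality `|y|/(2τ) ≤ y²/(4τ√τ) + 1/(4√τ)` and the second moment `2τ` give the bound
`3/(4√τ)`. -/
lemma integral_abs_weight_some {τ : ℝ} (hτ : 0 < τ) (i : Fin d) :
    ∫ y, |weight (some i) τ y| ∂(gaussN d τ) ≤ τ ^ (-(1 / 2) : ℝ) := by
  have hm := integrable_apply_sq_gaussN (d := d) τ i
  have h1 : ∫ y, (y i) ^ 2 ∂(gaussN d τ) = 2 * τ := by
    have h := (measurePreserving_eval (fun _ : Fin d => gaussianReal 0 (2 * τ).toNNReal) i)
    have h2 := h.map_eq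
    have h3 : ∫ y, (y i) ^ 2 ∂(gaussN d τ) = ∫ x, x ^ 2 ∂(gaussianReal 0 (2 * τ).toNNReal) := by
      rw [← h2, integral_map h.measurable.aemeasurable (by fun_prop)]
      rfl
    rw [h3]
    have h4 := variance_id_gaussianReal (μ := 0) (v := (2 * τ).toNNReal)
    rw [variance_of_integral_eq_zero aemeasurable_id (by simp)] at h4
    simpa [hτ.le] using h4
  have hs : (0 : ℝ) < Real.sqrt τ := Real.sqrt_pos.mpr hτ
  have hss : Real.sqrt τ ^ 2 = τ := Real.sq_sqrt hτ.le
  have hpt : ∀ y : Fin d → ℝ, |weight (some i) τ y| ≤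
      (y i) ^ 2 * (1 / (4 * τ * Real.sqrt τ)) + 1 / (4 * Real.sqrt τ) := fun y => by
    have h5 : |weight (some i) τ y| = |y i| / (2 * τ) := by
      simp [weight, abs_div, abs_of_pos hτ]
    rw [h5, ← sq_abs (y i)]
    set a := |y i|
    rw [← sub_nonneg]
    have : a ^ 2 * (1 / (4 * τ * Real.sqrt τ)) + 1 / (4 * Real.sqrt τ) - a / (2 * τ) =
        (a - Real.sqrt τ) ^ 2 / (4 * τ * Real.sqrt τ) := by
      rw [sub_sq, hss]
      have hτs : τ = Real.sqrt τ * Real.sqrt τ := by rw [← sq, hss]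
      field_simp
      ring
    rw [this]; positivity
  calc ∫ y, |weight (some i) τ y| ∂(gaussN d τ)
      ≤ ∫ y, ((y i) ^ 2 * (1 / (4 * τ * Real.sqrt τ)) + 1 / (4 * Real.sqrt τ)) ∂(gaussN d τ) :=
        integral_mono (integrable_weight _ _).abs
          ((hm.integrable_sq.mul_const _).add (integrable_const _)) hpt
    _ = (2 * τ) * (1 / (4 * τ * Real.sqrt τ)) + 1 / (4 * Real.sqrt τ) := by
        rw [integral_add (hm.integrable_sq.mul_const _) (integrable_const _), integral_mul_const,
          h1]
        simp
    _ ≤ τ ^ (-(1 / 2) : ℝ) := by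
        rw [Real.rpow_neg hτ.le, ← Real.sqrt_eq_rpow]
        apply le_of_sub_nonneg
        have : (Real.sqrt τ)⁻¹ - (2 * τ * (1 / (4 * τ * Real.sqrt τ)) + 1 / (4 * Real.sqrt τ)) =
          1 / (4 * Real.sqrt τ) := by field_simp; norm_num
        rw [this]; positivity

/-- The coordinates are independent, so the integral is a product of one-dimensional ones. The
weight `y i / (2τ)` only affects the `i`-th factor, where it produces the multiplier `2πi nᵢ`,
because the variance is `2τ`. -/
lemma integral_mFourier_mul_weight (j : Option (Fin d)) {τ : ℝ} (hτ : 0 < τ) (n : Fin d → ℤ) :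
    ∫ y, mFourier n (coeTorus y) * (weight j τ y : ℂ) ∂(gaussN d τ) = coef j τ n := by
  have hv : (((2 * τ).toNNReal : ℝ≥0) : ℂ) = 2 * τ := by
    have : (((2 * τ).toNNReal : ℝ≥0) : ℝ) = 2 * τ := Real.coe_toNNReal _ (by positivity)
    have h := congrArg (fun r : ℝ => (r : ℂ)) this
    simpa using h
  have hτ' : (τ : ℂ) ≠ 0 := by exact_mod_cast hτ.ne'
  set z : Fin d → ℂ := fun k => 2 * Real.pi * Complex.I * n k
  set E : Fin d → ℂ := fun k => Complex.exp (τ * (z k) ^ 2)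
  have hE : ∏ k, E k = (Real.exp (-lam n * τ) : ℝ) := by
    rw [← Complex.exp_sum, Complex.ofReal_exp]
    congr 1
    simp only [lam, z, ← Finset.mul_sum, mul_pow, Complex.I_sq]
    push_cast
    ring
  have h0 : ∀ k, ∫ y : ℝ, Complex.exp (z k * y) ∂(gaussianReal 0 (2 * τ).toNNReal) = E k :=
    fun k => by
      rw [integral_cexp_gaussianReal, hv]
      congr 1; ring
  have hF : ∀ y : Fin d → ℝ, mFourier n (coeTorus y) = ∏ k, Complex.exp (z k * y k) := fun y => by
    rw [← Complex.exp_sum]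
    refine (mFourier_coe n y).trans ?_
    congr 1
    rw [Finset.mul_sum]
    exact Finset.sum_congr rfl fun k _ => by simp only [z]; ring
  rcases j with _ | i
  · simp only [weight, coef, freq, one_mul, Complex.ofReal_one, mul_one, hF]
    rw [gaussN, integral_fintype_prod_eq_prod (fun k (y : ℝ) => Complex.exp (z k * y))]
    simp_rw [h0]
    exact hE
  · have hi : ∫ y : ℝ, (y : ℂ) / (2 * τ) * Complex.exp (z i * y)
        ∂(gaussianReal 0 (2 * τ).toNNReal) = z i * E i := by
      have h1 : ∀ y : ℝ, (y : ℂ) / (2 * τ) * Complex.exp (z i * y) =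
          (2 * τ : ℂ)⁻¹ * ((y : ℂ) * Complex.exp (z i * y)) := fun y => by ring
      simp_rw [h1]
      rw [integral_const_mul, integral_id_mul_cexp_gaussianReal, hv]
      have : Complex.exp (2 * τ * z i ^ 2 / 2) = E i := by
        simp only [E]; congr 1; ring
      rw [this]
      field_simp
    have h2 : ∀ y : Fin d → ℝ, mFourier n (coeTorus y) * (weight (some i) τ y : ℂ) =
        ∏ k, (if k = i then (y k : ℂ) / (2 * τ) * Complex.exp (z k * y k)
          else Complex.exp (z k * y k)) := fun y => by
      rw [hF, Finset.prod_eq_mul_prod_sdiff_singleton_of_mem (Finset.mem_univ i),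
        Finset.prod_eq_mul_prod_sdiff_singleton_of_mem (Finset.mem_univ i) (fun k => ite _ _ _),
        if_pos rfl]
      have : ∏ k ∈ Finset.univ \ {i}, (if k = i then (y k : ℂ) / (2 * τ) * Complex.exp (z k * y k)
          else Complex.exp (z k * y k)) = ∏ k ∈ Finset.univ \ {i}, Complex.exp (z k * y k) :=
        Finset.prod_congr rfl fun k hk => if_neg (by simpa using hk)
      rw [this]
      simp [weight]
      ring
    simp_rw [h2]
    rw [gaussN, integral_fintype_prod_eq_prod
      (fun k (y : ℝ) => if k = i then (y : ℂ) / (2 * τ) * Complex.exp (z k * y)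
          else Complex.exp (z k * y)),
      Finset.prod_eq_mul_prod_sdiff_singleton_of_mem (Finset.mem_univ i)]
    simp only [if_true]
    rw [hi, Finset.prod_congr rfl (g := E) fun k hk => ?_, mul_assoc,
      ← Finset.prod_eq_mul_prod_sdiff_singleton_of_mem (Finset.mem_univ i), hE]
    · rfl
    · rw [← h0]
      have : k ≠ i := by simpa using hk
      simp [this]

/-- Convolution with the heat kernel (`none`) or its derivatives (`some i`). -/
def conv (j : Option (Fin d)) (τ : ℝ) (f : Torus d → ℝ) (x : Torus d) : ℝ :=
  ∫ y, kernel j τ (x - y) * f y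

/-- Both sides are continuous linear functionals of `F` with the same values on characters. This
replaces the periodisation of the Gaussian density. -/
lemma integral_kernelC_mul (j : Option (Fin d)) {τ : ℝ} (hτ : 0 < τ) (x : Torus d)
    (F : C(Torus d, ℂ)) :
    ∫ y, F y * kernelC j τ (x - y) =
      ∫ y, F (x + coeTorus y) * (weight j τ y : ℂ) ∂(gaussN d τ) := by
  have h : pairing volume id measurable_id (fun y => kernelC j τ (x - y))
      (continuous_integrable_torus (by fun_prop)) =
      pairing (gaussN d τ) (fun y => x + coeTorus y) (measurable_coeTorus.const_add x)
        (fun y => (weight j τ y : ℂ)) (integrable_weight j τ).ofReal := by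
    refine clm_ext_mFourier fun n => ?_
    simp only [pairing_apply, id, mFourier_add_apply, mul_assoc]
    rw [integral_const_mul, integral_mFourier_mul_weight j hτ, kernelC,
      integral_mFourier_mul_trigSeries (summable_norm_coef j hτ), mul_comm]
  exact congrArg (fun L => L F) h

/-- Gaussian representation of the heat semigroup and its derivatives. -/
lemma conv_eq_integral_gaussN (j : Option (Fin d)) {τ : ℝ} (hτ : 0 < τ) (x : Torus d)
    {f : Torus d → ℝ} (hf : Continuous f) :
    conv j τ f x = ∫ y, f (x + coeTorus y) * weight j τ y ∂(gaussN d τ) := by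
  have h := integral_kernelC_mul j hτ x ⟨fun y => (f y : ℂ), by fun_prop⟩
  simp only [ContinuousMap.coe_mk, ← ofReal_kernel j hτ, ← Complex.ofReal_mul] at h
  rw [integral_complex_ofReal, integral_complex_ofReal, Complex.ofReal_inj] at h
  rw [conv, ← h]
  simp_rw [mul_comm]

/-! ### Positivity of the heat kernel and identification with `heat`. -/

/-- Test the kernel against its own negative part `f`: the convolution at `0` is a Gaussian average
of `f ≥ 0`, hence nonnegative, but it also equals `-∫ f²`. So `f = 0`. -/
lemma kernel_nonneg {τ : ℝ} (hτ : 0 < τ) (x : Torus d) : 0 ≤ kernel none τ x := by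
  have hk := continuous_kernel (d := d) none τ
  set f : Torus d → ℝ := fun y => max 0 (-(kernel none τ (0 - y)))
  have hf : Continuous f := by fun_prop
  have h1 : 0 ≤ conv none τ f 0 := by
    rw [conv_eq_integral_gaussN none hτ 0 hf]
    exact integral_nonneg fun y => by simp [weight, f]
  have h2 : ∀ y, kernel none τ (0 - y) * f y = -(f y) ^ 2 := fun y => by
    simp only [f]
    rcases le_total 0 (kernel none τ (0 - y)) with h | h
    · rw [max_eq_left (by linarith)]; simp
    · rw [max_eq_right (by linarith)]; ring
  rw [conv] at h1
  simp_rw [h2, integral_neg] at h1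
  have h3 : ∫ y, (f y) ^ 2 = 0 :=
    le_antisymm (by linarith) (integral_nonneg fun y => sq_nonneg _)
  have h4 := (integral_eq_zero_iff_of_nonneg (fun y => sq_nonneg (f y))
    (continuous_integrable_torus (hf.pow 2))).mp h3
  have h5 := (Continuous.ae_eq_iff_eq volume (hf.pow 2) continuous_const).mp h4
  have h6 : f (-x) = 0 := pow_eq_zero_iff two_ne_zero |>.mp (congrFun h5 (-x))
  have h7 : -(kernel none τ (0 - -x)) ≤ 0 := by
    rw [← h6]; exact le_max_right _ _
  simpa using h7

/-- The heat kernel measure centred at `x`. -/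
def law (τ : ℝ) (x : Torus d) : Measure (Torus d) :=
  volume.withDensity fun y => ENNReal.ofReal (kernel none τ (x - y))

lemma integral_law {τ : ℝ} (hτ : 0 < τ) (x : Torus d) (f : Torus d → ℝ) :
    ∫ y, f y ∂(law τ x) = conv none τ f x := by
  have hk := continuous_kernel (d := d) none τ
  rw [law, integral_withDensity_eq_integral_toReal_smul]
  · simp only [ENNReal.toReal_ofReal (kernel_nonneg hτ _), smul_eq_mul]; rfl
  · have : Continuous fun y => kernel none τ (x - y) := by fun_prop
    exact this.measurable.ennreal_ofReal
  · simp

instance (τ : ℝ) (x : Torus d) : IsFiniteMeasure (law τ x) := by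
  have hk := continuous_kernel (d := d) none τ
  have : Continuous fun y => kernel none τ (x - y) := by fun_prop
  exact isFiniteMeasure_withDensity_ofReal (continuous_integrable_torus this).2

/-- Finite measures are determined by integrals of bounded continuous functions, for which the
Gaussian representation is available. -/
lemma map_gaussN_eq_law {τ : ℝ} (hτ : 0 < τ) (x : Torus d) :
    (gaussN d τ).map (fun y => x + coeTorus y) = law τ x := by
  have hm : Measurable fun y : Fin d → ℝ => x + coeTorus y := measurable_coeTorus.const_add x
  refine ext_of_forall_integral_eq_of_IsFiniteMeasure fun f => ?_
  rw [integral_law hτ, conv_eq_integral_gaussN none hτ x f.continuous,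
    integral_map hm.aemeasurable f.continuous.aestronglyMeasurable]
  simp [weight]

lemma isProbabilityMeasure_law {τ : ℝ} (hτ : 0 < τ) (x : Torus d) :
    IsProbabilityMeasure (law τ x) := by
  have hm : Measurable fun y : Fin d → ℝ => x + coeTorus y := measurable_coeTorus.const_add x
  rw [← map_gaussN_eq_law hτ]
  exact Measure.isProbabilityMeasure_map hm.aemeasurable

lemma law_absolutelyContinuous (τ : ℝ) (x : Torus d) : law τ x ≪ volume :=
  withDensity_absolutelyContinuous _ _

/-- For merely measurable `f` the Gaussian representation of continuous functions does not apply
directly; equality of the two laws, together with absolute continuity of `law`, covers this case. -/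
lemma heat_eq_conv {τ : ℝ} (hτ : 0 < τ) {f : Torus d → ℝ} (hf : AEStronglyMeasurable f volume)
    (x : Torus d) : heat τ f x = conv none τ f x := by
  have hm : Measurable fun y : Fin d → ℝ => x + coeTorus y := measurable_coeTorus.const_add x
  rw [← integral_law hτ, ← map_gaussN_eq_law hτ, integral_map hm.aemeasurable]
  · rfl
  · rw [map_gaussN_eq_law hτ]
    exact hf.mono_ac (law_absolutelyContinuous τ x)

lemma heat_zero (f : Torus d → ℝ) : heat 0 f = f := by
  ext x
  have h : (Measure.pi fun _ : Fin d => gaussianReal 0 (2 * 0 : ℝ).toNNReal) =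
      Measure.dirac (0 : Fin d → ℝ) := by
    simp only [mul_zero, Real.toNNReal_zero, gaussianReal_zero_var]
    refine (Measure.pi_eq fun s hs => ?_)
    rw [Measure.dirac_apply' _ (MeasurableSet.univ_pi hs)]
    simp only [Measure.dirac_apply' _ (hs _)]
    by_cases h : (0 : Fin d → ℝ) ∈ univ.pi s
    · rw [indicator_of_mem h]
      symm
      refine Finset.prod_eq_one fun i _ => ?_
      exact indicator_of_mem (h i (mem_univ i)) _
    · rw [indicator_of_notMem h]
      rw [mem_univ_pi, not_forall] at h
      obtain ⟨i, hi⟩ := h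
      symm
      exact Finset.prod_eq_zero (Finset.mem_univ i) (indicator_of_notMem hi _)
  rw [heat, h, integral_dirac]
  congr 1
  ext i
  simp

lemma integrable_kernel_mul (j : Option (Fin d)) (τ : ℝ) {f : Torus d → ℝ}
    (hf : Integrable f volume) (x : Torus d) :
    Integrable (fun y => kernel j τ (x - y) * f y) volume := by
  have hk : Continuous fun y => kernel j τ (x - y) := (continuous_kernel j τ).comp (by fun_prop)
  obtain ⟨C, hC⟩ := isCompact_univ.exists_bound_of_continuousOn hk.continuousOn
  exact hf.bdd_mul hk.aestronglyMeasurable (Eventually.of_forall fun y => hC y (mem_univ y))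

lemma continuous_conv (j : Option (Fin d)) {τ : ℝ} (hτ : 0 < τ) {f : Torus d → ℝ}
    (hf : Integrable f volume) : Continuous (conv j τ f) := by
  refine continuous_of_dominated (bound := fun y => kernelBound j τ * ‖f y‖)
    (fun x => (integrable_kernel_mul j τ hf x).aestronglyMeasurable)
    (fun x => Eventually.of_forall fun y => ?_) (hf.norm.const_mul _)
    (Eventually.of_forall fun y => ?_)
  · rw [norm_mul]
    gcongr
    exact abs_kernel_le j hτ le_rfl _
  · have := continuous_kernel j τ
    fun_prop

/-! ### Semigroup law and differentiability of heat convolutions. -/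

lemma coef_none_mul (j : Option (Fin d)) (τ σ : ℝ) (n : Fin d → ℤ) :
    coef none τ n * coef j σ n = coef j (τ + σ) n := by
  simp only [coef, freq, one_mul]
  rw [mul_left_comm, ← Complex.ofReal_mul, ← Real.exp_add, mul_add]

lemma integral_kernel_mul_kernel (j j' j'' : Option (Fin d)) {τ σ : ℝ} (hτ : 0 < τ) (hσ : 0 < σ)
    (h : ∀ n, coef j τ n * coef j' σ n = coef j'' (τ + σ) n) (x : Torus d) :
    ∫ y, kernel j τ (x - y) * kernel j' σ y = kernel j'' (τ + σ) x := by
  have h1 := integral_trigSeries_mul_trigSeries (summable_norm_coef j hτ)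
    (summable_norm_coef j' hσ) x
  have h2 : (fun n => coef j τ n * coef j' σ n) = coef j'' (τ + σ) := funext h
  rw [h2] at h1
  change ∫ y, kernelC j' σ y * kernelC j τ (x - y) = kernelC j'' (τ + σ) x at h1
  simp only [← ofReal_kernel j hτ, ← ofReal_kernel j' hσ, ← ofReal_kernel j'' (add_pos hτ hσ),
    ← Complex.ofReal_mul] at h1
  rw [integral_complex_ofReal, Complex.ofReal_inj] at h1
  rw [← h1]
  simp_rw [mul_comm]

/-- Fubini and the multiplication of Fourier coefficients. The condition on coefficients allows the
derivative to sit on either factor. -/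
lemma conv_conv (j j' j'' : Option (Fin d)) {τ σ : ℝ} (hτ : 0 < τ) (hσ : 0 < σ)
    (h : ∀ n, coef j τ n * coef j' σ n = coef j'' (τ + σ) n)
    {f : Torus d → ℝ} (hf : Integrable f volume) (x : Torus d) :
    conv j τ (conv j' σ f) x = conv j'' (τ + σ) f x := by
  unfold conv
  have hint : Integrable (Function.uncurry fun y z : Torus d =>
      kernel j τ (x - y) * (kernel j' σ (y - z) * f z)) (volume.prod volume) := by
    have h1 : Integrable (fun w : Torus d × Torus d => f w.2) (volume.prod volume) :=
      hf.comp_snd volume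
    have hc : Continuous fun w : Torus d × Torus d =>
        kernel j τ (x - w.1) * kernel j' σ (w.1 - w.2) := by
      have := continuous_kernel j τ
      have := continuous_kernel j' σ
      fun_prop
    refine (h1.bdd_mul (c := kernelBound j τ * kernelBound j' σ) hc.aestronglyMeasurable
      (Eventually.of_forall fun w => ?_)).congr (Eventually.of_forall fun w => ?_)
    · rw [norm_mul]
      exact mul_le_mul (abs_kernel_le j hτ le_rfl _) (abs_kernel_le j' hσ le_rfl _)
        (norm_nonneg _) (kernelBound_nonneg _ _)
    · simp [Function.uncurry, mul_assoc]
  simp_rw [← integral_const_mul]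
  rw [integral_integral_swap hint]
  refine integral_congr_ae (Eventually.of_forall fun z => ?_)
  simp_rw [← mul_assoc]
  rw [integral_mul_const]
  congr 1
  rw [← integral_kernel_mul_kernel j j' j'' hτ hσ h,
    ← integral_add_right_eq_self (μ := (volume : Measure (Torus d))) _ z]
  refine integral_congr_ae (Eventually.of_forall fun y => ?_)
  simp only [add_sub_cancel_right]
  congr 2
  abel

lemma integral_covector {α : Type*} [MeasurableSpace α] {μ : Measure α} {a : α → Fin d → ℝ}
    (ha : ∀ i, Integrable (fun s => a s i) μ) :
    ∫ s, covector (a s) ∂μ = covector fun i => ∫ s, a s i ∂μ := by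
  unfold covector
  rw [integral_finsetSum _ fun i _ => (ha i).smul_const _]
  simp_rw [integral_smul_const]

lemma covector_smul (c : ℝ) (a : Fin d → ℝ) : covector (fun i => a i * c) = c • covector a := by
  ext x; simp [covector_apply, Finset.mul_sum]; exact Finset.sum_congr rfl fun i _ => by ring

lemma continuous_covector : Continuous (covector (d := d)) := by
  unfold covector
  fun_prop

lemma hasFDerivAt_conv {τ : ℝ} (hτ : 0 < τ) {f : Torus d → ℝ}
    (hf : Integrable f volume) (x : EuclideanSpace ℝ (Fin d)) :
    HasFDerivAt (lift (conv none τ f)) (covector fun i => conv (some i) τ f (proj x)) x := by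
  have hi : ∀ i, Integrable (fun y => kernel (some i) τ (proj x - y) * f y) volume :=
    fun i => integrable_kernel_mul (some i) τ hf _
  have h := hasFDerivAt_integral_of_dominated_of_fderiv_le (𝕜 := ℝ) (μ := volume) (s := univ)
    (F := fun (x : EuclideanSpace ℝ (Fin d)) y => kernel none τ (proj x - y) * f y)
    (F' := fun x y => covector fun i => kernel (some i) τ (proj x - y) * f y)
    (bound := fun y => (∑ i : Fin d, kernelBound (some i) τ) * ‖f y‖) (x₀ := x)
    univ_mem (Eventually.of_forall fun x => (integrable_kernel_mul none τ hf _).aestronglyMeasurable)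
    (integrable_kernel_mul none τ hf _) ?_ ?_ (hf.norm.const_mul _) ?_
  · rw [integral_covector hi] at h
    exact h
  · have : AEStronglyMeasurable (fun y => fun i => kernel (some i) τ (proj x - y) * f y)
        (volume : Measure (Torus d)) :=
      (aemeasurable_pi_lambda _ fun i => (hi i).aestronglyMeasurable.aemeasurable).aestronglyMeasurable
    exact continuous_covector.comp_aestronglyMeasurable this
  · refine Eventually.of_forall fun y x _ => (norm_covector_le _).trans ?_
    rw [Finset.sum_mul]
    refine Finset.sum_le_sum fun i _ => ?_
    rw [abs_mul]
    exact mul_le_mul_of_nonneg_right (abs_kernel_le _ hτ le_rfl _) (abs_nonneg _)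
  · refine Eventually.of_forall fun y x _ => ?_
    rw [covector_smul]
    exact (hasFDerivAt_kernel_sub hτ y x).mul_const (f y)

/-! ### Smoothing estimates from `L^p` to supremum and Hölder bounds. -/

lemma abs_conv_le_of_continuous (j : Option (Fin d)) {τ M : ℝ} (hτ : 0 < τ) {f : Torus d → ℝ}
    (hf : Continuous f) (hM : ∀ x, |f x| ≤ M) (x : Torus d) :
    |conv j τ f x| ≤ M * ∫ y, |weight j τ y| ∂(gaussN d τ) := by
  rw [conv_eq_integral_gaussN j hτ x hf, ← integral_const_mul]
  refine (norm_integral_le_integral_norm (fun y => f (x + coeTorus y) * weight j τ y)).trans ?_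
  refine integral_mono_of_nonneg (Eventually.of_forall fun y => norm_nonneg _)
    ((integrable_weight j τ).abs.const_mul _) (Eventually.of_forall fun y => ?_)
  simp only [norm_mul, Real.norm_eq_abs]
  gcongr
  exact hM _

lemma abs_conv_some_le_of_continuous (i : Fin d) {τ M : ℝ} (hτ : 0 < τ) {f : Torus d → ℝ}
    (hf : Continuous f) (hM : ∀ x, |f x| ≤ M) (x : Torus d) :
    |conv (some i) τ f x| ≤ M * τ ^ (-(1 / 2) : ℝ) := by
  have hM0 : 0 ≤ M := (abs_nonneg _).trans (hM x)
  refine (abs_conv_le_of_continuous _ hτ hf hM x).trans ?_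
  gcongr
  exact integral_abs_weight_some hτ i

/-- The smoothing exponent `d/(2p)` of the heat semigroup from `L^p` to `L^∞`. -/
def smoothExp (d : ℕ) (p : ℝ≥0∞) : ℝ := d / 2 * (p⁻¹).toReal

lemma smoothExp_nonneg (d : ℕ) (p : ℝ≥0∞) : 0 ≤ smoothExp d p := by
  unfold smoothExp; positivity

lemma exists_law_le (d : ℕ) (T : ℝ) : ∃ C : ℝ, 0 < C ∧ ∀ τ, 0 < τ → τ ≤ T → ∀ x : Torus d,
    law τ x ≤ ENNReal.ofReal (C * τ ^ (-(d / 2 : ℝ))) • volume := by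
  obtain ⟨C, hC0, hC⟩ := exists_tsum_exp_lam_le d T
  refine ⟨C + 1, by linarith, fun τ hτ hτT x => ?_⟩
  rw [law, ← withDensity_const]
  refine withDensity_mono (Eventually.of_forall fun y => ENNReal.ofReal_le_ofReal ?_)
  refine (le_abs_self _).trans ((abs_kernel_le none hτ le_rfl _).trans ?_)
  have h1 : kernelBound (d := d) none τ = ∑' n : Fin d → ℤ, Real.exp (-lam n * τ) := by
    unfold kernelBound
    exact tsum_congr fun n => by rw [norm_coef]; simp [freq]
  rw [h1]
  refine (hC τ hτ hτT).trans ?_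
  gcongr
  linarith

/-- `law τ x` is a probability measure, so the mean of `|f|` is at most its `L^p` norm under that
law. The density is at most `C τ^{-d/2}`, and the `L^p` norm only sees its power `1/p`. The case `p
= ∞` is included. -/
lemma exists_abs_conv_none_le (d : ℕ) (p : ℝ≥0∞) (hp : 1 ≤ p) (T : ℝ) : ∃ C : ℝ, 0 ≤ C ∧
    ∀ f : Torus d → ℝ, MemLp f p volume → ∀ τ, 0 < τ → τ ≤ T → ∀ x,
      |conv none τ f x| ≤ C * τ ^ (-smoothExp d p) * (eLpNorm f p volume).toReal := by
  obtain ⟨C, hC0, hC⟩ := exists_law_le d T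
  refine ⟨C ^ (p⁻¹).toReal, by positivity, fun f hf τ hτ hτT x => ?_⟩
  have := isProbabilityMeasure_law hτ x
  have hpos : 0 < C * τ ^ (-(d / 2 : ℝ)) := by positivity
  have h1 : ‖conv none τ f x‖ₑ ≤
      ENNReal.ofReal (C ^ (p⁻¹).toReal * τ ^ (-smoothExp d p)) * eLpNorm f p volume := by
    calc ‖conv none τ f x‖ₑ = ‖∫ y, f y ∂(law τ x)‖ₑ := by rw [integral_law hτ]
      _ ≤ ∫⁻ y, ‖f y‖ₑ ∂(law τ x) := enorm_integral_le_lintegral_enorm _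
      _ = eLpNorm f 1 (law τ x) := eLpNorm_one_eq_lintegral_enorm.symm
      _ ≤ eLpNorm f p (law τ x) := eLpNorm_le_eLpNorm_of_exponent_le hp
          (hf.1.mono_ac (law_absolutelyContinuous τ x))
      _ ≤ eLpNorm f p (ENNReal.ofReal (C * τ ^ (-(d / 2 : ℝ))) • volume) :=
          eLpNorm_mono_measure _ (hC τ hτ hτT x)
      _ = _ := by
          rw [eLpNorm_smul_measure_of_ne_zero (by simpa using hpos), smul_eq_mul, one_div,
            ENNReal.ofReal_rpow_of_pos hpos, Real.mul_rpow hC0.le (by positivity),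
            ← Real.rpow_mul hτ.le, smoothExp, neg_mul]
  have h2 := ENNReal.toReal_mono (by finiteness [hf.2.ne]) h1
  rw [ENNReal.toReal_mul, ENNReal.toReal_ofReal (by positivity)] at h2
  simpa using h2

lemma abs_sub_le_of_hasFDerivAt {f : EuclideanSpace ℝ (Fin d) → ℝ}
    {a : EuclideanSpace ℝ (Fin d) → Fin d → ℝ} (h : ∀ x, HasFDerivAt f (covector (a x)) x)
    {B : ℝ} (hB : ∀ x i, |a x i| ≤ B) (x x' : EuclideanSpace ℝ (Fin d)) :
    |f x - f x'| ≤ d * B * ‖x - x'‖ := by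
  refine convex_univ.norm_image_sub_le_of_norm_hasFDerivWithin_le
    (fun y _ => (h y).hasFDerivWithinAt) (fun y _ => (norm_covector_le _).trans ?_)
    (mem_univ x') (mem_univ x)
  refine (Finset.sum_le_sum fun i _ => hB y i).trans (le_of_eq ?_)
  simp

/-- Half the order of the differential operator attached to an index. -/
def halfOrder (j : Option (Fin d)) : ℝ :=
  match j with
  | none => 0
  | some _ => 1 / 2

/-- Interpolation: write `a = a^(1-θ) a^θ` and bound each factor by a different inequality. It turns
a supremum bound and a Lipschitz bound into a Hölder bound. -/
lemma le_mul_rpow_of_le_of_le {a A B r θ : ℝ} (ha : 0 ≤ a) (hB : 0 ≤ B) (hr : 0 ≤ r)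
    (hθ0 : 0 ≤ θ) (hθ1 : θ ≤ 1) (h1 : a ≤ A) (h2 : a ≤ B * r) :
    a ≤ A ^ (1 - θ) * B ^ θ * r ^ θ := by
  have hA := ha.trans h1
  rw [mul_assoc, ← Real.mul_rpow hB hr]
  calc a = a ^ (1 - θ) * a ^ θ := by
        rcases ha.eq_or_lt with h | h
        · rw [← h]
          rcases hθ0.eq_or_lt with h' | h'
          · simp [← h']
          · rw [Real.zero_rpow h'.ne', mul_zero]
        · rw [← Real.rpow_add h]; simp
    _ ≤ _ := by gcongr

/-- The time `τ` is split in halves. One half is used for the smoothing already known, and the other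
for one more derivative at cost `τ^{-1/2}`. Doing this once gives gradients and a second time gives
Lipschitz bounds on gradients; Hölder bounds follow by interpolation. -/
lemma exists_abs_conv_le (d : ℕ) (p : ℝ≥0∞) (hp : 1 ≤ p) (T : ℝ) : ∃ C : ℝ, 0 ≤ C ∧
    ∀ f : Torus d → ℝ, MemLp f p volume → ∀ τ, 0 < τ → τ ≤ T → ∀ j,
      (∀ x, |conv j τ f x| ≤
        C * τ ^ (-(smoothExp d p + halfOrder j)) * (eLpNorm f p volume).toReal) ∧
      ∀ θ, 0 ≤ θ → θ ≤ 1 → ∀ x x', |conv j τ f (proj x) - conv j τ f (proj x')| ≤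
        C * τ ^ (-(smoothExp d p + halfOrder j + θ / 2)) * (eLpNorm f p volume).toReal *
          ‖x - x'‖ ^ θ := by
  obtain ⟨C, hC0, hC⟩ := exists_abs_conv_none_le d p hp T
  set a := smoothExp d p with ha
  have ha0 : 0 ≤ a := smoothExp_nonneg d p
  have hhalf : ∀ τ : ℝ, 0 < τ → ∀ b : ℝ, (τ / 2) ^ (-b) = 2 ^ b * τ ^ (-b) := fun τ hτ b => by
    rw [Real.div_rpow hτ.le (by norm_num), Real.rpow_neg (by norm_num : (0 : ℝ) ≤ 2)]
    field_simp
  -- The powers of `2` come from evaluating the bounds at `τ/2`: one halving for the gradient and a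
  -- further one for the Lipschitz constant of the gradient.
  set C1 : ℝ := C * 2 ^ (a + 1 / 2) with hC1
  set C2 : ℝ := C1 * 2 ^ (a + 1) with hC2
  have h2pow : ∀ b : ℝ, 0 ≤ b → (1 : ℝ) ≤ 2 ^ b := fun b hb =>
    Real.one_le_rpow (by norm_num) hb
  have hCC1 : C ≤ C1 := le_mul_of_one_le_right hC0 (h2pow _ (by linarith))
  have hC1C2 : C1 ≤ C2 := le_mul_of_one_le_right (hC0.trans hCC1) (h2pow _ (by linarith))
  have hC1' : 0 ≤ C1 := hC0.trans hCC1
  have hC2' : 0 ≤ C2 := hC1'.trans hC1C2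
  -- supremum bounds
  have hsup : ∀ f : Torus d → ℝ, MemLp f p volume → ∀ τ, 0 < τ → τ ≤ T → ∀ j, ∀ x,
      |conv j τ f x| ≤ C1 * τ ^ (-(a + halfOrder j)) * (eLpNorm f p volume).toReal := by
    intro f hf τ hτ hτT j x
    have hfi := hf.integrable hp
    rcases j with _ | i
    · simp only [halfOrder, add_zero]
      refine (hC f hf τ hτ hτT x).trans ?_
      gcongr
    · have h2 : 0 < τ / 2 := half_pos hτ
      have h3 := conv_conv (some i) none (some i) h2 h2
        (fun n => by rw [mul_comm, coef_none_mul]) hfi x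
      rw [add_halves] at h3
      rw [← h3]
      refine (abs_conv_some_le_of_continuous i h2 (continuous_conv none h2 hfi)
        (hC f hf (τ / 2) h2 (by linarith)) x).trans (le_of_eq ?_)
      rw [mul_right_comm, mul_assoc C, ← Real.rpow_add h2]
      simp only [halfOrder]
      rw [← neg_add, hhalf τ hτ, hC1]
      ring
  -- Lipschitz bounds
  have hlip : ∀ f : Torus d → ℝ, MemLp f p volume → ∀ τ, 0 < τ → τ ≤ T → ∀ j, ∀ x x',
      |conv j τ f (proj x) - conv j τ f (proj x')| ≤
        (d * C2) * τ ^ (-(a + halfOrder j + 1 / 2)) * (eLpNorm f p volume).toReal * ‖x - x'‖ := by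
    intro f hf τ hτ hτT j x x'
    have hfi := hf.integrable hp
    rcases j with _ | i
    · have h1 := abs_sub_le_of_hasFDerivAt (hasFDerivAt_conv hτ hfi)
        (B := C1 * τ ^ (-(a + 1 / 2)) * (eLpNorm f p volume).toReal)
        (fun x i => hsup f hf τ hτ hτT (some i) (proj x)) x x'
      refine h1.trans ?_
      simp only [halfOrder, add_zero, ← mul_assoc]
      gcongr
    · have h2 : 0 < τ / 2 := half_pos hτ
      have h3 := conv_conv none (some i) (some i) h2 h2
        (fun n => by rw [coef_none_mul]) hfi
      rw [add_halves] at h3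
      rw [← h3, ← h3]
      have h4 := continuous_conv (some i) h2 hfi
      have h5 := abs_sub_le_of_hasFDerivAt (hasFDerivAt_conv h2 (continuous_integrable_torus h4))
        (fun x k => abs_conv_some_le_of_continuous k h2 h4
          (hsup f hf (τ / 2) h2 (by linarith) (some i)) (proj x)) x x'
      refine h5.trans (le_of_eq ?_)
      congr 1
      rw [mul_right_comm (C1 * _), mul_assoc C1, ← Real.rpow_add h2]
      simp only [halfOrder]
      have : -(a + 1 / 2) + -(1 / 2) = -(a + 1) := by ring
      rw [this, hhalf τ hτ, hC2, add_assoc a, add_halves]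
      ring
  refine ⟨2 * C1 + d * C2, by positivity, fun f hf τ hτ hτT j => ⟨fun x => ?_, ?_⟩⟩
  · refine (hsup f hf τ hτ hτT j x).trans ?_
    gcongr
    nlinarith [mul_nonneg (Nat.cast_nonneg (α := ℝ) d) hC2']
  · intro θ hθ0 hθ1 x x'
    set N := (eLpNorm f p volume).toReal
    have hN : 0 ≤ N := ENNReal.toReal_nonneg
    set D := 2 * C1 + d * C2
    have hD : 0 ≤ D := by positivity
    set b := a + halfOrder j
    have h1 : |conv j τ f (proj x) - conv j τ f (proj x')| ≤ D * τ ^ (-b) * N := by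
      refine (abs_sub _ _).trans ?_
      have h2 := hsup f hf τ hτ hτT j (proj x)
      have h3 := hsup f hf τ hτ hτT j (proj x')
      have h4 : (2 * C1) * τ ^ (-b) * N ≤ D * τ ^ (-b) * N := by
        gcongr
        simp only [D]
        nlinarith [mul_nonneg (Nat.cast_nonneg (α := ℝ) d) hC2']
      linarith
    have h2 : |conv j τ f (proj x) - conv j τ f (proj x')| ≤
        (D * τ ^ (-(b + 1 / 2)) * N) * ‖x - x'‖ := by
      refine (hlip f hf τ hτ hτT j x x').trans ?_
      gcongr
      simp only [D]
      linarith
    refine (le_mul_rpow_of_le_of_le (abs_nonneg _) (by positivity) (norm_nonneg _) hθ0 hθ1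
      h1 h2).trans (le_of_eq ?_)
    congr 1
    have hDN : 0 ≤ D * N := by positivity
    have h6 : ∀ t : ℝ, D * t * N = D * N * t := fun t => by ring
    rw [h6, h6, Real.mul_rpow hDN (by positivity),
      Real.mul_rpow hDN (by positivity), mul_mul_mul_comm, ← Real.rpow_mul hτ.le,
      ← Real.rpow_mul hτ.le, ← Real.rpow_add hτ]
    have h5 : (D * N) ^ (1 - θ) * (D * N) ^ θ = D * N := by
      rcases hDN.eq_or_lt with h | h
      · rw [← h]
        rcases hθ0.eq_or_lt with h' | h'
        · simp [← h']
        · rw [Real.zero_rpow h'.ne', mul_zero]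
      · rw [← Real.rpow_add h]; simp
    rw [h5, mul_right_comm]
    congr 3
    ring

/-! ### Differential calculus and integration by parts on the torus. -/

/-- The `i`-th basis vector. -/
def basisVec (i : Fin d) : EuclideanSpace ℝ (Fin d) := EuclideanSpace.single i 1

lemma proj_add_smul_basisVec (i : Fin d) (x : EuclideanSpace ℝ (Fin d)) (s : ℝ) :
    proj (x + s • basisVec i) = proj x + Pi.single i (s : UnitAddCircle) := by
  ext k
  by_cases h : k = i
  · subst h; simp [proj, basisVec]
  · simp [proj, basisVec, h]

lemma hasDerivAt_of_hasFDerivAt_lift {f : Torus d → ℝ} {x : EuclideanSpace ℝ (Fin d)}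
    {L : EuclideanSpace ℝ (Fin d) →L[ℝ] ℝ} (h : HasFDerivAt (lift f) L x) (i : Fin d) :
    HasDerivAt (fun s : ℝ => f (proj x + Pi.single i (s : UnitAddCircle))) (L (basisVec i)) 0 := by
  have h1 : HasDerivAt (fun s : ℝ => x + s • basisVec i) (basisVec i) 0 := by
    simpa using ((hasDerivAt_id (0 : ℝ)).smul_const (basisVec i)).const_add x
  have h2 : HasFDerivAt (lift f) L (x + (0 : ℝ) • basisVec i) := by simpa using h
  have h3 := h2.comp_hasDerivAt (0 : ℝ) h1
  refine h3.congr_of_eventuallyEq (Eventually.of_forall fun s => ?_)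
  simp [lift, proj_add_smul_basisVec]

lemma pderiv_eq_of_hasFDerivAt {f : Torus d → ℝ} {x : EuclideanSpace ℝ (Fin d)}
    {L : EuclideanSpace ℝ (Fin d) →L[ℝ] ℝ} (h : HasFDerivAt (lift f) L x) (i : Fin d) :
    pderiv i f (proj x) = L (basisVec i) :=
  (hasDerivAt_of_hasFDerivAt_lift h i).deriv

lemma covector_basisVec (a : Fin d → ℝ) (i : Fin d) : covector a (basisVec i) = a i := by
  simp [covector_apply, basisVec]

lemma lift_pderiv {f : Torus d → ℝ} (hf : ContDiff ℝ 1 (lift f)) (i : Fin d) :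
    lift (pderiv i f) = fun x => fderiv ℝ (lift f) x (basisVec i) := by
  ext x
  exact pderiv_eq_of_hasFDerivAt ((hf.differentiable one_ne_zero).differentiableAt.hasFDerivAt) i

/-- The projection from the Euclidean space is an open quotient map. -/
lemma continuous_of_continuous_lift {f : Torus d → ℝ} (h : Continuous (lift f)) :
    Continuous f := by
  have hq : IsOpenQuotientMap (proj (d := d)) := by
    have h1 : IsOpenQuotientMap (fun y : Fin d → ℝ => coeTorus y) :=
      IsOpenQuotientMap.piMap fun _ => QuotientAddGroup.isOpenQuotientMap_mk
    exact h1.comp (PiLp.homeomorph 2 (fun _ : Fin d => ℝ)).isOpenQuotientMap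
  exact hq.isQuotientMap.continuous_iff.mpr h

lemma continuous_pderiv {f : Torus d → ℝ} (hf : ContDiff ℝ 1 (lift f)) (i : Fin d) :
    Continuous (pderiv i f) := by
  apply continuous_of_continuous_lift
  rw [lift_pderiv hf]
  exact (hf.continuous_fderiv one_ne_zero).clm_apply continuous_const

lemma IsSmooth.contDiff_one {f : Torus d → ℝ} (hf : IsSmooth f) : ContDiff ℝ 1 (lift f) :=
  hf.of_le (by exact_mod_cast le_top)

lemma IsSmooth.continuous {f : Torus d → ℝ} (hf : IsSmooth f) : Continuous f :=
  continuous_of_continuous_lift (ContDiff.continuous hf)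

lemma IsSmooth.pderiv {f : Torus d → ℝ} (hf : IsSmooth f) (i : Fin d) :
    IsSmooth (pderiv i f) := by
  unfold IsSmooth
  rw [lift_pderiv hf.contDiff_one]
  exact (ContDiff.fderiv_right (m := ∞) hf (by simp)).clm_apply contDiff_const

lemma IsSmooth.continuous_laplacian {f : Torus d → ℝ} (hf : IsSmooth f) :
    Continuous (laplacian f) := by
  unfold laplacian
  exact continuous_finsetSum _ fun i _ => ((hf.pderiv i).pderiv i).continuous

/-- By translation invariance the integral of `f (x + s eᵢ)` does not depend on `s`; differentiate
it under the integral sign at `s = 0`. -/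
lemma integral_pderiv {f : Torus d → ℝ} (hf : ContDiff ℝ 1 (lift f)) (i : Fin d) :
    ∫ x, pderiv i f x = 0 := by
  have hc : Continuous f := continuous_of_continuous_lift hf.continuous
  have hp := continuous_pderiv hf i
  have hderiv : ∀ (x : Torus d) (s : ℝ),
      HasDerivAt (fun s : ℝ => f (x + Pi.single i (s : UnitAddCircle)))
        (pderiv i f (x + Pi.single i (s : UnitAddCircle))) s := by
    intro x s
    obtain ⟨y, rfl⟩ := proj_surjective x
    rw [← proj_add_smul_basisVec]
    have h1 := hasDerivAt_of_hasFDerivAt_lift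
      ((hf.differentiable one_ne_zero).differentiableAt (x := y + s • basisVec i)).hasFDerivAt i
    rw [← congrFun (lift_pderiv hf i) (y + s • basisVec i)] at h1
    have h2 : HasDerivAt (fun r : ℝ => r - s) 1 s := (hasDerivAt_id s).sub_const s
    rw [← sub_self s] at h1
    have h3 := HasDerivAt.comp (h := fun r : ℝ => r - s) s h1 h2
    rw [mul_one] at h3
    refine h3.congr_of_eventuallyEq (Eventually.of_forall fun r => ?_)
    simp only [Function.comp_apply]
    rw [proj_add_smul_basisVec, add_assoc, ← Pi.single_add, ← AddCircle.coe_add]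
    simp
  obtain ⟨M, hM⟩ := isCompact_univ.exists_bound_of_continuousOn hp.continuousOn
  have h := hasDerivAt_integral_of_dominated_loc_of_deriv_le (𝕜 := ℝ)
    (μ := (volume : Measure (Torus d)))
    (F := fun (s : ℝ) x => f (x + Pi.single i (s : UnitAddCircle)))
    (F' := fun s x => pderiv i f (x + Pi.single i (s : UnitAddCircle)))
    (bound := fun _ => M) (x₀ := 0) univ_mem
    (Eventually.of_forall fun s => (hc.comp (by fun_prop)).aestronglyMeasurable)
    (continuous_integrable_torus (hc.comp (by fun_prop)))
    (hp.comp (by fun_prop)).aestronglyMeasurable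
    (Eventually.of_forall fun x s _ => hM _ (mem_univ _)) (integrable_const _)
    (Eventually.of_forall fun x s _ => hderiv x s)
  have h1 := h.2
  simp only [integral_add_right_eq_self (μ := (volume : Measure (Torus d)))] at h1
  exact h1.unique (hasDerivAt_const (0 : ℝ) _)

lemma pderiv_mul {f g : Torus d → ℝ} (hf : ContDiff ℝ 1 (lift f)) (hg : ContDiff ℝ 1 (lift g))
    (i : Fin d) (x : Torus d) :
    pderiv i (fun x => f x * g x) x = f x * pderiv i g x + g x * pderiv i f x := by
  obtain ⟨y, rfl⟩ := proj_surjective x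
  have h1 := ((hf.differentiable one_ne_zero).differentiableAt (x := y)).hasFDerivAt
  have h2 := ((hg.differentiable one_ne_zero).differentiableAt (x := y)).hasFDerivAt
  rw [pderiv_eq_of_hasFDerivAt h1, pderiv_eq_of_hasFDerivAt h2,
    pderiv_eq_of_hasFDerivAt (f := fun x => f x * g x) (h1.mul h2)]
  simp [lift]

lemma integral_mul_pderiv {f g : Torus d → ℝ} (hf : ContDiff ℝ 1 (lift f))
    (hg : ContDiff ℝ 1 (lift g)) (i : Fin d) :
    ∫ x, f x * pderiv i g x = -∫ x, g x * pderiv i f x := by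
  have hcf : Continuous f := continuous_of_continuous_lift hf.continuous
  have hcg : Continuous g := continuous_of_continuous_lift hg.continuous
  have h := integral_pderiv (f := fun x => f x * g x) (hf.mul hg) i
  simp_rw [pderiv_mul hf hg] at h
  have h1 : Integrable (fun x => f x * pderiv i g x) volume :=
    continuous_integrable_torus (hcf.mul (continuous_pderiv hg i))
  have h2 : Integrable (fun x => g x * pderiv i f x) volume :=
    continuous_integrable_torus (hcg.mul (continuous_pderiv hf i))
  rw [integral_add h1 h2] at h
  linarith

lemma integral_mul_laplacian {f g : Torus d → ℝ} (hf : IsSmooth f) (hg : IsSmooth g) :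
    ∫ x, f x * laplacian g x = ∫ x, g x * laplacian f x := by
  have hint : ∀ {f g : Torus d → ℝ}, IsSmooth f → IsSmooth g → ∀ i,
      Integrable (fun x => f x * pderiv i (pderiv i g) x) volume := fun hf hg i =>
    continuous_integrable_torus (hf.continuous.mul ((hg.pderiv i).pderiv i).continuous)
  simp only [laplacian, Finset.mul_sum]
  rw [integral_finsetSum _ fun i _ => hint hf hg i, integral_finsetSum _ fun i _ => hint hg hf i]
  refine Finset.sum_congr rfl fun i _ => ?_
  rw [integral_mul_pderiv hf.contDiff_one (hg.pderiv i).contDiff_one,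
    integral_mul_pderiv hg.contDiff_one (hf.pderiv i).contDiff_one]
  simp_rw [mul_comm]

/-! ### Trigonometric test functions and the heat flow of smooth functions. -/

/-- The real (`true`) and imaginary (`false`) parts of the characters of the torus. -/
def trig (r : Bool) (n : Fin d → ℤ) (x : Torus d) : ℝ :=
  if r then (mFourier n x).re else (mFourier n x).im

/-- Real (`true`) or imaginary (`false`) part as a real-linear map. -/
def partCLM (r : Bool) : ℂ →L[ℝ] ℝ := if r then Complex.reCLM else Complex.imCLM

lemma trig_eq (r : Bool) (n : Fin d → ℤ) (x : Torus d) :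
    trig r n x = partCLM r (mFourier n x) := by
  cases r <;> simp [trig, partCLM]

lemma partCLM_ofReal_mul (r : Bool) (a : ℝ) (z : ℂ) : partCLM r (a * z) = a * partCLM r z := by
  cases r <;> simp [partCLM]

lemma isSmooth_trig (r : Bool) (n : Fin d → ℤ) : IsSmooth (trig r n) := by
  unfold IsSmooth
  have h : lift (trig r n) = fun x : EuclideanSpace ℝ (Fin d) =>
      partCLM r (Complex.exp (2 * Real.pi * Complex.I * ∑ i, (n i : ℂ) * x i)) := by
    ext x
    rw [lift, trig_eq]
    congr 1
    exact mFourier_coe n (fun i => x i)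
  rw [h]
  refine (partCLM r).contDiff.comp (ContDiff.cexp (contDiff_const.mul ?_))
  refine ContDiff.sum fun i _ => contDiff_const.mul ?_
  exact Complex.ofRealCLM.contDiff.comp (EuclideanSpace.proj (𝕜 := ℝ) i).contDiff

lemma pderiv_partCLM_mFourier (r : Bool) (n : Fin d → ℤ) (c : ℂ) (i : Fin d) (x : Torus d) :
    pderiv i (fun x => partCLM r (c * mFourier n x)) x =
      partCLM r ((c * freq (some i) n) * mFourier n x) := by
  obtain ⟨y, rfl⟩ := proj_surjective x
  have h := (partCLM r).hasFDerivAt.comp y ((hasFDerivAt_mFourier_proj n y).const_mul c)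
  rw [pderiv_eq_of_hasFDerivAt (f := fun x => partCLM r (c * mFourier n x)) h i]
  have : ∀ k, (basisVec i : EuclideanSpace ℝ (Fin d)) k = if k = i then 1 else 0 := fun k => by
    simp [basisVec]
  simp only [ContinuousLinearMap.comp_apply, smul_apply, sum_apply, PiLp.proj_apply, this,
    Complex.ofRealCLM_apply]
  congr 1
  rw [Finset.sum_eq_single i]
  · simp; ring
  · intro k _ hk; simp [hk]
  · simp

lemma laplacian_trig (r : Bool) (n : Fin d → ℤ) (x : Torus d) :
    laplacian (trig r n) x = -lam n * trig r n x := by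
  have h0 : trig r n = fun x => partCLM r (1 * mFourier n x) := by
    ext x; rw [trig_eq, one_mul]
  have h1 : ∀ i, pderiv i (trig r n) =
      fun x => partCLM r ((1 * freq (some i) n) * mFourier n x) := fun i => by
    ext x; rw [h0]; exact pderiv_partCLM_mFourier r n 1 i x
  simp only [laplacian, h1, pderiv_partCLM_mFourier]
  rw [← map_sum, ← Finset.sum_mul, trig_eq, ← partCLM_ofReal_mul]
  congr 2
  simp only [one_mul, freq, lam]
  push_cast
  rw [Finset.mul_sum, ← Finset.sum_neg_distrib]
  refine Finset.sum_congr rfl fun i _ => ?_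
  linear_combination 4 * (Real.pi : ℂ) ^ 2 * (n i : ℂ) ^ 2 * Complex.I_sq

lemma eq_of_integral_trig {f g : Torus d → ℝ} (hf : Continuous f) (hg : Continuous g)
    (h : ∀ r n, ∫ x, f x * trig r n x = ∫ x, g x * trig r n x) : f = g := by
  set F : C(Torus d, ℂ) := ⟨fun x => ((f x - g x : ℝ) : ℂ), by fun_prop⟩
  have hF : F = 0 := by
    refine eq_zero_of_integral_mFourier F fun n => ?_
    have hi : Integrable (fun x => mFourier n x * F x) volume :=
      continuous_integrable_torus (by fun_prop)
    have key : ∀ r, partCLM r (∫ x, mFourier n x * F x) = 0 := fun r => by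
      rw [← ContinuousLinearMap.integral_comp_comm _ hi]
      have h2 : ∀ x, partCLM r (mFourier n x * F x) = f x * trig r n x - g x * trig r n x :=
        fun x => by
          rw [mul_comm, trig_eq, ← sub_mul]
          exact partCLM_ofReal_mul r _ _
      have hc := (isSmooth_trig r n).continuous
      simp_rw [h2]
      rw [integral_sub (continuous_integrable_torus (by fun_prop))
        (continuous_integrable_torus (by fun_prop)), h r n, sub_self]
    apply Complex.ext
    · simpa [partCLM] using key true
    · simpa [partCLM] using key false
  ext x
  have h1 := congrArg (fun F : C(Torus d, ℂ) => F x) hF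
  have h2 : ((f x - g x : ℝ) : ℂ) = 0 := h1
  have h3 : f x - g x = 0 := by exact_mod_cast h2
  linarith

lemma kernel_none_neg (τ : ℝ) (hτ : 0 < τ) (x : Torus d) :
    kernel none τ (-x) = kernel none τ x := by
  have h : (kernelC none τ (-x) : ℂ) = kernelC none τ x := by
    have h1 := trigSeries_apply (summable_norm_coef none hτ) x
    have h2 := trigSeries_apply (summable_norm_coef none hτ) (-x)
    rw [← (Equiv.neg (Fin d → ℤ)).hasSum_iff] at h2
    refine h2.unique ?_
    convert h1 using 1
    · ext n
      simp [coef, freq, lam_neg, mFourier_neg_apply]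
    · rfl
  rw [kernel, h, kernel]

/-- Heat convolution is self-adjoint because the kernel is even. -/
lemma integral_conv_mul {τ : ℝ} (hτ : 0 < τ) {f g : Torus d → ℝ} (hf : Integrable f volume)
    (hg : Integrable g volume) :
    ∫ x, conv none τ f x * g x = ∫ x, f x * conv none τ g x := by
  unfold conv
  have hint : Integrable (Function.uncurry fun x y : Torus d =>
      (kernel none τ (x - y) * f y) * g x) (volume.prod volume) := by
    have h1 : Integrable (fun w : Torus d × Torus d => g w.1 * f w.2) (volume.prod volume) :=
      hg.mul_prod hf
    have hc : Continuous fun w : Torus d × Torus d => kernel none τ (w.1 - w.2) := by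
      have := continuous_kernel (d := d) none τ
      fun_prop
    refine (h1.bdd_mul (c := kernelBound (d := d) none τ) hc.aestronglyMeasurable
      (Eventually.of_forall fun w => abs_kernel_le none hτ le_rfl _)).congr
      (Eventually.of_forall fun w => ?_)
    simp only [Function.uncurry]; ring
  simp_rw [← integral_mul_const]
  rw [integral_integral_swap hint]
  refine integral_congr_ae (Eventually.of_forall fun y => ?_)
  simp only [← integral_const_mul]
  refine integral_congr_ae (Eventually.of_forall fun x => ?_)
  simp only
  rw [← kernel_none_neg τ hτ (x - y), neg_sub]
  ring

lemma conv_trig (r : Bool) (n : Fin d → ℤ) {τ : ℝ} (hτ : 0 < τ) (x : Torus d) :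
    conv none τ (trig r n) x = Real.exp (-lam n * τ) * trig r n x := by
  have h := integral_mFourier_mul_trigSeries (summable_norm_coef none hτ) n x
  have h1 : partCLM r (∫ y, mFourier n y * kernelC none τ (x - y)) =
      partCLM r (coef none τ n * mFourier n x) := congrArg _ h
  rw [← ContinuousLinearMap.integral_comp_comm _
    (continuous_integrable_torus (by fun_prop))] at h1
  rw [trig_eq, ← partCLM_ofReal_mul]
  simp only [coef, freq, one_mul] at h1
  rw [← h1, conv]
  refine integral_congr_ae (Eventually.of_forall fun y => ?_)
  simp only
  rw [← ofReal_kernel none hτ, mul_comm (mFourier n y), partCLM_ofReal_mul, trig_eq]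

lemma continuousOn_conv (j : Option (Fin d)) {f : Torus d → ℝ} (hf : Integrable f volume) :
    ContinuousOn (fun z : ℝ × Torus d => conv j z.1 f z.2) (Ioi (0 : ℝ) ×ˢ univ) := by
  rintro ⟨τ, x⟩ ⟨hτ, -⟩
  have hτ' : 0 < τ := hτ
  refine ContinuousAt.continuousWithinAt ?_
  have hnhds : ∀ᶠ z : ℝ × Torus d in 𝓝 (τ, x), τ / 2 < z.1 :=
    continuousAt_fst (Ioi_mem_nhds (half_lt_self hτ'))
  refine continuousAt_of_dominated (bound := fun y => kernelBound j (τ / 2) * ‖f y‖)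
    (Eventually.of_forall fun z => (integrable_kernel_mul j z.1 hf z.2).aestronglyMeasurable)
    ?_ (hf.norm.const_mul _) (Eventually.of_forall fun y => ?_)
  · filter_upwards [hnhds] with z hz
    refine Eventually.of_forall fun y => ?_
    rw [norm_mul]
    gcongr
    exact abs_kernel_le j (half_pos hτ') hz.le _
  · refine ContinuousAt.mul ?_ continuousAt_const
    have h1 : ContinuousAt (fun z : ℝ × Torus d => kernel j z.1 z.2) (τ, x - y) :=
      (continuousOn_kernel j).continuousAt (prod_mem_nhds (Ioi_mem_nhds hτ') univ_mem)
    exact ContinuousAt.comp (x := (τ, x)) (f := fun z : ℝ × Torus d => (z.1, z.2 - y)) h1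
      (by fun_prop)

lemma abs_conv_none_le_of_bound {τ M : ℝ} (hτ : 0 < τ) {f : Torus d → ℝ}
    (hf : Continuous f) (hM : ∀ x, |f x| ≤ M) (x : Torus d) : |conv none τ f x| ≤ M := by
  simpa [integral_abs_weight_none] using abs_conv_le_of_continuous none hτ hf hM x

lemma aestronglyMeasurable_conv (j : Option (Fin d)) {f : Torus d → ℝ} (hf : Integrable f volume)
    (t : ℝ) : AEStronglyMeasurable (fun z : ℝ × Torus d => conv j z.1 f z.2)
      ((volume.restrict (Ioc 0 t)).prod volume) := by
  have h1 : ((volume.restrict (Ioc 0 t)).prod volume : Measure (ℝ × Torus d)) =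
      (volume.prod volume).restrict (Ioc 0 t ×ˢ univ) := by
    rw [← Measure.prod_restrict, Measure.restrict_univ]
  rw [h1]
  exact ((continuousOn_conv j hf).mono (prod_mono Ioc_subset_Ioi_self subset_rfl)).aestronglyMeasurable
    (measurableSet_Ioc.prod MeasurableSet.univ)

lemma integrable_conv_prod {f : Torus d → ℝ} (hf : Continuous f) (t : ℝ) :
    Integrable (fun z : ℝ × Torus d => conv none z.1 f z.2)
      ((volume.restrict (Ioc 0 t)).prod volume) := by
  obtain ⟨M, hM⟩ := isCompact_univ.exists_bound_of_continuousOn hf.continuousOn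
  refine Integrable.of_bound
    (aestronglyMeasurable_conv none (continuous_integrable_torus hf) t) M ?_
  have h1 : ((volume.restrict (Ioc 0 t)).prod volume : Measure (ℝ × Torus d)) =
      (volume.prod volume).restrict (Ioc 0 t ×ˢ univ) := by
    rw [← Measure.prod_restrict, Measure.restrict_univ]
  rw [h1]
  refine (ae_restrict_iff' (measurableSet_Ioc.prod MeasurableSet.univ)).mpr
    (Eventually.of_forall fun z hz => ?_)
  exact abs_conv_none_le_of_bound hz.1.1 hf (fun x => hM x (mem_univ x)) _

lemma continuous_integral_conv {ψ : Torus d → ℝ} (hψ : Continuous ψ) (t : ℝ) :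
    Continuous fun x => ∫ r in Ioc 0 t, conv none r ψ x := by
  obtain ⟨M, hM⟩ := isCompact_univ.exists_bound_of_continuousOn hψ.continuousOn
  refine continuous_of_dominated (bound := fun _ => M) (fun x => ?_) (fun x => ?_)
    (integrable_const _) ?_
  · have h1 : ContinuousOn (fun r : ℝ => (r, x)) (Ioc 0 t) := by fun_prop
    have h2 : MapsTo (fun r : ℝ => (r, x)) (Ioc 0 t) (Ioi (0 : ℝ) ×ˢ univ) :=
      fun r hr => ⟨hr.1, mem_univ x⟩
    have h3 := (continuousOn_conv none (continuous_integrable_torus hψ)).comp h1 h2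
    exact h3.aestronglyMeasurable measurableSet_Ioc
  · refine (ae_restrict_iff' measurableSet_Ioc).mpr (Eventually.of_forall fun r hr => ?_)
    exact abs_conv_none_le_of_bound hr.1 hψ (fun x => hM x (mem_univ x)) _
  · refine (ae_restrict_iff' measurableSet_Ioc).mpr (Eventually.of_forall fun r hr => ?_)
    exact continuous_conv none hr.1 (continuous_integrable_torus hψ)

/-- Duhamel's formula for the heat semigroup acting on smooth functions. -/
lemma conv_eq_add_integral {φ : Torus d → ℝ} (hφ : IsSmooth φ) {t : ℝ} (ht : 0 < t)
    (x : Torus d) :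
    conv none t φ x = φ x + ∫ r in Ioc 0 t, conv none r (laplacian φ) x := by
  have hc := hφ.continuous
  have hl := hφ.continuous_laplacian
  have hint := integrable_conv_prod hl t
  have hG := continuous_integral_conv hl t
  have hcG : Continuous fun x => φ x + ∫ r in Ioc 0 t, conv none r (laplacian φ) x := hc.add hG
  suffices h : conv none t φ = fun x => φ x + ∫ r in Ioc 0 t, conv none r (laplacian φ) x from
    congrFun h x
  -- Both sides are continuous, so their trigonometric coefficients may be compared. There the heat
  -- flow multiplies by `exp (-λt)` and the Laplacian by `-λ`, which reduces the claim to `exp (-λt)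
  -- - 1 = ∫₀ᵗ -λ exp (-λr) dr`.
  refine eq_of_integral_trig (continuous_conv none ht (continuous_integrable_torus hc)) hcG
    fun b n => ?_
  have hs := isSmooth_trig b n
  have hsc := hs.continuous
  have h1 : ∀ r, 0 < r → ∀ ψ : Torus d → ℝ, Continuous ψ → ∫ x, conv none r ψ x * trig b n x =
      Real.exp (-lam n * r) * ∫ x, ψ x * trig b n x := by
    intro r hr ψ hψ
    rw [integral_conv_mul hr (continuous_integrable_torus hψ) (continuous_integrable_torus hsc)]
    simp_rw [conv_trig b n hr]
    rw [← integral_const_mul]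
    refine integral_congr_ae (Eventually.of_forall fun x => ?_)
    simp only; ring
  have h2 : ∫ x, laplacian φ x * trig b n x = -lam n * ∫ x, φ x * trig b n x := by
    have := integral_mul_laplacian hs hφ
    simp_rw [laplacian_trig] at this
    rw [← integral_const_mul]
    simp_rw [mul_comm (laplacian φ _), this]
    refine integral_congr_ae (Eventually.of_forall fun x => ?_)
    simp only; ring
  rw [h1 t ht φ hc]
  simp only [add_mul]
  have hi1 : Integrable (fun x => φ x * trig b n x) volume :=
    continuous_integrable_torus (hc.mul hsc)
  have hi2 : Integrable (fun x => (∫ r in Ioc 0 t, conv none r (laplacian φ) x) * trig b n x)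
    volume := continuous_integrable_torus (hG.mul hsc)
  rw [integral_add hi1 hi2]
  have h3 : ∫ x, (∫ r in Ioc 0 t, conv none r (laplacian φ) x) * trig b n x =
      ∫ r in Ioc 0 t, ∫ x, conv none r (laplacian φ) x * trig b n x := by
    simp_rw [← integral_mul_const]
    refine integral_integral_swap ?_
    obtain ⟨M', hM'⟩ := isCompact_univ.exists_bound_of_continuousOn hsc.continuousOn
    refine (hint.swap.bdd_mul (c := M') (f := fun z : Torus d × ℝ => trig b n z.1) ?_ ?_).congr
      (Eventually.of_forall fun z => ?_)
    · exact (hsc.comp continuous_fst).aestronglyMeasurable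
    · exact Eventually.of_forall fun z => hM' _ (mem_univ _)
    · exact mul_comm _ _
  have h4 : ∫ r in Ioc 0 t, ∫ x, conv none r (laplacian φ) x * trig b n x =
      ∫ r in Ioc 0 t, (-lam n * Real.exp (-lam n * r)) * ∫ x, φ x * trig b n x := by
    refine setIntegral_congr_fun measurableSet_Ioc fun r hr => ?_
    rw [h1 r hr.1 _ hl, h2]
    ring
  have h5 : ∫ r in Ioc 0 t, -lam n * Real.exp (-lam n * r) = Real.exp (-lam n * t) - 1 := by
    rw [← intervalIntegral.integral_of_le ht.le,
      intervalIntegral.integral_eq_sub_of_hasDerivAt (f := fun r => Real.exp (-lam n * r))]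
    · simp
    · intro r _
      have := ((hasDerivAt_id r).const_mul (-lam n)).exp
      simpa [mul_comm] using this
    · exact Continuous.intervalIntegrable (by fun_prop) _ _
  rw [h3, h4, integral_mul_const, h5]
  ring

/-! ### Mixed norms and singular integrals in time. -/

lemma aemeasurable_eLpNorm_slice {α β E : Type*} [MeasurableSpace α] [MeasurableSpace β]
    [NormedAddCommGroup E] {μ : Measure α} {ν : Measure β} [SFinite μ] [SFinite ν]
    {f : α → β → E} (hf : AEStronglyMeasurable (fun z : α × β => f z.1 z.2) (μ.prod ν))
    (p : ℝ≥0∞) : AEMeasurable (fun a => eLpNorm (f a) p ν) μ := by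
  obtain ⟨g, hg, hfg⟩ := hf
  have h1 : ∀ᵐ a ∂μ, eLpNorm (f a) p ν = eLpNorm (fun y => g (a, y)) p ν := by
    filter_upwards [Measure.ae_ae_of_ae_prod hfg] with a ha
    exact eLpNorm_congr_ae ha
  refine AEMeasurable.congr (Measurable.aemeasurable ?_) (h1.mono fun a ha => ha.symm)
  have hgm : Measurable fun z => ‖g z‖ₑ := hg.enorm
  rcases eq_or_ne p 0 with h0 | h0
  · simp [h0]
  rcases eq_or_ne p ∞ with ht | ht
  · simp only [ht, eLpNorm_exponent_top, eLpNormEssSup]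
    -- A sublevel set of the essential supremum consists of the `a` whose slice of `{c < ‖g‖}` is
    -- null, and measures of slices depend measurably on `a`.
    refine measurable_of_Iic fun c => ?_
    have h2 : (fun a => essSup (fun y => ‖g (a, y)‖ₑ) ν) ⁻¹' Iic c =
        {a | ν (Prod.mk a ⁻¹' {z | c < ‖g z‖ₑ}) = 0} := by
      ext a
      simp only [mem_preimage, mem_Iic, mem_ofPred_eq]
      constructor
      · intro h
        have h3 := ae_le_essSup (μ := ν) (f := fun y => ‖g (a, y)‖ₑ)
        have h4 : ∀ᵐ y ∂ν, ‖g (a, y)‖ₑ ≤ c := h3.mono fun y hy => hy.trans h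
        rw [ae_iff] at h4
        simpa using h4
      · intro h
        refine essSup_le_of_ae_le c ?_
        rw [EventuallyLE, ae_iff]
        simpa using h
    rw [h2]
    exact (measurable_measure_prodMk_left (measurableSet_lt measurable_const hgm))
      (measurableSet_singleton 0)
  · simp only [eLpNorm_eq_lintegral_rpow_enorm_toReal h0 ht]
    exact ((hgm.pow_const _).lintegral_prod_right').pow_const _

/-- Hölder's inequality in time. -/
lemma exists_lintegral_mul_le {T : ℝ} {q : ℝ≥0∞} (hq : 2 < q) {M : ℝ → ℝ≥0∞}
    (hM : AEMeasurable M (volume.restrict (Icc 0 T)))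
    (hMq : eLpNorm M q (volume.restrict (Icc 0 T)) < ⊤) :
    ∃ r : ℝ, 1 ≤ r ∧ r < 2 ∧ 1 / r = 1 - (q⁻¹).toReal ∧ ∃ S : ℝ≥0, ∀ t ≤ T, ∀ f : ℝ → ℝ≥0∞,
      Measurable f → ∫⁻ s in Ioo 0 t, f s * M s ≤ (∫⁻ s in Ioo 0 t, f s ^ r) ^ (1 / r) * S := by
  have hle : ∀ t ≤ T, (volume.restrict (Ioo 0 t) : Measure ℝ) ≤ volume.restrict (Icc 0 T) :=
    fun t ht => Measure.restrict_mono
      (Ioo_subset_Icc_self.trans (Icc_subset_Icc_right ht)) le_rfl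
  rcases eq_or_ne q ∞ with h | h
  · subst h
    refine ⟨1, le_rfl, by norm_num, by simp, (eLpNorm M ∞ (volume.restrict (Icc 0 T))).toNNReal,
      fun t ht f hf => ?_⟩
    rw [ENNReal.coe_toNNReal hMq.ne]
    simp only [ENNReal.rpow_one, div_one]
    rw [← lintegral_mul_const _ hf]
    refine lintegral_mono_ae ?_
    have h1 : ∀ᵐ s ∂(volume.restrict (Icc 0 T)), M s ≤ eLpNorm M ∞ (volume.restrict (Icc 0 T)) := by
      simpa [eLpNorm_exponent_top, eLpNormEssSup] using
        ae_le_essSup (μ := volume.restrict (Icc 0 T)) (f := M)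
    filter_upwards [ae_mono (hle t ht) h1] with s hs
    gcongr
  -- Here `r` is the exponent conjugate to `q`. The condition `q > 2` means `r < 2`, which makes
  -- `s^{-1/2}` integrable to the power `r` at time zero.
  · have hq2 : 2 < q.toReal := by
      rw [← ENNReal.toReal_ofNat]
      exact (ENNReal.toReal_lt_toReal (by simp) h).mpr hq
    have hconj := (Real.HolderConjugate.conjExponent (by linarith : 1 < q.toReal)).symm
    set r := q.toReal.conjExponent with hr
    have hr1 : r⁻¹ = 1 - q.toReal⁻¹ := by
      have := hconj.inv_add_inv_eq_one
      linarith
    have hq3 : q.toReal⁻¹ < 2⁻¹ := by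
      apply inv_strictAnti₀ (by norm_num) hq2
    have hr0 : 1 < r := hconj.lt
    refine ⟨r, hr0.le, ?_, by rw [one_div, hr1, ENNReal.toReal_inv],
      (eLpNorm M q (volume.restrict (Icc 0 T))).toNNReal, fun t ht f hf => ?_⟩
    · have : 2⁻¹ < r⁻¹ := by rw [hr1]; linarith
      exact (inv_lt_inv₀ (by norm_num) (by linarith)).mp this
    · rw [ENNReal.coe_toNNReal hMq.ne]
      refine (ENNReal.lintegral_mul_le_Lp_mul_Lq (volume.restrict (Ioo 0 t)) hconj hf.aemeasurable
        (hM.mono_measure (hle t ht))).trans ?_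
      gcongr
      rw [eLpNorm_eq_lintegral_rpow_enorm_toReal (by rintro rfl; simp at hq) h]
      simp only [enorm_eq_self]
      gcongr ?_ ^ _
      exact lintegral_mono' (hle t ht) le_rfl

lemma lintegral_rpow_neg {t b : ℝ} (ht : 0 < t) (hb : b < 1) :
    ∫⁻ s in Ioo 0 t, ENNReal.ofReal (s ^ (-b)) = ENNReal.ofReal (t ^ (1 - b) / (1 - b)) := by
  have hi := intervalIntegral.intervalIntegrable_rpow' (a := 0) (b := t) (by linarith : -1 < -b)
  rw [intervalIntegrable_iff_integrableOn_Ioo_of_le ht.le] at hi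
  rw [← ofReal_integral_eq_lintegral_ofReal hi
    ((ae_restrict_iff' measurableSet_Ioo).mpr (Eventually.of_forall fun s hs =>
      Real.rpow_nonneg hs.1.le _)), ← integral_Ioc_eq_integral_Ioo,
    ← intervalIntegral.integral_of_le ht.le, integral_rpow (Or.inl (by linarith)),
    Real.zero_rpow (by linarith)]
  congr 1
  rw [sub_zero]
  congr 1 <;> ring_nf

lemma lintegral_sub_rpow_neg {t b : ℝ} (ht : 0 < t) (hb : b < 1) :
    ∫⁻ s in Ioo 0 t, ENNReal.ofReal ((t - s) ^ (-b)) = ENNReal.ofReal (t ^ (1 - b) / (1 - b)) := by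
  rw [← lintegral_rpow_neg ht hb, ← lintegral_indicator measurableSet_Ioo,
    ← lintegral_indicator measurableSet_Ioo,
    ← lintegral_sub_left_eq_self (fun s => (Ioo 0 t).indicator
      (fun s => ENNReal.ofReal (s ^ (-b))) s) t]
  refine lintegral_congr fun s => ?_
  have : t - s ∈ Ioo 0 t ↔ s ∈ Ioo 0 t := by
    constructor <;> rintro ⟨h1, h2⟩ <;> constructor <;> linarith
  by_cases h : s ∈ Ioo 0 t
  · rw [indicator_of_mem h, indicator_of_mem (this.mpr h)]
  · rw [indicator_of_notMem h, indicator_of_notMem (mt this.mp h)]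

/-- On each half of `(0, t)` only one factor is singular; the other is at most its value at `t/2`.
-/
lemma rpow_mul_rpow_le {t s a b : ℝ} (hs : 0 < s) (hst : s < t) (ha : 0 ≤ a) (hb : 0 ≤ b) :
    (t - s) ^ (-a) * s ^ (-b) ≤
      (t / 2) ^ (-a) * s ^ (-b) + (t / 2) ^ (-b) * (t - s) ^ (-a) := by
  have hts : 0 < t - s := by linarith
  have ht2 : 0 < t / 2 := by linarith
  rcases le_total s (t / 2) with h | h
  · have h1 : (t - s) ^ (-a) ≤ (t / 2) ^ (-a) :=
      Real.rpow_le_rpow_of_nonpos ht2 (by linarith) (by linarith)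
    have h2 : (t - s) ^ (-a) * s ^ (-b) ≤ (t / 2) ^ (-a) * s ^ (-b) := by gcongr
    have h3 : 0 ≤ (t / 2) ^ (-b) * (t - s) ^ (-a) := by positivity
    linarith
  · have h1 : s ^ (-b) ≤ (t / 2) ^ (-b) :=
      Real.rpow_le_rpow_of_nonpos ht2 h (by linarith)
    have h2 : (t - s) ^ (-a) * s ^ (-b) ≤ (t - s) ^ (-a) * (t / 2) ^ (-b) := by gcongr
    have h3 : 0 ≤ (t / 2) ^ (-a) * s ^ (-b) := by positivity
    linarith

/-- An upper bound for the Beta integral with its exact scaling in `t`; separating the two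
singularities makes it elementary. -/
lemma exists_lintegral_beta_le {a b : ℝ} (ha : 0 ≤ a) (ha1 : a < 1) (hb : 0 ≤ b) (hb1 : b < 1) :
    ∃ C : ℝ, 0 ≤ C ∧ ∀ t, 0 < t →
      ∫⁻ s in Ioo 0 t, ENNReal.ofReal ((t - s) ^ (-a) * s ^ (-b)) ≤
        ENNReal.ofReal (C * t ^ (1 - a - b)) := by
  have ha' : 0 < 1 - a := by linarith
  have hb' : 0 < 1 - b := by linarith
  refine ⟨2 ^ a / (1 - b) + 2 ^ b / (1 - a), by positivity, fun t ht => ?_⟩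
  have ht2 : 0 < t / 2 := by linarith
  have hhalf : ∀ c : ℝ, (t / 2) ^ (-c) = 2 ^ c * t ^ (-c) := fun c => by
    rw [Real.div_rpow ht.le (by norm_num), Real.rpow_neg (by norm_num : (0 : ℝ) ≤ 2)]
    field_simp
  calc ∫⁻ s in Ioo 0 t, ENNReal.ofReal ((t - s) ^ (-a) * s ^ (-b))
      ≤ ∫⁻ s in Ioo 0 t, (ENNReal.ofReal ((t / 2) ^ (-a)) * ENNReal.ofReal (s ^ (-b)) +
          ENNReal.ofReal ((t / 2) ^ (-b)) * ENNReal.ofReal ((t - s) ^ (-a))) := by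
        refine setLIntegral_mono' measurableSet_Ioo fun s hs => ?_
        have hs0 : 0 < s := hs.1
        have hts : 0 < t - s := by linarith [hs.2]
        rw [← ENNReal.ofReal_mul (by positivity), ← ENNReal.ofReal_mul (by positivity),
          ← ENNReal.ofReal_add (by positivity) (by positivity)]
        exact ENNReal.ofReal_le_ofReal (rpow_mul_rpow_le hs.1 hs.2 ha hb)
    _ = ENNReal.ofReal ((t / 2) ^ (-a)) * ENNReal.ofReal (t ^ (1 - b) / (1 - b)) +
          ENNReal.ofReal ((t / 2) ^ (-b)) * ENNReal.ofReal (t ^ (1 - a) / (1 - a)) := by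
        rw [lintegral_add_left (by fun_prop), lintegral_const_mul _ (by fun_prop),
          lintegral_const_mul _ (by fun_prop), lintegral_rpow_neg ht hb1,
          lintegral_sub_rpow_neg ht ha1]
    _ ≤ _ := by
        rw [← ENNReal.ofReal_mul (by positivity), ← ENNReal.ofReal_mul (by positivity),
          ← ENNReal.ofReal_add (by positivity) (by positivity)]
        refine ENNReal.ofReal_le_ofReal (le_of_eq ?_)
        have e1 : t ^ (-a) * t ^ (1 - b) = t ^ (1 - a - b) := by
          rw [← Real.rpow_add ht]; congr 1; ring
        have e2 : t ^ (-b) * t ^ (1 - a) = t ^ (1 - a - b) := by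
          rw [← Real.rpow_add ht]; congr 1; ring
        rw [hhalf, hhalf, add_mul, ← e1]
        nth_rw 2 [e1]
        rw [← e2]
        ring

/-- Weighted time integrals of `L^q` functions. -/
lemma exists_lintegral_time_le {T : ℝ} {q : ℝ≥0∞} (hq : 2 < q) {M : ℝ → ℝ≥0∞}
    (hM : AEMeasurable M (volume.restrict (Icc 0 T)))
    (hMq : eLpNorm M q (volume.restrict (Icc 0 T)) < ⊤) {a : ℝ} (ha : 0 ≤ a)
    (ha1 : a < 1 - (q⁻¹).toReal) :
    ∃ C : ℝ, 0 ≤ C ∧ ∀ t, 0 < t → t ≤ T →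
      ∫⁻ s in Ioo 0 t, ENNReal.ofReal ((t - s) ^ (-a) * s ^ (-(1 / 2) : ℝ)) * M s ≤
        ENNReal.ofReal (C * t ^ (1 / 2 - (q⁻¹).toReal - a)) := by
  obtain ⟨r, hr1, hr2, hrq, S, hS⟩ := exists_lintegral_mul_le hq hM hMq
  have hr0 : 0 < r := by linarith
  rw [← hrq] at ha1
  have har : a * r < 1 := by rwa [lt_div_iff₀ hr0] at ha1
  -- After raising to the power `r` both exponents stay below `1`: `a r < 1` because `a < 1/r`, and
  -- `r/2 < 1` because `r < 2`. The final power is `(1 - ar - r/2)/r = 1/2 - 1/q - a`.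
  obtain ⟨C, hC0, hC⟩ := exists_lintegral_beta_le (a := a * r) (b := 1 / 2 * r) (by positivity)
    har (by positivity) (by linarith)
  refine ⟨C ^ (1 / r) * S, by positivity, fun t ht htT => ?_⟩
  refine (hS t htT _ (by fun_prop)).trans ?_
  have h1 : ∫⁻ s in Ioo 0 t, ENNReal.ofReal ((t - s) ^ (-a) * s ^ (-(1 / 2) : ℝ)) ^ r =
      ∫⁻ s in Ioo 0 t, ENNReal.ofReal ((t - s) ^ (-(a * r)) * s ^ (-(1 / 2 * r))) := by
    refine setLIntegral_congr_fun measurableSet_Ioo fun s hs => ?_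
    have hs0 : 0 < s := hs.1
    have hts : 0 < t - s := by linarith [hs.2]
    rw [ENNReal.ofReal_rpow_of_nonneg (by positivity) hr0.le,
      Real.mul_rpow (by positivity) (by positivity), ← Real.rpow_mul hts.le,
      ← Real.rpow_mul hs0.le, neg_mul, neg_mul]
  rw [h1]
  calc _ ≤ ENNReal.ofReal (C * t ^ (1 - a * r - 1 / 2 * r)) ^ (1 / r) * S := by
        gcongr; exact hC t ht
    _ ≤ _ := by
        rw [ENNReal.ofReal_rpow_of_nonneg (by positivity) (by positivity),
          ← ENNReal.ofReal_coe_nnreal, ← ENNReal.ofReal_mul (by positivity)]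
        refine ENNReal.ofReal_le_ofReal (le_of_eq ?_)
        rw [Real.mul_rpow hC0 (by positivity), ← Real.rpow_mul ht.le]
        have : (1 - a * r - 1 / 2 * r) * (1 / r) = 1 / 2 - (q⁻¹).toReal - a := by
          have : (q⁻¹).toReal = 1 - 1 / r := by linarith
          rw [this]; field_simp; ring
        rw [this]
        ring

/-! ### Sources and size estimates for their heat potentials. -/

/-- The function `β` is an envelope for lower order coefficients in the subcritical class. -/
structure Admissible (T : ℝ) (p q : ℝ≥0∞) (β : ℝ → Torus d → ℝ) : Prop where
  one_le : 1 ≤ p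
  two_lt : 2 < q
  subcritical : krExponent d p q < 1
  mem : MemLqLp T q p β

/-- The function `g` is measurable in time and space and dominated by `w(t) |β(t,x)|`. -/
structure IsSource (T : ℝ) (β : ℝ → Torus d → ℝ) (w : ℝ → ℝ) (g : ℝ → Torus d → ℝ) : Prop where
  meas : AEStronglyMeasurable (fun z : ℝ × Torus d => g z.1 z.2) (cylinder d T)
  le : ∀ s ∈ Ioc 0 T, ∀ x, |g s x| ≤ w s * |β s x|

lemma krExponent_eq (d : ℕ) (p q : ℝ≥0∞) :
    krExponent d p q = 2 * (q⁻¹).toReal + 2 * smoothExp d p := by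
  rw [krExponent, smoothExp]; ring

section
variable {T : ℝ} {p q : ℝ≥0∞} {β g : ℝ → Torus d → ℝ} {w : ℝ → ℝ}

lemma Admissible.aemeasurable (h : Admissible T p q β) :
    AEMeasurable (fun s => eLpNorm (β s) p volume) (volume.restrict (Icc 0 T)) :=
  aemeasurable_eLpNorm_slice h.mem.1 p

lemma Admissible.ae_lt_top (h : Admissible T p q β) :
    ∀ᵐ s ∂(volume.restrict (Icc 0 T)), eLpNorm (β s) p volume < ⊤ := by
  have hq0 : q ≠ 0 := by rintro rfl; simpa using h.two_lt
  have h1 := h.mem.2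
  rcases eq_or_ne q ∞ with ht | ht
  · subst ht
    rw [eLpNorm_exponent_top, eLpNormEssSup] at h1
    filter_upwards [ae_le_essSup (μ := volume.restrict (Icc 0 T))
      (f := fun s => ‖eLpNorm (β s) p volume‖ₑ)] with s hs
    exact hs.trans_lt h1
  · have h2 := lintegral_rpow_enorm_lt_top_of_eLpNorm_lt_top hq0 ht h1
    have hq1 : 0 < q.toReal := ENNReal.toReal_pos hq0 ht
    filter_upwards [ae_lt_top' (h.aemeasurable.enorm.pow_const _) h2.ne] with s hs
    exact (ENNReal.rpow_lt_top_iff_of_pos hq1).mp hs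

lemma Admissible.ae_slice (h : Admissible T p q β) (hg : IsSource T β w g) :
    ∀ᵐ s ∂(volume.restrict (Ioc 0 T)), MemLp (g s) p volume ∧
      eLpNorm (g s) p volume ≤ ENNReal.ofReal (w s) * eLpNorm (β s) p volume := by
  have hle : (volume.restrict (Ioc 0 T) : Measure ℝ) ≤ volume.restrict (Icc 0 T) :=
    Measure.restrict_mono Ioc_subset_Icc_self le_rfl
  have h1 : ∀ᵐ s ∂(volume.restrict (Icc 0 T)), AEStronglyMeasurable (g s) volume :=
    AEStronglyMeasurable.prodMk_left hg.meas
  filter_upwards [ae_mono hle h.ae_lt_top, ae_mono hle h1,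
    ae_restrict_mem measurableSet_Ioc] with s hs1 hs2 hs3
  have h2 : eLpNorm (g s) p volume ≤ ENNReal.ofReal (w s) * eLpNorm (β s) p volume :=
    eLpNorm_le_mul_eLpNorm_of_ae_le_mul (Eventually.of_forall fun x => by
      simpa using hg.le s hs3 x) p
  exact ⟨⟨hs2, h2.trans_lt (ENNReal.mul_lt_top (by simp) hs1)⟩, h2⟩

lemma Ioo_prod_le_cylinder {t : ℝ} (ht : t ≤ T) :
    ((volume.restrict (Ioo 0 t)).prod volume : Measure (ℝ × Torus d)) ≤ cylinder d T := by
  unfold cylinder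
  exact Measure.prod_mono (Measure.restrict_mono
      (Ioo_subset_Icc_self.trans (Icc_subset_Icc_right ht)) le_rfl) le_rfl

lemma Ioo_prod_eq (t : ℝ) : ((volume.restrict (Ioo 0 t)).prod volume : Measure (ℝ × Torus d)) =
    (volume.prod volume).restrict (Ioo 0 t ×ˢ univ) := by
  rw [← Measure.prod_restrict, Measure.restrict_univ]

lemma aestronglyMeasurable_kernel_mul (hg : IsSource T β w g) (j : Option (Fin d)) {t : ℝ}
    (ht : t ≤ T) (x : Torus d) :
    AEStronglyMeasurable (fun z : ℝ × Torus d => kernel j (t - z.1) (x - z.2) * g z.1 z.2)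
      ((volume.restrict (Ioo 0 t)).prod volume) := by
  refine AEStronglyMeasurable.mul ?_ (hg.meas.mono_measure (Ioo_prod_le_cylinder ht))
  rw [Ioo_prod_eq]
  have h1 : ContinuousOn (fun z : ℝ × Torus d => (t - z.1, x - z.2)) (Ioo 0 t ×ˢ univ) := by
    fun_prop
  have h2 : MapsTo (fun z : ℝ × Torus d => (t - z.1, x - z.2)) (Ioo 0 t ×ˢ univ)
      (Ioi (0 : ℝ) ×ˢ univ) := fun z hz => ⟨sub_pos.mpr hz.1.2, mem_univ _⟩
  have h3 := (continuousOn_kernel j).comp h1 h2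
  exact h3.aestronglyMeasurable (measurableSet_Ioo.prod MeasurableSet.univ)

lemma aestronglyMeasurable_conv_slice (hg : IsSource T β w g) (j : Option (Fin d)) {t : ℝ}
    (ht : t ≤ T) (x : Torus d) :
    AEStronglyMeasurable (fun s => conv j (t - s) (g s) x) (volume.restrict (Ioo 0 t)) :=
  (aestronglyMeasurable_kernel_mul hg j ht x).integral_prod_right'

/-- The Duhamel potential `∫₀ᵗ P_{t-s} g_s ds` (`none`) and its derivatives (`some i`). -/
def potential (j : Option (Fin d)) (g : ℝ → Torus d → ℝ) (t : ℝ) (x : Torus d) : ℝ :=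
  ∫ s in Ioo 0 t, conv j (t - s) (g s) x

/-- The smoothing estimates applied to time slices. They hold only for almost every `s`, as `g s`
lies in `L^p` only then, but the null set serves all `j`, `x` and `θ`, and the constant depends on
neither `w` nor `g`. -/
lemma Admissible.exists_ae_conv_le (h : Admissible T p q β) : ∃ C : ℝ, 0 ≤ C ∧
    ∀ (w : ℝ → ℝ) (g : ℝ → Torus d → ℝ), (∀ s, 0 ≤ w s) → IsSource T β w g →
      ∀ t ≤ T, ∀ᵐ s ∂(volume.restrict (Ioo 0 t)), Integrable (g s) volume ∧ ∀ j,
        (∀ x, ‖conv j (t - s) (g s) x‖ₑ ≤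
          ENNReal.ofReal (C * ((t - s) ^ (-(smoothExp d p + halfOrder j)) * w s)) *
            eLpNorm (β s) p volume) ∧
        ∀ θ, 0 ≤ θ → θ ≤ 1 → ∀ x x',
          ‖conv j (t - s) (g s) (proj x) - conv j (t - s) (g s) (proj x')‖ₑ ≤
          ENNReal.ofReal (C * ‖x - x'‖ ^ θ *
            ((t - s) ^ (-(smoothExp d p + halfOrder j + θ / 2)) * w s)) *
            eLpNorm (β s) p volume := by
  obtain ⟨C, hC0, hC⟩ := exists_abs_conv_le d p h.one_le T
  refine ⟨C, hC0, fun w g hw hg t ht => ?_⟩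
  have hle : (volume.restrict (Ioo 0 t) : Measure ℝ) ≤ volume.restrict (Ioc 0 T) :=
    Measure.restrict_mono (Ioo_subset_Ioc_self.trans (Ioc_subset_Ioc_right ht)) le_rfl
  filter_upwards [ae_mono hle (h.ae_slice hg), ae_restrict_mem measurableSet_Ioo] with s hs1 hs
  refine ⟨hs1.1.integrable h.one_le, fun j => ?_⟩
  have hs0 : 0 < s := hs.1
  have hts : 0 < t - s := by linarith [hs.2]
  obtain ⟨hA, hB⟩ := hC (g s) hs1.1 (t - s) hts (by linarith) j
  have key : ∀ (a D : ℝ), 0 ≤ D → |a| ≤ D * (eLpNorm (g s) p volume).toReal →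
      ‖a‖ₑ ≤ ENNReal.ofReal (D * w s) * eLpNorm (β s) p volume := fun a D hD hle => by
    rw [ENNReal.ofReal_mul hD, mul_assoc]
    calc ‖a‖ₑ = ENNReal.ofReal |a| := Real.enorm_eq_ofReal_abs a
      _ ≤ ENNReal.ofReal (D * (eLpNorm (g s) p volume).toReal) := ENNReal.ofReal_le_ofReal hle
      _ = ENNReal.ofReal D * eLpNorm (g s) p volume := by
          rw [ENNReal.ofReal_mul hD, ENNReal.ofReal_toReal hs1.1.2.ne]
      _ ≤ _ := by gcongr; exact hs1.2
  refine ⟨fun x => ?_, fun θ hθ0 hθ1 x x' => ?_⟩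
  · rw [← mul_assoc]
    exact key _ _ (by positivity) (hA x)
  · rw [← mul_assoc]
    refine key _ _ (by positivity) ((hB θ hθ0 hθ1 x x').trans (le_of_eq ?_))
    ring

/-- Integrals over time of functions with a subcritical singularity. -/
lemma Admissible.exists_time_le (h : Admissible T p q β) {a : ℝ} (ha : 0 ≤ a)
    (ha1 : a < 1 - (q⁻¹).toReal) : ∃ C : ℝ, 0 ≤ C ∧ ∀ (u : ℝ → ℝ) (t D : ℝ), 0 ≤ D → 0 < t → t ≤ T →
      (∀ᵐ s ∂(volume.restrict (Ioo 0 t)), ‖u s‖ₑ ≤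
        ENNReal.ofReal (D * ((t - s) ^ (-a) * s ^ (-(1 / 2) : ℝ))) * eLpNorm (β s) p volume) →
      ∫⁻ s in Ioo 0 t, ‖u s‖ₑ ≤ ENNReal.ofReal (D * (C * t ^ (1 / 2 - (q⁻¹).toReal - a))) := by
  obtain ⟨C, hC0, hC⟩ := exists_lintegral_time_le h.two_lt h.aemeasurable h.mem.2 ha ha1
  refine ⟨C, hC0, fun u t D hD ht htT hu => ?_⟩
  refine (lintegral_mono_ae hu).trans ?_
  simp_rw [ENNReal.ofReal_mul hD, mul_assoc]
  rw [lintegral_const_mul' _ _ (by simp)]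
  gcongr
  exact hC t ht htT

lemma abs_integral_le_of_lintegral_le {α : Type*} [MeasurableSpace α] {μ : Measure α} {u : α → ℝ}
    {D : ℝ} (hD : 0 ≤ D) (h : ∫⁻ s, ‖u s‖ₑ ∂μ ≤ ENNReal.ofReal D) : |∫ s, u s ∂μ| ≤ D := by
  have h1 := (enorm_integral_le_lintegral_enorm u).trans h
  rw [Real.enorm_eq_ofReal_abs] at h1
  exact (ENNReal.ofReal_le_ofReal_iff hD).mp h1

lemma exp_neg_le_rpow_neg {u η : ℝ} (hu : 0 < u) (hη0 : 0 ≤ η) (hη1 : η ≤ 1) :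
    Real.exp (-u) ≤ u ^ (-η) := by
  rw [Real.exp_neg, Real.rpow_neg hu.le]
  apply inv_anti₀ (by positivity)
  have h1 : u ^ η ≤ 1 + u := by
    rcases le_total u 1 with h | h
    · exact (Real.rpow_le_one hu.le h hη0).trans (by linarith)
    · calc u ^ η ≤ u ^ (1 : ℝ) := Real.rpow_le_rpow_of_exponent_le h hη1
        _ ≤ 1 + u := by rw [Real.rpow_one]; linarith
  linarith [Real.add_one_le_exp u]

lemma halfOrder_nonneg (j : Option (Fin d)) : 0 ≤ halfOrder j := by
  rcases j with _ | i <;> simp [halfOrder]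

lemma halfOrder_le (j : Option (Fin d)) : halfOrder j ≤ 1 / 2 := by
  rcases j with _ | i <;> simp [halfOrder]

/-- The place where subcriticality enters: for one derivative the inequality is a rewriting of `γ <
1`. -/
lemma Admissible.half_lt (h : Admissible T p q β) (j : Option (Fin d)) :
    smoothExp d p + halfOrder j < 1 - (q⁻¹).toReal := by
  have h1 := h.subcritical
  rw [krExponent_eq] at h1
  have := halfOrder_le j
  linarith

/-- Bounds for potentials of sources with a square root singularity at time zero. -/
lemma Admissible.exists_potential_le (h : Admissible T p q β) (j : Option (Fin d)) :
    ∃ C : ℝ, 0 ≤ C ∧ ∀ (N : ℝ) (g : ℝ → Torus d → ℝ), 0 ≤ N →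
      IsSource T β (fun s => N * s ^ (-(1 / 2) : ℝ)) g → ∀ t, 0 < t → t ≤ T → ∀ x,
        Integrable (fun s => conv j (t - s) (g s) x) (volume.restrict (Ioo 0 t)) ∧
        |potential j g t x| ≤ C * N * t ^ ((1 - krExponent d p q) / 2 - halfOrder j) := by
  have ha0 : 0 ≤ smoothExp d p + halfOrder j :=
    add_nonneg (smoothExp_nonneg d p) (halfOrder_nonneg j)
  obtain ⟨C1, hC1, h1⟩ := h.exists_ae_conv_le
  obtain ⟨C2, hC2, h2⟩ := h.exists_time_le ha0 (h.half_lt j)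
  refine ⟨C1 * C2, by positivity, fun N g hN hg t ht htT x => ?_⟩
  -- The weight is required to be nonnegative at all real times, hence `|s|`; on `(0, T]` nothing
  -- changes.
  have hae := h1 (fun s => N * |s| ^ (-(1 / 2) : ℝ)) g (fun s => by positivity)
    ⟨hg.meas, fun s hs x => by rw [abs_of_pos hs.1]; exact hg.le s hs x⟩ t htT
  have h3 := h2 (fun s => conv j (t - s) (g s) x) t (C1 * N) (by positivity) ht htT (by
    filter_upwards [hae, ae_restrict_mem measurableSet_Ioo] with s hs hs'
    refine ((hs.2 j).1 x).trans (le_of_eq ?_)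
    rw [abs_of_pos hs'.1]
    congr 2; ring)
  refine ⟨⟨aestronglyMeasurable_conv_slice hg j htT x, h3.trans_lt ENNReal.ofReal_lt_top⟩, ?_⟩
  refine (abs_integral_le_of_lintegral_le (by positivity) h3).trans (le_of_eq ?_)
  rw [krExponent_eq]
  have : 1 / 2 - (q⁻¹).toReal - (smoothExp d p + halfOrder j) =
    (1 - (2 * (q⁻¹).toReal + 2 * smoothExp d p)) / 2 - halfOrder j := by ring
  rw [this]; ring

/-- Hölder bounds for potentials of sources with a square root singularity at time zero. -/
lemma Admissible.exists_potential_sub_le (h : Admissible T p q β) (j : Option (Fin d)) {θ : ℝ}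
    (hθ0 : 0 ≤ θ) (hθ1 : θ ≤ 1) (hθ : 2 * halfOrder j + θ < 2 - krExponent d p q) :
    ∃ C : ℝ, 0 ≤ C ∧ ∀ (N : ℝ) (g : ℝ → Torus d → ℝ), 0 ≤ N →
      IsSource T β (fun s => N * s ^ (-(1 / 2) : ℝ)) g → ∀ t, 0 < t → t ≤ T → ∀ x x',
        |potential j g t (proj x) - potential j g t (proj x')| ≤
          C * N * t ^ ((1 - krExponent d p q) / 2 - halfOrder j - θ / 2) * ‖x - x'‖ ^ θ := by
  have ha0 : 0 ≤ smoothExp d p + halfOrder j + θ / 2 :=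
    add_nonneg (add_nonneg (smoothExp_nonneg d p) (halfOrder_nonneg j)) (by positivity)
  obtain ⟨C0, hC0, h0⟩ := h.exists_potential_le j
  obtain ⟨C1, hC1, h1⟩ := h.exists_ae_conv_le
  obtain ⟨C2, hC2, h2⟩ := h.exists_time_le ha0 (by rw [krExponent_eq] at hθ; linarith)
  refine ⟨C1 * C2, by positivity, fun N g hN hg t ht htT x x' => ?_⟩
  have hae := h1 (fun s => N * |s| ^ (-(1 / 2) : ℝ)) g (fun s => by positivity)
    ⟨hg.meas, fun s hs x => by rw [abs_of_pos hs.1]; exact hg.le s hs x⟩ t htT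
  have h3 := h2 (fun s => conv j (t - s) (g s) (proj x) - conv j (t - s) (g s) (proj x')) t
    (C1 * N * ‖x - x'‖ ^ θ) (by positivity) ht htT (by
    filter_upwards [hae, ae_restrict_mem measurableSet_Ioo] with s hs hs'
    refine ((hs.2 j).2 θ hθ0 hθ1 x x').trans (le_of_eq ?_)
    rw [abs_of_pos hs'.1]
    congr 2; ring)
  rw [potential, potential, ← integral_sub (h0 N g hN hg t ht htT _).1
    (h0 N g hN hg t ht htT _).1]
  refine (abs_integral_le_of_lintegral_le (by positivity) h3).trans (le_of_eq ?_)
  rw [krExponent_eq]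
  have : 1 / 2 - (q⁻¹).toReal - (smoothExp d p + halfOrder j + θ / 2) =
    (1 - (2 * (q⁻¹).toReal + 2 * smoothExp d p)) / 2 - halfOrder j - θ / 2 := by ring
  rw [this]; ring

/-- The exponent of the contraction factor. -/
def gain (d : ℕ) (p q : ℝ≥0∞) : ℝ := (1 - krExponent d p q) / 4

/-- Exponentially weighted bounds for potentials. -/
lemma Admissible.exists_potential_exp_le (h : Admissible T p q β) :
    ∃ C : ℝ, 0 ≤ C ∧ ∀ (N L : ℝ) (g : ℝ → Torus d → ℝ), 0 ≤ N → 0 < L →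
      IsSource T β (fun s => N * (Real.exp (L * s) * s ^ (-(1 / 2) : ℝ))) g →
        ∀ t, 0 < t → t ≤ T → ∀ j x,
        Real.exp (-(L * t)) * t ^ (1 / 2 : ℝ) * |potential j g t x| ≤
          C * L ^ (-gain d p q) * N := by
  set η := gain d p q with hη
  have hγ0 : 0 ≤ krExponent d p q := by
    rw [krExponent_eq]; have := smoothExp_nonneg d p; positivity
  have hγ := h.subcritical
  have hη0 : 0 < η := by rw [hη, gain]; linarith
  have hη1 : η ≤ 1 := by rw [hη, gain]; linarith
  have hj : ∀ j : Option (Fin d), ∃ C : ℝ, 0 ≤ C ∧ ∀ (N L : ℝ) (g : ℝ → Torus d → ℝ), 0 ≤ N →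
      0 < L → IsSource T β (fun s => N * (Real.exp (L * s) * s ^ (-(1 / 2) : ℝ))) g →
        ∀ t, 0 < t → t ≤ T → ∀ x,
        Real.exp (-(L * t)) * t ^ (1 / 2 : ℝ) * |potential j g t x| ≤ C * L ^ (-η) * N := by
    intro j
    have ha0 : 0 ≤ smoothExp d p + halfOrder j + η :=
      add_nonneg (add_nonneg (smoothExp_nonneg d p) (halfOrder_nonneg j)) hη0.le
    have hk := krExponent_eq d p q
    have hj2 := halfOrder_le j
    obtain ⟨C1, hC1, h1⟩ := h.exists_ae_conv_le
    obtain ⟨C2, hC2, h2⟩ := h.exists_time_le ha0 (by rw [hη, gain]; linarith)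
    -- `e` is the total power of `t` left after multiplication by `t^{1/2}`. It equals `1 - γ/2 -
    -- halfOrder j - η`, which is at least `(1-γ)/4` by the choice of `η`, so `t^e ≤ T^e`.
    set e := 1 / 2 + (1 / 2 - (q⁻¹).toReal - (smoothExp d p + halfOrder j + η)) with he
    have he0 : 0 ≤ e := by rw [he, hη, gain]; linarith
    by_cases hT : 0 < T
    swap
    · exact ⟨0, le_rfl, fun N L g hN hL hg t ht htT => absurd (ht.trans_le htT) hT⟩
    refine ⟨C1 * C2 * T ^ e, by positivity, fun N L g hN hL hg t ht htT x => ?_⟩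
    have hae := h1 (fun s => N * (Real.exp (L * s) * |s| ^ (-(1 / 2) : ℝ))) g
      (fun s => by positivity)
      ⟨hg.meas, fun s hs x => by rw [abs_of_pos hs.1]; exact hg.le s hs x⟩ t htT
    have h3 := h2 (fun s => conv j (t - s) (g s) x) t (C1 * N * (Real.exp (L * t) * L ^ (-η)))
      (by positivity) ht htT (by
      filter_upwards [hae, ae_restrict_mem measurableSet_Ioo] with s hs hs'
      refine ((hs.2 j).1 x).trans ?_
      have hs0 : 0 < s := hs'.1
      have hts : 0 < t - s := by linarith [hs'.2]
      rw [abs_of_pos hs0]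
      gcongr ENNReal.ofReal ?_ * _
      -- The exponential weight gains `exp (-L(t-s)) ≤ (L(t-s))^{-η}`: a small additional
      -- singularity at `s = t` is traded for the small factor `L^{-η}`.
      have h4 : Real.exp (L * s) ≤ Real.exp (L * t) * (L ^ (-η) * (t - s) ^ (-η)) := by
        rw [← Real.mul_rpow hL.le hts.le]
        have : Real.exp (L * s) = Real.exp (L * t) * Real.exp (-(L * (t - s))) := by
          rw [← Real.exp_add]; congr 1; ring
        rw [this]
        gcongr
        exact exp_neg_le_rpow_neg (by positivity) hη0.le hη1
      calc C1 * ((t - s) ^ (-(smoothExp d p + halfOrder j)) *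
            (N * (Real.exp (L * s) * s ^ (-(1 / 2) : ℝ))))
          ≤ C1 * ((t - s) ^ (-(smoothExp d p + halfOrder j)) *
            (N * ((Real.exp (L * t) * (L ^ (-η) * (t - s) ^ (-η))) * s ^ (-(1 / 2) : ℝ)))) := by
            gcongr
        _ = _ := by
            have : -(smoothExp d p + halfOrder j + η) =
              -(smoothExp d p + halfOrder j) + -η := by ring
            rw [this, Real.rpow_add hts]
            ring)
    have h4 := abs_integral_le_of_lintegral_le (by positivity) h3
    calc Real.exp (-(L * t)) * t ^ (1 / 2 : ℝ) * |potential j g t x|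
        ≤ Real.exp (-(L * t)) * t ^ (1 / 2 : ℝ) * (C1 * N * (Real.exp (L * t) * L ^ (-η)) *
          (C2 * t ^ (1 / 2 - (q⁻¹).toReal - (smoothExp d p + halfOrder j + η)))) := by
          gcongr; exact h4
      _ = (Real.exp (-(L * t)) * Real.exp (L * t)) * (C1 * C2 * t ^ e * L ^ (-η) * N) := by
          rw [he, Real.rpow_add ht]; ring
      _ = C1 * C2 * t ^ e * L ^ (-η) * N := by
          rw [← Real.exp_add]; simp
      _ ≤ _ := by gcongr
  choose C hC0 hC using hj
  refine ⟨∑ j, C j, Finset.sum_nonneg fun j _ => hC0 j, fun N L g hN hL hg t ht htT j x => ?_⟩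
  refine (hC j N L g hN hL hg t ht htT x).trans ?_
  gcongr
  exact Finset.single_le_sum (fun j _ => hC0 j) (Finset.mem_univ j)

end

/-! ### Differentiability and continuity of potentials. -/

section
variable {T : ℝ} {p q : ℝ≥0∞} {β g : ℝ → Torus d → ℝ} {N : ℝ}

lemma cylinder_eq (d : ℕ) (T : ℝ) :
    cylinder d T = (volume.restrict (Ioo 0 T)).prod volume := by
  rw [cylinder, Measure.restrict_congr_set Ioo_ae_eq_Icc.symm]

/-- The source has an inverse square root singularity at time zero, with constant `N`. -/
abbrev IsSqrtSource (T : ℝ) (β : ℝ → Torus d → ℝ) (N : ℝ) (g : ℝ → Torus d → ℝ) : Prop :=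
  IsSource T β (fun s => N * s ^ (-(1 / 2) : ℝ)) g

lemma IsSource.abs_weight (hg : IsSqrtSource T β N g) :
    IsSource T β (fun s => N * |s| ^ (-(1 / 2) : ℝ)) g :=
  ⟨hg.meas, fun s hs x => by rw [abs_of_pos hs.1]; exact hg.le s hs x⟩

/-- One time-integrable function dominates the integrand for all `j` and `x` simultaneously. This
justifies both differentiation under the time integral and the applications of Fubini's theorem. -/
lemma Admissible.exists_majorant (h : Admissible T p q β) (hN : 0 ≤ N)
    (hg : IsSqrtSource T β N g) {t : ℝ} (ht : 0 < t) (htT : t ≤ T) :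
    ∃ B : ℝ → ℝ, Integrable B (volume.restrict (Ioo 0 t)) ∧
      ∀ᵐ s ∂(volume.restrict (Ioo 0 t)), Integrable (g s) volume ∧
        ∀ j x, |conv j (t - s) (g s) x| ≤ B s := by
  obtain ⟨C1, hC1, h1⟩ := h.exists_ae_conv_le
  have hae := h1 _ g (fun s => by positivity) hg.abs_weight t htT
  have hle : (volume.restrict (Ioo 0 t) : Measure ℝ) ≤ volume.restrict (Icc 0 T) :=
    Measure.restrict_mono (Ioo_subset_Icc_self.trans (Icc_subset_Icc_right htT)) le_rfl
  have ha : ∀ j : Option (Fin d), Integrable (fun s => (ENNReal.ofReal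
      (C1 * ((t - s) ^ (-(smoothExp d p + halfOrder j)) * (N * |s| ^ (-(1 / 2) : ℝ)))) *
        eLpNorm (β s) p volume).toReal) (volume.restrict (Ioo 0 t)) := by
    intro j
    obtain ⟨C2, hC2, h2⟩ := exists_lintegral_time_le h.two_lt h.aemeasurable h.mem.2
      (add_nonneg (smoothExp_nonneg d p) (halfOrder_nonneg j)) (h.half_lt j)
    refine integrable_toReal_of_lintegral_ne_top ?_ (ne_of_lt ?_)
    · refine AEMeasurable.mul ?_ (h.aemeasurable.mono_measure hle)
      exact Measurable.aemeasurable (by fun_prop)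
    · calc _ ≤ ∫⁻ s in Ioo 0 t, ENNReal.ofReal (C1 * N) * (ENNReal.ofReal
            ((t - s) ^ (-(smoothExp d p + halfOrder j)) * s ^ (-(1 / 2) : ℝ)) *
            eLpNorm (β s) p volume) := by
            refine setLIntegral_mono_ae' measurableSet_Ioo (Eventually.of_forall fun s hs => ?_)
            rw [← mul_assoc (ENNReal.ofReal _), ← ENNReal.ofReal_mul (by positivity),
              abs_of_pos hs.1]
            refine le_of_eq ?_
            congr 2; ring
        _ < ⊤ := by
            rw [lintegral_const_mul' _ _ (by simp)]
            exact ENNReal.mul_lt_top (by simp) ((h2 t ht htT).trans_lt ENNReal.ofReal_lt_top)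
  refine ⟨_, integrable_finsetSum Finset.univ fun j _ => ha j, ?_⟩
  filter_upwards [hae, ae_mono hle h.ae_lt_top] with s hs hs2
  refine ⟨hs.1, fun j x => ?_⟩
  have h3 := ENNReal.toReal_mono (ENNReal.mul_ne_top (by simp) hs2.ne) ((hs.2 j).1 x)
  rw [toReal_enorm, Real.norm_eq_abs] at h3
  refine h3.trans ?_
  exact Finset.single_le_sum (f := fun j => (ENNReal.ofReal
      (C1 * ((t - s) ^ (-(smoothExp d p + halfOrder j)) * (N * |s| ^ (-(1 / 2) : ℝ)))) *
        eLpNorm (β s) p volume).toReal) (fun j _ => ENNReal.toReal_nonneg) (Finset.mem_univ j)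

lemma Admissible.hasFDerivAt_potential (h : Admissible T p q β) (hN : 0 ≤ N)
    (hg : IsSqrtSource T β N g) {t : ℝ} (ht : 0 < t) (htT : t ≤ T)
    (x : EuclideanSpace ℝ (Fin d)) :
    HasFDerivAt (lift (potential none g t))
      (covector fun i => potential (some i) g t (proj x)) x := by
  obtain ⟨B, hB, hae⟩ := h.exists_majorant hN hg ht htT
  have hm := fun j x => aestronglyMeasurable_conv_slice hg j htT x
  have hi : ∀ j x, Integrable (fun s => conv j (t - s) (g s) x) (volume.restrict (Ioo 0 t)) :=
    fun j x => hB.mono' (hm j x) (hae.mono fun s hs => hs.2 j x)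
  have h1 := hasFDerivAt_integral_of_dominated_of_fderiv_le (𝕜 := ℝ)
    (μ := volume.restrict (Ioo 0 t)) (s := univ)
    (F := fun (x : EuclideanSpace ℝ (Fin d)) s => conv none (t - s) (g s) (proj x))
    (F' := fun x s => covector fun i => conv (some i) (t - s) (g s) (proj x))
    (bound := fun s => d * B s) (x₀ := x) univ_mem
    (Eventually.of_forall fun x => hm none _) (hi none _) ?_ ?_ (hB.const_mul _) ?_
  · rw [integral_covector fun i => hi (some i) _] at h1
    exact h1
  · exact continuous_covector.comp_aestronglyMeasurable
      (aemeasurable_pi_lambda _ fun i => (hm (some i) _).aemeasurable).aestronglyMeasurable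
  · filter_upwards [hae] with s hs x _
    refine (norm_covector_le _).trans ((Finset.sum_le_sum fun i _ => hs.2 (some i) _).trans ?_)
    simp
  · filter_upwards [hae, ae_restrict_mem measurableSet_Ioo] with s hs hs' x _
    exact hasFDerivAt_conv (sub_pos.mpr hs'.2) hs.1 x

/-- The time estimate with exponent `a = 0` at `t = T`, together with the inclusion of `L^p` in `L¹`
on the torus. -/
lemma Admissible.integrable_source (h : Admissible T p q β) (hT : 0 < T) (hN : 0 ≤ N)
    (hg : IsSqrtSource T β N g) :
    Integrable (fun z : ℝ × Torus d => g z.1 z.2) (cylinder d T) := by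
  have hq2 : (q⁻¹).toReal < 1 := by
    have h1 := h.subcritical
    rw [krExponent_eq] at h1
    have := smoothExp_nonneg d p
    linarith [ENNReal.toReal_nonneg (a := q⁻¹)]
  obtain ⟨C2, hC2, h2⟩ := exists_lintegral_time_le h.two_lt h.aemeasurable h.mem.2
    (le_refl (0 : ℝ)) (by linarith)
  refine ⟨hg.meas, ?_⟩
  have hle : (volume.restrict (Ioo 0 T) : Measure ℝ) ≤ volume.restrict (Ioc 0 T) :=
    Measure.restrict_mono Ioo_subset_Ioc_self le_rfl
  have hmeas := hg.meas
  rw [cylinder_eq] at hmeas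
  rw [HasFiniteIntegral, cylinder_eq, lintegral_prod _ hmeas.enorm]
  calc ∫⁻ s in Ioo 0 T, ∫⁻ x, ‖g s x‖ₑ
      ≤ ∫⁻ s in Ioo 0 T, ENNReal.ofReal N * (ENNReal.ofReal
          ((T - s) ^ (-0 : ℝ) * s ^ (-(1 / 2) : ℝ)) * eLpNorm (β s) p volume) := by
        refine lintegral_mono_ae ?_
        filter_upwards [ae_mono hle (h.ae_slice hg), ae_restrict_mem measurableSet_Ioo] with s hs hs'
        rw [← eLpNorm_one_eq_lintegral_enorm]
        refine (eLpNorm_le_eLpNorm_of_exponent_le h.one_le hs.1.1).trans (hs.2.trans ?_)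
        rw [← mul_assoc, ← ENNReal.ofReal_mul hN]
        simp
    _ < ⊤ := by
        rw [lintegral_const_mul' _ _ (by simp)]
        exact ENNReal.mul_lt_top (by simp) ((h2 T hT le_rfl).trans_lt ENNReal.ofReal_lt_top)

/-- A continuous cutoff vanishing for `τ ≤ ε` and equal to one for `τ ≥ 2ε`. -/
def cutoff (ε τ : ℝ) : ℝ := max 0 (min 1 (τ / ε - 1))

lemma cutoff_nonneg (ε τ : ℝ) : 0 ≤ cutoff ε τ := le_max_left _ _

lemma cutoff_le_one (ε τ : ℝ) : cutoff ε τ ≤ 1 := max_le zero_le_one (min_le_left _ _)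

lemma cutoff_eq_zero {ε τ : ℝ} (hε : 0 < ε) (h : τ ≤ ε) : cutoff ε τ = 0 := by
  refine max_eq_left (min_le_of_right_le ?_)
  have : τ / ε ≤ 1 := (div_le_one hε).mpr h
  linarith

lemma cutoff_eq_one {ε τ : ℝ} (hε : 0 < ε) (h : 2 * ε ≤ τ) : cutoff ε τ = 1 := by
  have : 2 ≤ τ / ε := (le_div_iff₀ hε).mpr h
  rw [cutoff, min_eq_left (by linarith), max_eq_right zero_le_one]

/-- The left side vanishes for `τ ≥ 2ε` and is at most `1` elsewhere. The smallness `ε^η` is bought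
with the extra singularity `τ^{-η}`. -/
lemma one_sub_cutoff_le {ε τ η : ℝ} (hε : 0 < ε) (hτ : 0 < τ) (hη : 0 ≤ η) :
    |1 - cutoff ε τ| ≤ (2 * ε) ^ η * τ ^ (-η) := by
  rcases le_total (2 * ε) τ with h | h
  · rw [cutoff_eq_one hε h]
    simp only [sub_self, abs_zero]
    positivity
  · rw [abs_of_nonneg (by linarith [cutoff_le_one ε τ])]
    have h1 : 1 ≤ (2 * ε / τ) ^ η := Real.one_le_rpow ((one_le_div hτ).mpr h) hη
    rw [Real.div_rpow (by positivity) hτ.le, div_eq_mul_inv, ← Real.rpow_neg hτ.le] at h1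
    linarith [cutoff_nonneg ε τ]

/-- The potential with the singularity of the kernel cut off. -/
def cutPotential (T ε : ℝ) (j : Option (Fin d)) (g : ℝ → Torus d → ℝ) (w : ℝ × Torus d) : ℝ :=
  ∫ z : ℝ × Torus d, (cutoff ε (w.1 - z.1) * kernel j (max (w.1 - z.1) ε) (w.2 - z.2)) * g z.1 z.2
    ∂(cylinder d T)

lemma continuous_cutoff (ε : ℝ) : Continuous (cutoff ε) := by
  unfold cutoff; fun_prop

/-- The maximum keeps the kernel at times at least `ε`, where it is continuous, and the cutoff
vanishes wherever the maximum changes the time. -/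
lemma continuous_cutKernel {ε : ℝ} (hε : 0 < ε) (j : Option (Fin d)) :
    Continuous fun w : ℝ × Torus d => cutoff ε w.1 * kernel j (max w.1 ε) w.2 := by
  refine ((continuous_cutoff ε).comp continuous_fst).mul ?_
  refine (continuousOn_kernel j).comp_continuous
    (f := fun w : ℝ × Torus d => (max w.1 ε, w.2)) (by fun_prop) fun w => ⟨?_, mem_univ _⟩
  exact hε.trans_le (le_max_right _ _)

lemma abs_cutKernel_le {ε : ℝ} (hε : 0 < ε) (j : Option (Fin d)) (τ : ℝ) (x : Torus d) :
    |cutoff ε τ * kernel j (max τ ε) x| ≤ kernelBound j ε := by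
  rw [abs_mul, abs_of_nonneg (cutoff_nonneg _ _)]
  exact (mul_le_of_le_one_left (abs_nonneg _) (cutoff_le_one _ _)).trans
    (abs_kernel_le j hε (le_max_right _ _) _)

lemma integrable_cutKernel_mul (hg : Integrable (fun z : ℝ × Torus d => g z.1 z.2) (cylinder d T))
    {ε : ℝ} (hε : 0 < ε) (j : Option (Fin d)) (t : ℝ) (x : Torus d) :
    Integrable (fun z : ℝ × Torus d =>
      (cutoff ε (t - z.1) * kernel j (max (t - z.1) ε) (x - z.2)) * g z.1 z.2) (cylinder d T) := by
  have h1 : Continuous fun z : ℝ × Torus d =>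
      cutoff ε (t - z.1) * kernel j (max (t - z.1) ε) (x - z.2) :=
    (continuous_cutKernel hε j).comp (f := fun z : ℝ × Torus d => (t - z.1, x - z.2)) (by fun_prop)
  exact hg.bdd_mul h1.aestronglyMeasurable
    (Eventually.of_forall fun z => abs_cutKernel_le hε j _ _)

lemma continuous_cutPotential
    (hg : Integrable (fun z : ℝ × Torus d => g z.1 z.2) (cylinder d T))
    {ε : ℝ} (hε : 0 < ε) (j : Option (Fin d)) : Continuous (cutPotential T ε j g) := by
  refine continuous_of_dominated (bound := fun z => kernelBound j ε * ‖g z.1 z.2‖)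
    (fun w => (integrable_cutKernel_mul hg hε j w.1 w.2).aestronglyMeasurable)
    (fun w => Eventually.of_forall fun z => ?_) (hg.norm.const_mul _)
    (Eventually.of_forall fun z => ?_)
  · rw [norm_mul]
    gcongr
    exact abs_cutKernel_le hε j _ _
  · refine Continuous.mul ?_ continuous_const
    exact (continuous_cutKernel hε j).comp
      (f := fun w : ℝ × Torus d => (w.1 - z.1, w.2 - z.2)) (by fun_prop)

lemma cutPotential_eq (hg : Integrable (fun z : ℝ × Torus d => g z.1 z.2) (cylinder d T))
    {ε : ℝ} (hε : 0 < ε) (j : Option (Fin d)) {t : ℝ} (htT : t ≤ T) (x : Torus d) :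
    cutPotential T ε j g (t, x) =
      ∫ s in Ioo 0 t, cutoff ε (t - s) * conv j (t - s) (g s) x := by
  have h1 := integrable_cutKernel_mul hg hε j t x
  rw [cylinder_eq] at h1
  rw [cutPotential, cylinder_eq, integral_prod _ h1]
  have h2 : ∀ s, ∫ y, (cutoff ε (t - s) * kernel j (max (t - s) ε) (x - y)) * g s y =
      cutoff ε (t - s) * conv j (t - s) (g s) x := fun s => by
    simp_rw [mul_assoc]
    rw [integral_const_mul]
    rcases le_total (t - s) ε with h | h
    · rw [cutoff_eq_zero hε h, zero_mul, zero_mul]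
    · rw [max_eq_left h]; rfl
  simp only [h2]
  refine setIntegral_eq_of_subset_of_forall_sdiff_eq_zero measurableSet_Ioo
    (Ioo_subset_Ioo_right htT) fun s hs => ?_
  have : t - s ≤ 0 := by
    by_contra hlt
    push Not at hlt
    exact hs.2 ⟨hs.1.1, by linarith⟩
  rw [cutoff_eq_zero hε (by linarith), zero_mul]

/-- Removing the cutoff costs only an exponent `η` in the singularity, which subcriticality leaves
room for. The factor `t^{1/2}` makes the error uniform up to time zero, where gradients may blow up.
-/
lemma Admissible.exists_cutPotential_sub_le (h : Admissible T p q β) (hT : 0 < T)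
    (j : Option (Fin d)) : ∃ C η : ℝ, 0 ≤ C ∧ 0 < η ∧ ∀ (N : ℝ) (g : ℝ → Torus d → ℝ), 0 ≤ N →
      IsSqrtSource T β N g → ∀ ε, 0 < ε → ∀ t, 0 < t → t ≤ T → ∀ x,
        |t ^ (1 / 2 : ℝ) * potential j g t x - t ^ (1 / 2 : ℝ) * cutPotential T ε j g (t, x)| ≤
          C * N * ε ^ η := by
  set η := gain d p q with hη
  have hγ := h.subcritical
  have hη0 : 0 < η := by rw [hη, gain]; linarith
  have ha0 : 0 ≤ smoothExp d p + halfOrder j + η :=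
    add_nonneg (add_nonneg (smoothExp_nonneg d p) (halfOrder_nonneg j)) hη0.le
  have hk := krExponent_eq d p q
  have hj2 := halfOrder_le j
  obtain ⟨C0, hC0, h0⟩ := h.exists_potential_le j
  obtain ⟨C1, hC1, h1⟩ := h.exists_ae_conv_le
  obtain ⟨C2, hC2, h2⟩ := h.exists_time_le ha0 (by rw [hη, gain]; linarith)
  set e := 1 / 2 + (1 / 2 - (q⁻¹).toReal - (smoothExp d p + halfOrder j + η)) with he
  have he0 : 0 ≤ e := by rw [he, hη, gain]; linarith
  refine ⟨C1 * C2 * 2 ^ η * T ^ e, η, by positivity, hη0, fun N g hN hg ε hε t ht htT x => ?_⟩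
  have hgi := h.integrable_source hT hN hg
  have hci := (h0 N g hN hg t ht htT x).1
  have hci2 : Integrable (fun s => cutoff ε (t - s) * conv j (t - s) (g s) x)
      (volume.restrict (Ioo 0 t)) := by
    refine hci.bdd_mul (c := 1) ?_ (Eventually.of_forall fun s => ?_)
    · exact ((continuous_cutoff ε).comp (by fun_prop)).aestronglyMeasurable
    · rw [Real.norm_eq_abs, abs_of_nonneg (cutoff_nonneg _ _)]
      exact cutoff_le_one _ _
  rw [cutPotential_eq hgi hε j htT, potential, ← mul_sub, ← integral_sub hci hci2, abs_mul,
    abs_of_nonneg (by positivity)]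
  have hae := h1 _ g (fun s => by positivity) hg.abs_weight t htT
  have h3 := h2 (fun s => conv j (t - s) (g s) x - cutoff ε (t - s) * conv j (t - s) (g s) x) t
    (C1 * N * (2 * ε) ^ η) (by positivity) ht htT (by
    filter_upwards [hae, ae_restrict_mem measurableSet_Ioo] with s hs hs'
    have hs0 : 0 < s := hs'.1
    have hts : 0 < t - s := by linarith [hs'.2]
    have e1 : conv j (t - s) (g s) x - cutoff ε (t - s) * conv j (t - s) (g s) x =
      (1 - cutoff ε (t - s)) * conv j (t - s) (g s) x := by ring
    rw [e1, enorm_mul]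
    calc _ ≤ ENNReal.ofReal ((2 * ε) ^ η * (t - s) ^ (-η)) *
          (ENNReal.ofReal (C1 * ((t - s) ^ (-(smoothExp d p + halfOrder j)) *
            (N * |s| ^ (-(1 / 2) : ℝ)))) * eLpNorm (β s) p volume) := by
          gcongr
          · rw [Real.enorm_eq_ofReal_abs]
            exact ENNReal.ofReal_le_ofReal (one_sub_cutoff_le hε hts hη0.le)
          · exact (hs.2 j).1 x
      _ = _ := by
          rw [← mul_assoc, ← ENNReal.ofReal_mul (by positivity), abs_of_pos hs0]
          have : -(smoothExp d p + halfOrder j + η) =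
              -(smoothExp d p + halfOrder j) + -η := by ring
          rw [this, Real.rpow_add hts]
          congr 2; ring)
  have h4 := abs_integral_le_of_lintegral_le (by positivity) h3
  calc _ ≤ t ^ (1 / 2 : ℝ) * (C1 * N * (2 * ε) ^ η *
        (C2 * t ^ (1 / 2 - (q⁻¹).toReal - (smoothExp d p + halfOrder j + η)))) := by
        gcongr
    _ = C1 * C2 * 2 ^ η * t ^ e * N * ε ^ η := by
        rw [he, Real.rpow_add ht, Real.mul_rpow (by norm_num) hε.le]; ring
    _ ≤ C1 * C2 * 2 ^ η * T ^ e * N * ε ^ η := by gcongr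
    _ = _ := by ring

lemma Admissible.continuousOn_potential (h : Admissible T p q β) (hT : 0 < T) (hN : 0 ≤ N)
    (hg : IsSqrtSource T β N g) (j : Option (Fin d)) :
    ContinuousOn (fun z : ℝ × Torus d => potential j g z.1 z.2) (Ioc 0 T ×ˢ univ) := by
  obtain ⟨C, η, hC, hη, hCη⟩ := h.exists_cutPotential_sub_le hT j
  have hgi := h.integrable_source hT hN hg
  -- `t^{1/2}` times the potential is a uniform limit of continuous functions as `ε → 0`; the factor
  -- is divided out at positive times.
  have h1 : ContinuousOn (fun z : ℝ × Torus d => z.1 ^ (1 / 2 : ℝ) * potential j g z.1 z.2)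
      (Ioc 0 T ×ˢ univ) := by
    refine continuousOn_of_uniform_approx_of_continuousOn fun u hu => ?_
    obtain ⟨δ, hδ, hu⟩ := Metric.mem_uniformity_dist.mp hu
    have hlim : Tendsto (fun ε : ℝ => C * N * ε ^ η) (𝓝[>] 0) (𝓝 0) := by
      have h2 : ContinuousAt (fun ε : ℝ => C * N * ε ^ η) 0 :=
        continuousAt_const.mul (Real.continuousAt_rpow_const _ _ (Or.inr hη.le))
      have h3 := h2.tendsto
      rw [Real.zero_rpow hη.ne', mul_zero] at h3
      exact h3.mono_left nhdsWithin_le_nhds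
    obtain ⟨ε, hε, hε0⟩ := ((hlim.eventually (gt_mem_nhds hδ)).and self_mem_nhdsWithin).exists
    refine ⟨fun z => z.1 ^ (1 / 2 : ℝ) * cutPotential T ε j g z, ?_, fun z hz => hu ?_⟩
    · refine ContinuousOn.mul ?_ (continuous_cutPotential hgi hε0 j).continuousOn
      exact ContinuousOn.rpow_const continuousOn_fst fun z hz => Or.inl hz.1.1.ne'
    · rw [Real.dist_eq]
      exact (hCη N g hN hg ε hε0 z.1 hz.1.1 hz.1.2 z.2).trans_lt hε
  have h2 : ContinuousOn (fun z : ℝ × Torus d => z.1 ^ (-(1 / 2) : ℝ)) (Ioc 0 T ×ˢ univ) :=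
    ContinuousOn.rpow_const continuousOn_fst fun z hz => Or.inl hz.1.1.ne'
  refine (h2.mul h1).congr fun z hz => ?_
  have hz0 : 0 < z.1 := hz.1.1
  change _ = z.1 ^ (-(1 / 2) : ℝ) * (z.1 ^ (1 / 2 : ℝ) * _)
  rw [← mul_assoc, ← Real.rpow_add hz0]
  simp

lemma potential_zero (j : Option (Fin d)) (g : ℝ → Torus d → ℝ) (x : Torus d) :
    potential j g 0 x = 0 := by
  simp [potential]

/-- Without derivatives the potential is `O(t^{(1-γ)/2})`, so it tends to zero at the initial time.
-/
lemma Admissible.continuousOn_potential_none (h : Admissible T p q β) (hT : 0 < T) (hN : 0 ≤ N)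
    (hg : IsSqrtSource T β N g) :
    ContinuousOn (fun z : ℝ × Torus d => potential none g z.1 z.2) (Icc 0 T ×ˢ univ) := by
  rintro ⟨t, x⟩ ⟨ht, -⟩
  rcases ht.1.eq_or_lt with h0 | h0
  · have h0 : t = 0 := h0.symm
    subst h0
    obtain ⟨C, hC, hCb⟩ := h.exists_potential_le none
    have hγ := h.subcritical
    set e := (1 - krExponent d p q) / 2 - halfOrder (none : Option (Fin d)) with he
    have he0 : 0 < e := by rw [he, halfOrder]; linarith
    have hb : ∀ z ∈ Icc 0 T ×ˢ (univ : Set (Torus d)),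
        ‖potential none g z.1 z.2‖ ≤ C * N * z.1 ^ e := fun z hz => by
      rcases hz.1.1.eq_or_lt with h1 | h1
      · rw [← h1, potential_zero, Real.zero_rpow he0.ne']; simp
      · exact (hCb N g hN hg z.1 h1 hz.1.2 z.2).2
    rw [ContinuousWithinAt, potential_zero]
    refine squeeze_zero_norm' (eventually_nhdsWithin_of_forall hb) ?_
    have h2 : ContinuousAt (fun z : ℝ × Torus d => C * N * z.1 ^ e) (0, x) := by
      refine continuousAt_const.mul ?_
      exact (Real.continuousAt_rpow_const 0 e (Or.inr he0.le)).comp (x := ((0 : ℝ), x))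
        (f := fun z : ℝ × Torus d => z.1) continuousAt_fst
    have h3 := h2.tendsto
    simp only [Real.zero_rpow he0.ne', mul_zero] at h3
    exact h3.mono_left nhdsWithin_le_nhds
  · have h1 := h.continuousOn_potential hT hN hg none (t, x) ⟨⟨h0, ht.2⟩, mem_univ _⟩
    refine h1.mono_of_mem_nhdsWithin ?_
    have h2 : {z : ℝ × Torus d | 0 < z.1} ∈ 𝓝 (t, x) := continuousAt_fst (Ioi_mem_nhds h0)
    filter_upwards [mem_nhdsWithin_of_mem_nhds h2, self_mem_nhdsWithin] with z hz hz'
    exact ⟨⟨hz, hz'.1.2⟩, mem_univ _⟩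

end

/-! ### Weak form of the heat flow and of Duhamel potentials. -/

lemma exists_abs_le_of_continuous {f : Torus d → ℝ} (hf : Continuous f) :
    ∃ M, 0 ≤ M ∧ ∀ x, |f x| ≤ M := by
  obtain ⟨M, hM⟩ := isCompact_univ.exists_bound_of_continuousOn hf.continuousOn
  exact ⟨M, (abs_nonneg _).trans (hM 0 (mem_univ _)), fun x => hM x (mem_univ x)⟩

/-- The heat flow in weak form. -/
lemma integral_conv_mul_smooth {f φ : Torus d → ℝ} (hf : Integrable f volume) (hφ : IsSmooth φ)
    {t : ℝ} (ht : 0 < t) :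
    ∫ x, conv none t f x * φ x =
      (∫ x, f x * φ x) + ∫ r in Ioc 0 t, ∫ x, conv none r f x * laplacian φ x := by
  have hc := hφ.continuous
  have hl := hφ.continuous_laplacian
  obtain ⟨M, hM0, hM⟩ := exists_abs_le_of_continuous hl
  obtain ⟨M', hM'0, hM'⟩ := exists_abs_le_of_continuous hc
  have hG := continuous_integral_conv hl t
  obtain ⟨M'', hM''0, hM''⟩ := exists_abs_le_of_continuous hG
  rw [integral_conv_mul ht hf (continuous_integrable_torus hc)]
  simp_rw [conv_eq_add_integral hφ ht, mul_add]
  rw [integral_add (hf.mul_bdd hc.aestronglyMeasurable (Eventually.of_forall hM'))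
    (hf.mul_bdd hG.aestronglyMeasurable (Eventually.of_forall hM''))]
  congr 1
  simp_rw [← integral_const_mul]
  rw [integral_integral_swap]
  · refine setIntegral_congr_fun measurableSet_Ioc fun r hr => ?_
    exact (integral_conv_mul hr.1 hf (continuous_integrable_torus hl)).symm
  · have h1 : Integrable (fun z : Torus d × ℝ => f z.1) (volume.prod (volume.restrict (Ioc 0 t))) :=
      hf.comp_fst _
    refine h1.mul_bdd (g := fun z : Torus d × ℝ => conv none z.2 (laplacian φ) z.1) (c := M) ?_ ?_
    · exact (aestronglyMeasurable_conv none (continuous_integrable_torus hl) t).prod_swap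
    · have h2 : ((volume : Measure (Torus d)).prod (volume.restrict (Ioc 0 t))) =
          (volume.prod volume).restrict (univ ×ˢ Ioc 0 t) := by
        rw [← Measure.prod_restrict, Measure.restrict_univ]
      rw [h2]
      refine (ae_restrict_iff' (MeasurableSet.univ.prod measurableSet_Ioc)).mpr
        (Eventually.of_forall fun z hz => ?_)
      exact abs_conv_none_le_of_bound hz.2.1 hl hM _

/-- A function of positive times, extended by zero. -/
def extendZero (F : ℝ → Torus d → ℝ) (z : ℝ × Torus d) : ℝ :=
  (Ioi (0 : ℝ) ×ˢ (univ : Set (Torus d))).indicator (fun z => F z.1 z.2) z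

lemma measurable_extendZero {F : ℝ → Torus d → ℝ}
    (hF : ContinuousOn (fun z : ℝ × Torus d => F z.1 z.2) (Ioi 0 ×ˢ univ)) :
    Measurable (extendZero F) := by
  classical
  have h := hF.measurable_piecewise (g := 0) continuousOn_const
    (measurableSet_Ioi.prod MeasurableSet.univ)
  rwa [Set.piecewise_eq_indicator] at h

lemma extendZero_of_pos (F : ℝ → Torus d → ℝ) {t : ℝ} (ht : 0 < t) (x : Torus d) :
    extendZero F (t, x) = F t x :=
  indicator_of_mem (show (t, x) ∈ Ioi (0 : ℝ) ×ˢ univ from ⟨ht, mem_univ _⟩) _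

lemma extendZero_of_nonpos (F : ℝ → Torus d → ℝ) {t : ℝ} (ht : t ≤ 0) (x : Torus d) :
    extendZero F (t, x) = 0 :=
  indicator_of_notMem (fun h => (not_lt.mpr ht) h.1) _

section
variable {T : ℝ} {p q : ℝ≥0∞} {β g : ℝ → Torus d → ℝ} {N : ℝ}

lemma aestronglyMeasurable_conv_uncurry
    (hg : AEStronglyMeasurable (fun z : ℝ × Torus d => g z.1 z.2) (cylinder d T)) {t : ℝ}
    (ht : t ≤ T) :
    AEStronglyMeasurable (fun z : ℝ × Torus d => conv none (t - z.1) (g z.1) z.2)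
      ((volume.restrict (Ioo 0 t)).prod volume) := by
  have hg' := hg.mono_measure (Ioo_prod_le_cylinder ht)
  have h1 : Measure.QuasiMeasurePreserving (Prod.map Prod.fst id :
      (ℝ × Torus d) × Torus d → ℝ × Torus d)
      (((volume.restrict (Ioo 0 t)).prod volume).prod volume)
      ((volume.restrict (Ioo 0 t)).prod volume) :=
    QuasiMeasurePreserving.prodMap Measure.quasiMeasurePreserving_fst
      (Measure.QuasiMeasurePreserving.id _)
  have h2 : AEStronglyMeasurable (fun w : (ℝ × Torus d) × Torus d => g w.1.1 w.2)
      (((volume.restrict (Ioo 0 t)).prod volume).prod volume) :=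
    hg'.comp_quasiMeasurePreserving h1
  have h3 : Measurable fun w : (ℝ × Torus d) × Torus d =>
      extendZero (kernel none) (t - w.1.1, w.1.2 - w.2) :=
    (measurable_extendZero (continuousOn_kernel none)).comp (by fun_prop)
  have h4 := (h3.aestronglyMeasurable.mul h2).integral_prod_right'
  refine h4.congr ?_
  rw [Ioo_prod_eq]
  filter_upwards [ae_restrict_mem (measurableSet_Ioo.prod MeasurableSet.univ)] with z hz
  refine integral_congr_ae (Eventually.of_forall fun y => ?_)
  simp only [Pi.mul_apply]
  rw [extendZero_of_pos _ (sub_pos.mpr hz.1.2)]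

lemma Admissible.integral_potential_mul (h : Admissible T p q β) (hN : 0 ≤ N)
    (hg : IsSqrtSource T β N g) {t : ℝ} (ht : 0 < t) (htT : t ≤ T) {φ : Torus d → ℝ}
    (hφ : Continuous φ) :
    ∫ x, potential none g t x * φ x =
      ∫ s in Ioo 0 t, ∫ x, conv none (t - s) (g s) x * φ x := by
  obtain ⟨B, hB, hae⟩ := h.exists_majorant hN hg ht htT
  obtain ⟨M, hM0, hM⟩ := exists_abs_le_of_continuous hφ
  unfold potential
  simp_rw [← integral_mul_const]
  refine (integral_integral_swap ?_).symm
  refine Integrable.mul_bdd (f := fun z : ℝ × Torus d => conv none (t - z.1) (g z.1) z.2)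
    (g := fun z : ℝ × Torus d => φ z.2) (c := M) ?_
    (hφ.comp continuous_snd).aestronglyMeasurable (Eventually.of_forall fun z => hM _)
  refine Integrable.mono' (hB.comp_fst volume) (aestronglyMeasurable_conv_uncurry hg.meas htT) ?_
  have h1 := Measure.quasiMeasurePreserving_fst (μ := volume.restrict (Ioo 0 t))
    (ν := (volume : Measure (Torus d))) |>.ae hae
  filter_upwards [h1] with z hz
  exact hz.2 none z.2

/-- Duhamel potentials in weak form. -/
lemma Admissible.integral_potential_mul_smooth (h : Admissible T p q β) (hN : 0 ≤ N)
    (hg : IsSqrtSource T β N g) {t : ℝ} (ht : 0 < t) (htT : t ≤ T) {φ : Torus d → ℝ}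
    (hφ : IsSmooth φ) :
    IntegrableOn (fun r => ∫ x, potential none g r x * laplacian φ x) (Ioo 0 t) volume ∧
    IntegrableOn (fun s => ∫ x, g s x * φ x) (Ioo 0 t) volume ∧
    ∫ x, potential none g t x * φ x =
      (∫ s in Ioo 0 t, ∫ x, g s x * φ x) +
        ∫ r in Ioo 0 t, ∫ x, potential none g r x * laplacian φ x := by
  have hT : 0 < T := ht.trans_le htT
  have hc := hφ.continuous
  have hl := hφ.continuous_laplacian
  obtain ⟨M, hM0, hM⟩ := exists_abs_le_of_continuous hl
  obtain ⟨M', hM'0, hM'⟩ := exists_abs_le_of_continuous hc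
  set ψ := laplacian φ with hψ
  have hgi : Integrable (fun z : ℝ × Torus d => g z.1 z.2)
      ((volume.restrict (Ioo 0 t)).prod volume) :=
    (h.integrable_source hT hN hg).mono_measure (Ioo_prod_le_cylinder htT)
  obtain ⟨B, hB, hae⟩ := h.exists_majorant hN hg ht htT
  -- the kernel of the double time integral
  set K : ℝ → ℝ → ℝ := fun s r => ∫ x, g s x * extendZero (fun τ => conv none τ ψ) (r - s, x)
    with hK
  have hEm : Measurable (extendZero fun τ => conv none τ ψ) :=
    measurable_extendZero (continuousOn_conv none (continuous_integrable_torus hl))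
  have hEb : ∀ z, |extendZero (fun τ => conv none τ ψ) z| ≤ M := fun z => by
    obtain ⟨τ, x⟩ := z
    rcases lt_or_ge 0 τ with h0 | h0
    · rw [extendZero_of_pos _ h0]; exact abs_conv_none_le_of_bound h0 hl hM x
    · rw [extendZero_of_nonpos _ h0]; simpa using hM0
  have hKint : Integrable (fun w : ℝ × ℝ => K w.1 w.2)
      ((volume.restrict (Ioo 0 t)).prod (volume.restrict (Ioo 0 t))) := by
    have h1 : Measure.QuasiMeasurePreserving (Prod.map Prod.fst id :
        (ℝ × ℝ) × Torus d → ℝ × Torus d)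
        (((volume.restrict (Ioo 0 t)).prod (volume.restrict (Ioo 0 t))).prod volume)
        ((volume.restrict (Ioo 0 t)).prod volume) :=
      QuasiMeasurePreserving.prodMap Measure.quasiMeasurePreserving_fst
      (Measure.QuasiMeasurePreserving.id _)
    have h2 : AEStronglyMeasurable (fun w : (ℝ × ℝ) × Torus d => g w.1.1 w.2)
        (((volume.restrict (Ioo 0 t)).prod (volume.restrict (Ioo 0 t))).prod volume) :=
      hgi.aestronglyMeasurable.comp_quasiMeasurePreserving h1
    have h3 : Measurable fun w : (ℝ × ℝ) × Torus d =>
        extendZero (fun τ => conv none τ ψ) (w.1.2 - w.1.1, w.2) := hEm.comp (by fun_prop)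
    have h4 := (h2.mul h3.aestronglyMeasurable).integral_prod_right'
    have h5 : Integrable (fun s => (∫ x, ‖g s x‖) * M) (volume.restrict (Ioo 0 t)) :=
      hgi.integral_norm_prod_left.mul_const M
    refine Integrable.mono' (h5.comp_fst (volume.restrict (Ioo 0 t))) h4 ?_
    have h6 := Measure.quasiMeasurePreserving_fst (μ := volume.restrict (Ioo 0 t))
      (ν := (volume.restrict (Ioo 0 t) : Measure ℝ)) |>.ae hae
    filter_upwards [h6] with w hw
    refine (norm_integral_le_integral_norm _).trans ?_
    rw [← integral_mul_const]
    refine integral_mono_of_nonneg (Eventually.of_forall fun x => norm_nonneg _)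
      (hw.1.norm.mul_const M) (Eventually.of_forall fun x => ?_)
    simp only [norm_mul]
    gcongr
    exact hEb _
  have hKeq : ∀ s r, s < r → Integrable (g s) volume →
      K s r = ∫ x, conv none (r - s) (g s) x * ψ x := fun s r hsr hgs => by
    rw [integral_conv_mul (sub_pos.mpr hsr) hgs (continuous_integrable_torus hl)]
    simp only [hK, extendZero_of_pos _ (sub_pos.mpr hsr)]
  have hK0 : ∀ s r, r ≤ s → K s r = 0 := fun s r hsr => by
    simp only [hK, extendZero_of_nonpos _ (sub_nonpos.mpr hsr)]
    simp
  have hgφ : Integrable (fun s => ∫ x, g s x * φ x) (volume.restrict (Ioo 0 t)) := by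
    refine Integrable.integral_prod_left (f := fun z : ℝ × Torus d => g z.1 z.2 * φ z.2) ?_
    exact hgi.mul_bdd (g := fun z : ℝ × Torus d => φ z.2) (c := M')
      (hc.comp continuous_snd).aestronglyMeasurable (Eventually.of_forall fun z => hM' _)
  -- `K` is supported in `s < r`, so the square integral is one over a triangle. Integrating first
  -- in `s` yields the potential at time `r` paired with `Δφ`.
  have hinner : ∀ r ∈ Ioo 0 t, ∫ s in Ioo 0 t, K s r = ∫ x, potential none g r x * ψ x := by
    intro r hr
    rw [h.integral_potential_mul hN hg hr.1 (hr.2.le.trans htT) hl]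
    have h1 : ∫ s in Ioo 0 t, K s r = ∫ s in Ioo 0 r, K s r := by
      refine setIntegral_eq_of_subset_of_forall_sdiff_eq_zero measurableSet_Ioo
        (Ioo_subset_Ioo_right hr.2.le) fun s hs => hK0 s r ?_
      by_contra hlt
      push Not at hlt
      exact hs.2 ⟨hs.1.1, hlt⟩
    rw [h1]
    have hle : (volume.restrict (Ioo 0 r) : Measure ℝ) ≤ volume.restrict (Ioo 0 t) :=
      Measure.restrict_mono (Ioo_subset_Ioo_right hr.2.le) le_rfl
    refine integral_congr_ae ?_
    filter_upwards [ae_mono hle hae, ae_restrict_mem measurableSet_Ioo] with s hs hs'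
    exact hKeq s r hs'.2 hs.1
  -- Integrating first in `r` and substituting `ρ = r - s` yields the weak form of the heat flow
  -- started from `g s`. Comparing the two orders of integration proves the identity.
  have houter : ∀ᵐ s ∂(volume.restrict (Ioo 0 t)),
      ∫ x, conv none (t - s) (g s) x * φ x = (∫ x, g s x * φ x) + ∫ r in Ioo 0 t, K s r := by
    filter_upwards [hae, ae_restrict_mem measurableSet_Ioo] with s hs hs'
    rw [integral_conv_mul_smooth hs.1 hφ (sub_pos.mpr hs'.2)]
    congr 1
    have h1 : ∫ r in Ioo 0 t, K s r = ∫ r in Ioo s t, K s r := by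
      refine setIntegral_eq_of_subset_of_forall_sdiff_eq_zero measurableSet_Ioo
        (Ioo_subset_Ioo_left hs'.1.le) fun r hr => hK0 s r ?_
      by_contra hlt
      push Not at hlt
      exact hr.2 ⟨hlt, hr.1.2⟩
    rw [h1, setIntegral_congr_fun measurableSet_Ioo fun r hr => hKeq s r hr.1 hs.1,
      ← integral_Ioc_eq_integral_Ioo, ← intervalIntegral.integral_of_le hs'.2.le,
      ← intervalIntegral.integral_of_le (by linarith [hs'.2] : (0 : ℝ) ≤ t - s)]
    have := intervalIntegral.integral_comp_sub_right (a := s) (b := t)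
      (fun ρ => ∫ x, conv none ρ (g s) x * ψ x) s
    rw [sub_self] at this
    exact this.symm
  have hpot : Integrable (fun r => ∫ x, potential none g r x * ψ x)
      (volume.restrict (Ioo 0 t)) := by
    refine hKint.integral_prod_right.congr ?_
    filter_upwards [ae_restrict_mem measurableSet_Ioo] with r hr
    exact hinner r hr
  refine ⟨hpot, hgφ, ?_⟩
  have hswap : ∫ s in Ioo 0 t, ∫ r in Ioo 0 t, K s r = ∫ r in Ioo 0 t, ∫ s in Ioo 0 t, K s r :=
    integral_integral_swap hKint
  rw [h.integral_potential_mul hN hg ht htT hc, integral_congr_ae houter,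
    integral_add hgφ hKint.integral_prod_left, hswap]
  congr 1
  exact setIntegral_congr_fun measurableSet_Ioo hinner

end

/-! ### Uniqueness for the heat equation. -/

/-- Uniqueness of continuous weak solutions of the heat equation with zero initial value. -/
lemma eq_zero_of_weak_heat {T : ℝ} (hT : 0 ≤ T) {z : ℝ → Torus d → ℝ}
    (hz : ContinuousOn (fun w : ℝ × Torus d => z w.1 w.2) (Icc 0 T ×ˢ univ))
    (h : ∀ φ : Torus d → ℝ, IsSmooth φ → ∀ t ∈ Icc 0 T,
      ∫ x, z t x * φ x = ∫ s in (0 : ℝ)..t, ∫ x, z s x * laplacian φ x) :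
    ∀ t ∈ Icc 0 T, z t = 0 := by
  -- Clamping time to `[0, T]` gives a globally continuous function, for which the fundamental
  -- theorem of calculus applies at every time.
  set Z : ℝ × Torus d → ℝ := fun w => z (projIcc 0 T hT w.1) w.2 with hZ
  have hZc : Continuous Z := by
    refine hz.comp_continuous (f := fun w : ℝ × Torus d => ((projIcc 0 T hT w.1 : ℝ), w.2)) ?_
      fun w => ⟨(projIcc 0 T hT w.1).2, mem_univ _⟩
    exact (continuous_subtype_val.comp (continuous_projIcc.comp continuous_fst)).prodMk
      continuous_snd
  have hZe : ∀ t ∈ Icc 0 T, ∀ x, Z (t, x) = z t x := fun t ht x => by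
    simp only [hZ, projIcc_of_mem hT ht]
  obtain ⟨M, hM⟩ := (isCompact_Icc.prod isCompact_univ).exists_bound_of_continuousOn hz
  have hZb : ∀ w, ‖Z w‖ ≤ M := fun w =>
    hM ((projIcc 0 T hT w.1 : ℝ), w.2) ⟨(projIcc 0 T hT w.1).2, mem_univ _⟩
  have hzc : ∀ t ∈ Icc 0 T, Continuous (z t) := fun t ht => by
    have : Continuous fun x => Z (t, x) := by fun_prop
    simpa only [hZe t ht] using this
  intro t ht
  refine eq_of_integral_trig (hzc t ht) continuous_const fun b n => ?_
  have htc := (isSmooth_trig b n).continuous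
  obtain ⟨M', hM'0, hM'⟩ := exists_abs_le_of_continuous htc
  set Y : ℝ → ℝ := fun s => ∫ x, Z (s, x) * trig b n x with hY
  have hYc : Continuous Y := by
    refine continuous_of_dominated (bound := fun _ => M * M') (fun s => ?_)
      (fun s => Eventually.of_forall fun x => ?_) (integrable_const _)
      (Eventually.of_forall fun x => by fun_prop)
    · exact Continuous.aestronglyMeasurable (by fun_prop)
    · rw [norm_mul]
      exact mul_le_mul (hZb _) (hM' x) (norm_nonneg _) ((norm_nonneg _).trans (hZb (s, x)))
  set F : ℝ → ℝ := fun s => ∫ r in (0 : ℝ)..s, -lam n * Y r with hF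
  have hFd : ∀ s, HasDerivAt F (-lam n * Y s) s := fun s =>
    (hYc.const_mul _).integral_hasStrictDerivAt 0 s |>.hasDerivAt
  have hFY : ∀ s ∈ Icc 0 T, Y s = F s := by
    intro s hs
    have h1 := h _ (isSmooth_trig b n) s hs
    simp only [hY, hZe s hs]
    rw [h1, hF]
    refine intervalIntegral.integral_congr fun r hr => ?_
    rw [uIcc_of_le hs.1] at hr
    have hr' : r ∈ Icc 0 T := ⟨hr.1, hr.2.trans hs.2⟩
    simp only [hY, hZe r hr', laplacian_trig]
    rw [← integral_const_mul]
    refine integral_congr_ae (Eventually.of_forall fun x => ?_)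
    simp only; ring
  -- Each trigonometric coefficient solves `Y' = -λY` with `Y(0) = 0`, so it vanishes by Grönwall's
  -- inequality.
  have hF0 := eq_zero_of_abs_deriv_le_mul_abs_self_of_eq_zero_right (f := F)
    (f' := fun s => -lam n * Y s) (K := lam n) (a := 0) (b := T)
    (fun s _ => (hFd s).continuousAt.continuousWithinAt) (fun s _ => (hFd s).hasDerivWithinAt)
    (by simp [hF]) (fun s hs => by
      rw [hFY s ⟨hs.1, hs.2.le⟩, norm_mul, norm_neg, Real.norm_of_nonneg (lam_nonneg n)]) t ht
  have h2 := hFY t ht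
  rw [hF0] at h2
  simp only [hY, hZe t ht] at h2
  rw [h2]
  simp

/-! ### The lower order term and its envelope. -/

/-- The coefficients of the equation: the potential `c` for `none`, the drift `bᵢ` for `some i`. -/
def coeff (b : ℝ → Torus d → EuclideanSpace ℝ (Fin d)) (c : ℝ → Torus d → ℝ) :
    Option (Fin d) → ℝ → Torus d → ℝ
  | none => c
  | some i => fun t x => b t x i

/-- The sum of the absolute values of all coefficients. -/
def envelope (b : ℝ → Torus d → EuclideanSpace ℝ (Fin d)) (c : ℝ → Torus d → ℝ)
    (t : ℝ) (x : Torus d) : ℝ := ∑ j, |coeff b c j t x|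

/-- The lower order term applied to a family of functions standing for `h` and its derivatives. -/
def lowerOrderOf (b : ℝ → Torus d → EuclideanSpace ℝ (Fin d)) (c : ℝ → Torus d → ℝ)
    (V : Option (Fin d) → ℝ → Torus d → ℝ) (t : ℝ) (x : Torus d) : ℝ :=
  ∑ j, coeff b c j t x * V j t x

/-- A function of time and space, together with its partial derivatives. -/
def jet (h : ℝ → Torus d → ℝ) : Option (Fin d) → ℝ → Torus d → ℝ
  | none => h
  | some i => fun t => pderiv i (h t)

section
variable {T : ℝ} {p q : ℝ≥0∞} {b : ℝ → Torus d → EuclideanSpace ℝ (Fin d)} {c : ℝ → Torus d → ℝ}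
  {V : Option (Fin d) → ℝ → Torus d → ℝ}

lemma lowerOrder_eq (h : ℝ → Torus d → ℝ) (t : ℝ) (x : Torus d) :
    lowerOrder b c h t x = lowerOrderOf b c (jet h) t x := by
  rw [lowerOrder, lowerOrderOf, Fintype.sum_option, add_comm]
  rfl

lemma envelope_nonneg (t : ℝ) (x : Torus d) : 0 ≤ envelope b c t x :=
  Finset.sum_nonneg fun _ _ => abs_nonneg _

lemma aestronglyMeasurable_coeff (hb : MemLqLp T q p b) (hc : MemLqLp T q p c)
    (j : Option (Fin d)) :
    AEStronglyMeasurable (fun z : ℝ × Torus d => coeff b c j z.1 z.2) (cylinder d T) := by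
  cases j with
  | none => exact hc.1
  | some i => exact (EuclideanSpace.proj (𝕜 := ℝ) i).continuous.comp_aestronglyMeasurable hb.1

/-- Minkowski's inequality, once in space and once in time, puts the sum of all coefficients in the
same mixed space. -/
lemma admissible_envelope (hp : 2 < p) (hq : 2 < q) (hγ : krExponent d p q < 1)
    (hb : MemLqLp T q p b) (hc : MemLqLp T q p c) : Admissible T p q (envelope b c) := by
  have hp1 : 1 ≤ p := le_trans (by norm_num) hp.le
  have hq1 : 1 ≤ q := le_trans (by norm_num) hq.le
  have hm := aestronglyMeasurable_coeff hb hc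
  refine ⟨hp1, hq, hγ, ?_, ?_⟩
  · simp only [envelope]
    exact Finset.aestronglyMeasurable_fun_sum _ fun j _ => (hm j).norm
  have h1 : ∀ᵐ t ∂(volume.restrict (Icc 0 T)), eLpNorm (envelope b c t) p volume ≤
      ∑ j, eLpNorm (coeff b c j t) p volume := by
    have h2 : ∀ᵐ t ∂(volume.restrict (Icc 0 T)), ∀ j,
        AEStronglyMeasurable (coeff b c j t) volume :=
      ae_all_iff.mpr fun j => AEStronglyMeasurable.prodMk_left (hm j)
    filter_upwards [h2] with t ht
    have h3 := eLpNorm_sum_le (f := fun j x => |coeff b c j t x|) (s := Finset.univ)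
      (fun j _ => (ht j).norm) hp1
    have h4 : (∑ j, fun x => |coeff b c j t x|) = envelope b c t := by
      ext x; simp [envelope]
    rw [h4] at h3
    refine h3.trans (Finset.sum_le_sum fun j _ => ?_)
    exact eLpNorm_mono fun x => (norm_norm (coeff b c j t x)).le
  have h2 : eLpNorm (fun t => eLpNorm (envelope b c t) p volume) q (volume.restrict (Icc 0 T)) ≤
      ∑ j, eLpNorm (fun t => eLpNorm (coeff b c j t) p volume) q (volume.restrict (Icc 0 T)) := by
    refine le_trans ?_ (eLpNorm_sum_le (f := fun j t => eLpNorm (coeff b c j t) p volume)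
      (s := Finset.univ) (fun j _ => (aemeasurable_eLpNorm_slice (hm j) p).aestronglyMeasurable) hq1)
    refine eLpNorm_mono_enorm_ae ?_
    filter_upwards [h1] with t ht
    simpa using ht
  refine h2.trans_lt (ENNReal.sum_lt_top.mpr fun j _ => ?_)
  cases j with
  | none => exact hc.2
  | some i =>
    refine (eLpNorm_mono_enorm fun t => ?_).trans_lt hb.2
    simp only [enorm_eq_self]
    exact eLpNorm_mono fun x => PiLp.norm_apply_le (b t x) i

lemma abs_lowerOrderOf_le {s w : ℝ} {x : Torus d} (hw : ∀ j, |V j s x| ≤ w) :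
    |lowerOrderOf b c V s x| ≤ w * |envelope b c s x| := by
  rw [abs_of_nonneg (envelope_nonneg s x), envelope, Finset.mul_sum]
  refine (Finset.abs_sum_le_sum_abs _ _).trans (Finset.sum_le_sum fun j _ => ?_)
  rw [abs_mul, mul_comm]
  exact mul_le_mul_of_nonneg_right (hw j) (abs_nonneg _)

lemma isSource_lowerOrderOf (hb : MemLqLp T q p b) (hc : MemLqLp T q p c)
    (hV : ∀ j, ContinuousOn (fun z : ℝ × Torus d => V j z.1 z.2) (Ioc 0 T ×ˢ univ)) {w : ℝ → ℝ}
    (hw : ∀ j, ∀ t ∈ Ioc 0 T, ∀ x, |V j t x| ≤ w t) :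
    IsSource T (envelope b c) w (lowerOrderOf b c V) := by
  refine ⟨?_, fun s hs x => ?_⟩
  · refine Finset.aestronglyMeasurable_fun_sum _ fun j _ =>
      (aestronglyMeasurable_coeff hb hc j).mul ?_
    have h1 : cylinder d T = (volume.prod volume).restrict (Ioc 0 T ×ˢ univ) := by
      rw [cylinder, ← Measure.prod_restrict, Measure.restrict_univ,
        Measure.restrict_congr_set Ioc_ae_eq_Icc.symm]
    rw [h1]
    exact (hV j).aestronglyMeasurable (measurableSet_Ioc.prod MeasurableSet.univ)
  · exact abs_lowerOrderOf_le fun j => hw j s hs x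

lemma lowerOrderOf_sub (V V' : Option (Fin d) → ℝ → Torus d → ℝ) (t : ℝ) (x : Torus d) :
    lowerOrderOf b c (fun j s y => V j s y - V' j s y) t x =
      lowerOrderOf b c V t x - lowerOrderOf b c V' t x := by
  simp only [lowerOrderOf, mul_sub, Finset.sum_sub_distrib]

end

/-! ### Contraction and solution of the mild equation. -/

section
variable {T : ℝ} {p q : ℝ≥0∞} {β g g' : ℝ → Torus d → ℝ}

lemma Admissible.potential_sub (h : Admissible T p q β) {N N' : ℝ} (hN : 0 ≤ N) (hN' : 0 ≤ N')
    (hg : IsSqrtSource T β N g) (hg' : IsSqrtSource T β N' g') (j : Option (Fin d)) {t : ℝ}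
    (ht : 0 < t) (htT : t ≤ T) (x : Torus d) :
    potential j (fun s y => g s y - g' s y) t x = potential j g t x - potential j g' t x := by
  obtain ⟨C, -, hC⟩ := h.exists_potential_le j
  obtain ⟨B, -, hae⟩ := h.exists_majorant hN hg ht htT
  obtain ⟨B', -, hae'⟩ := h.exists_majorant hN' hg' ht htT
  rw [potential, potential, potential, ← integral_sub (hC N g hN hg t ht htT x).1
    (hC N' g' hN' hg' t ht htT x).1]
  refine integral_congr_ae ?_
  filter_upwards [hae, hae'] with s hs hs'
  rw [conv, conv, conv, ← integral_sub (integrable_kernel_mul j _ hs.1 x)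
    (integrable_kernel_mul j _ hs'.1 x)]
  simp only [mul_sub]

/-- The weight `e^{-Lt} t^{1/2}`. -/
def expWeight (L t : ℝ) : ℝ := Real.exp (-(L * t)) * t ^ (1 / 2 : ℝ)

lemma expWeight_pos (L : ℝ) {t : ℝ} (ht : 0 < t) : 0 < expWeight L t := by
  unfold expWeight; positivity

lemma inv_expWeight (L : ℝ) {t : ℝ} (ht : 0 < t) :
    (expWeight L t)⁻¹ = Real.exp (L * t) * t ^ (-(1 / 2) : ℝ) := by
  rw [expWeight, mul_inv, ← Real.exp_neg, neg_neg, Real.rpow_neg ht.le]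

lemma inv_expWeight_le {L : ℝ} (hL : 0 ≤ L) {t : ℝ} (ht : t ∈ Ioc 0 T) :
    (expWeight L t)⁻¹ ≤ Real.exp (L * T) * t ^ (-(1 / 2) : ℝ) := by
  have := ht.1
  rw [inv_expWeight L ht.1]
  gcongr
  exact ht.2

lemma expWeight_le {L : ℝ} (hL : 0 ≤ L) {t : ℝ} (ht : 0 < t) : expWeight L t ≤ t ^ (1 / 2 : ℝ) := by
  refine mul_le_of_le_one_left (by positivity) ?_
  rw [Real.exp_le_one_iff]
  have := mul_nonneg hL ht.le
  linarith

lemma continuousOn_expWeight (L : ℝ) : ContinuousOn (expWeight L) (Ioi 0) := by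
  unfold expWeight
  refine ContinuousOn.mul (by fun_prop) ?_
  exact continuousOn_id.rpow_const fun x hx => Or.inl (ne_of_gt hx)

/-- A large exponential weight makes potentials contracting. -/
lemma Admissible.exists_contraction (h : Admissible T p q β) : ∃ L : ℝ, 0 < L ∧
    ∀ (N : ℝ) (g : ℝ → Torus d → ℝ), 0 ≤ N →
      IsSource T β (fun s => N * (expWeight L s)⁻¹) g → ∀ t ∈ Ioc 0 T, ∀ j x,
        expWeight L t * |potential j g t x| ≤ N / 2 := by
  obtain ⟨C, hC0, hC⟩ := h.exists_potential_exp_le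
  have hη : 0 < gain d p q := by have := h.subcritical; rw [gain]; linarith
  have h1 : Tendsto (fun L : ℝ => C * L ^ (-gain d p q)) atTop (𝓝 (C * 0)) :=
    (tendsto_rpow_neg_atTop hη).const_mul C
  rw [mul_zero] at h1
  obtain ⟨L, hL1, hL2⟩ := ((h1.eventually (gt_mem_nhds (show (0 : ℝ) < 1 / 2 by norm_num))).and
    (eventually_gt_atTop 0)).exists
  refine ⟨L, hL2, fun N g hN hg t ht j x => ?_⟩
  have h2 := hC N L g hN hL2 ⟨hg.meas, fun s hs x => by
    have := hg.le s hs x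
    rwa [inv_expWeight L hs.1] at this⟩ t ht.1 ht.2 j x
  refine h2.trans ?_
  have := mul_le_mul_of_nonneg_right hL1.le hN
  linarith

end

section
variable {T : ℝ} {p q : ℝ≥0∞} {b : ℝ → Torus d → EuclideanSpace ℝ (Fin d)} {c : ℝ → Torus d → ℝ}

/-- The homogeneous fixed point equation has only the trivial solution. -/
lemma eq_zero_of_eq_potential (h : Admissible T p q (envelope b c))
    {V : Option (Fin d) → ℝ → Torus d → ℝ} {M : ℝ} (hM : 0 ≤ M)
    (hm : AEStronglyMeasurable (fun z : ℝ × Torus d => lowerOrderOf b c V z.1 z.2) (cylinder d T))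
    (hV : ∀ j, ∀ t ∈ Ioc 0 T, ∀ x, |V j t x| ≤ M * t ^ (-(1 / 2) : ℝ))
    (hfix : ∀ j, ∀ t ∈ Ioc 0 T, ∀ x, V j t x = potential j (lowerOrderOf b c V) t x) :
    ∀ j, ∀ t ∈ Ioc 0 T, ∀ x, V j t x = 0 := by
  obtain ⟨L, hL, hc⟩ := h.exists_contraction
  -- Each substitution of the fixed point equation into itself halves the weighted bound, since
  -- potentials contract by `1/2`.
  have h1 : ∀ n : ℕ, ∀ j, ∀ t ∈ Ioc 0 T, ∀ x, expWeight L t * |V j t x| ≤ M / 2 ^ n := by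
    intro n
    induction n with
    | zero =>
      intro j t ht x
      rw [pow_zero, div_one]
      calc expWeight L t * |V j t x| ≤ t ^ (1 / 2 : ℝ) * (M * t ^ (-(1 / 2) : ℝ)) := by
            have := (expWeight_pos L ht.1).le
            have := ht.1
            gcongr
            · exact expWeight_le hL.le ht.1
            · exact hV j t ht x
        _ = M := by
            rw [mul_left_comm, ← Real.rpow_add ht.1]; simp
    | succ n ih =>
      intro j t ht x
      rw [hfix j t ht x, pow_succ, ← div_div]
      refine hc (M / 2 ^ n) _ (by positivity) ⟨hm, fun s hs y => ?_⟩ t ht j x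
      refine abs_lowerOrderOf_le fun i => ?_
      rw [← div_eq_mul_inv, le_div_iff₀ (expWeight_pos L hs.1), mul_comm]
      exact ih i s hs y
  intro j t ht x
  have h2 : Tendsto (fun n : ℕ => M / 2 ^ n) atTop (𝓝 0) := by
    have := (tendsto_pow_atTop_nhds_zero_of_lt_one (r := (1 / 2 : ℝ)) (by norm_num)
      (by norm_num)).const_mul M
    simpa [div_eq_mul_inv] using this
  have h3 := ge_of_tendsto' h2 fun n => h1 n j t ht x
  have h4 := expWeight_pos L ht.1
  have h5 : |V j t x| ≤ 0 := by
    by_contra hlt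
    push Not at hlt
    linarith [mul_pos h4 hlt]
  exact abs_nonpos_iff.mp h5

/-- The families recovered from their weighted versions. -/
def unweight (L : ℝ) (H : BoundedContinuousFunction (Ioc 0 T × Torus d) (Option (Fin d) → ℝ))
    (j : Option (Fin d)) (t : ℝ) (x : Torus d) : ℝ :=
  open Classical in if ht : t ∈ Ioc 0 T then (expWeight L t)⁻¹ * H (⟨t, ht⟩, x) j else 0

lemma unweight_apply (L : ℝ)
    (H : BoundedContinuousFunction (Ioc 0 T × Torus d) (Option (Fin d) → ℝ))
    (j : Option (Fin d)) {t : ℝ} (ht : t ∈ Ioc 0 T) (x : Torus d) :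
    unweight L H j t x = (expWeight L t)⁻¹ * H (⟨t, ht⟩, x) j := dif_pos ht

lemma abs_unweight_le (L : ℝ)
    (H : BoundedContinuousFunction (Ioc 0 T × Torus d) (Option (Fin d) → ℝ))
    (j : Option (Fin d)) {t : ℝ} (ht : t ∈ Ioc 0 T) (x : Torus d) :
    |unweight L H j t x| ≤ ‖H‖ * (expWeight L t)⁻¹ := by
  have h1 := inv_nonneg.mpr (expWeight_pos L ht.1).le
  rw [unweight_apply L H j ht, abs_mul, abs_of_nonneg h1, mul_comm]
  gcongr
  exact (norm_le_pi_norm (H (⟨t, ht⟩, x)) j).trans (H.norm_coe_le_norm _)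

lemma continuousOn_unweight (L : ℝ)
    (H : BoundedContinuousFunction (Ioc 0 T × Torus d) (Option (Fin d) → ℝ))
    (j : Option (Fin d)) :
    ContinuousOn (fun z : ℝ × Torus d => unweight L H j z.1 z.2) (Ioc 0 T ×ˢ univ) := by
  rw [continuousOn_iff_continuous_domRestrict]
  have h1 : Continuous fun z : (Ioc 0 T ×ˢ univ : Set (ℝ × Torus d)) =>
      ((⟨z.1.1, z.2.1⟩, z.1.2) : Ioc 0 T × Torus d) := by fun_prop
  have h2 : Continuous fun z : (Ioc 0 T ×ˢ univ : Set (ℝ × Torus d)) => (expWeight L z.1.1)⁻¹ :=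
    ((continuousOn_expWeight L).comp_continuous (by fun_prop) fun z => z.2.1.1).inv₀
      fun z => (expWeight_pos L z.2.1.1).ne'
  have h3 : Continuous fun z : (Ioc 0 T ×ˢ univ : Set (ℝ × Torus d)) =>
      H (⟨z.1.1, z.2.1⟩, z.1.2) j := (continuous_apply j).comp (H.continuous.comp h1)
  refine (h2.mul h3).congr fun z => ?_
  exact (unweight_apply L H j z.2.1 z.1.2).symm

lemma exists_weighted (L : ℝ) {V : Option (Fin d) → ℝ → Torus d → ℝ} {K : ℝ}
    (hV : ∀ j, ContinuousOn (fun z : ℝ × Torus d => V j z.1 z.2) (Ioc 0 T ×ˢ univ)) (hK0 : 0 ≤ K)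
    (hK : ∀ j, ∀ t ∈ Ioc 0 T, ∀ x, expWeight L t * |V j t x| ≤ K) :
    ∃ H : BoundedContinuousFunction (Ioc 0 T × Torus d) (Option (Fin d) → ℝ),
      ∀ z j, H z j = expWeight L z.1 * V j z.1 z.2 := by
  refine ⟨BoundedContinuousFunction.ofNormedAddCommGroup
    (fun z j => expWeight L z.1 * V j z.1 z.2) ?_ K fun z => ?_, fun z j => rfl⟩
  · refine continuous_pi fun j => ?_
    refine ((continuousOn_expWeight L).comp_continuous (by fun_prop) fun z => z.1.2.1).mul ?_
    exact (hV j).comp_continuous (f := fun z : Ioc 0 T × Torus d => ((z.1 : ℝ), z.2))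
      (by fun_prop) fun z => ⟨z.1.2, mem_univ _⟩
  · refine (pi_norm_le_iff_of_nonneg hK0).mpr fun j => ?_
    rw [norm_mul, Real.norm_of_nonneg (expWeight_pos L z.1.2.1).le]
    exact hK j z.1 z.1.2 z.2

/-- The mild formulation of the equation is solvable. -/
lemma exists_mild_solution (hT : 0 < T) (hp : 2 < p) (hq : 2 < q) (hγ : krExponent d p q < 1)
    (hb : MemLqLp T q p b) (hc : MemLqLp T q p c) :
    ∃ C : ℝ, 0 ≤ C ∧ ∀ h₀ : Torus d → ℝ, MemLp h₀ ∞ volume →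
      ∃ V : Option (Fin d) → ℝ → Torus d → ℝ,
        (∀ j, ContinuousOn (fun z : ℝ × Torus d => V j z.1 z.2) (Ioc 0 T ×ˢ univ)) ∧
        (∀ j, ∀ t ∈ Ioc 0 T, ∀ x,
          |V j t x| ≤ C * (eLpNorm h₀ ∞ volume).toReal * t ^ (-(1 / 2) : ℝ)) ∧
        ∀ j, ∀ t ∈ Ioc 0 T, ∀ x,
          V j t x = conv j t h₀ x + potential j (lowerOrderOf b c V) t x := by
  have h := admissible_envelope hp hq hγ hb hc
  obtain ⟨L, hL, hcontr⟩ := h.exists_contraction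
  obtain ⟨C0, hC0, hC⟩ := exists_abs_conv_le d ∞ (by simp) T
  -- `A/2` bounds the weighted free evolution. The entry `1` of the maximum serves the derivatives,
  -- whose singularity `t^{-1/2}` is cancelled by the weight; `T^{1/2}` serves the function itself.
  -- The factor `2` anticipates absorbing `‖H‖/2`.
  set A : ℝ := 2 * (C0 * max 1 (T ^ (1 / 2 : ℝ))) with hA
  have hA0 : 0 ≤ A := by positivity
  refine ⟨A * Real.exp (L * T), by positivity, fun h₀ hh₀ => ?_⟩
  set n₀ := (eLpNorm h₀ ∞ volume).toReal with hn₀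
  have hn0 : 0 ≤ n₀ := ENNReal.toReal_nonneg
  have hint : Integrable h₀ volume := hh₀.integrable le_top
  -- the free evolution
  have hfree : ∀ j, ∀ t ∈ Ioc 0 T, ∀ x, expWeight L t * |conv j t h₀ x| ≤ A / 2 * n₀ := by
    intro j t ht x
    have ht0 := ht.1
    have h1 := (hC h₀ hh₀ t ht.1 ht.2 j).1 x
    have h2 : expWeight L t * |conv j t h₀ x| ≤
        t ^ (1 / 2 : ℝ) * (C0 * t ^ (-(smoothExp d ∞ + halfOrder j)) * n₀) := by
      have := (expWeight_pos L ht.1).le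
      gcongr
      exact expWeight_le hL.le ht.1
    refine h2.trans ?_
    have h3 : t ^ (1 / 2 : ℝ) * t ^ (-(smoothExp d ∞ + halfOrder j)) ≤
        max 1 (T ^ (1 / 2 : ℝ)) := by
      rw [← Real.rpow_add ht0]
      have hs : smoothExp d ∞ = 0 := by simp [smoothExp]
      cases j with
      | none =>
        refine le_trans ?_ (le_max_right _ _)
        simp only [hs, halfOrder, add_zero, neg_zero]
        exact Real.rpow_le_rpow ht0.le ht.2 (by norm_num)
      | some i =>
        refine le_trans (le_of_eq ?_) (le_max_left _ _)
        simp [hs, halfOrder]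
    calc _ = C0 * (t ^ (1 / 2 : ℝ) * t ^ (-(smoothExp d ∞ + halfOrder j))) * n₀ := by ring
      _ ≤ C0 * max 1 (T ^ (1 / 2 : ℝ)) * n₀ := by gcongr
      _ = A / 2 * n₀ := by rw [hA]; ring
  have hfreec : ∀ j, ContinuousOn (fun z : ℝ × Torus d => conv j z.1 h₀ z.2) (Ioc 0 T ×ˢ univ) :=
    fun j => (continuousOn_conv j hint).mono (prod_mono (fun t ht => ht.1) subset_rfl)
  -- the sources
  have hsrc : ∀ H : BoundedContinuousFunction (Ioc 0 T × Torus d) (Option (Fin d) → ℝ),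
      IsSource T (envelope b c) (fun s => ‖H‖ * (expWeight L s)⁻¹)
        (lowerOrderOf b c (unweight L H)) := fun H =>
    isSource_lowerOrderOf hb hc (continuousOn_unweight L H)
      fun j t ht x => abs_unweight_le L H j ht x
  have hsq : ∀ H : BoundedContinuousFunction (Ioc 0 T × Torus d) (Option (Fin d) → ℝ),
      IsSqrtSource T (envelope b c) (‖H‖ * Real.exp (L * T))
        (lowerOrderOf b c (unweight L H)) := fun H =>
    ⟨(hsrc H).meas, fun s hs x => ((hsrc H).le s hs x).trans (by
      refine mul_le_mul_of_nonneg_right ?_ (abs_nonneg _)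
      rw [mul_assoc]
      exact mul_le_mul_of_nonneg_left (inv_expWeight_le hL.le hs) (norm_nonneg _))⟩
  have hN : ∀ H : BoundedContinuousFunction (Ioc 0 T × Torus d) (Option (Fin d) → ℝ),
      0 ≤ ‖H‖ * Real.exp (L * T) := fun H => by positivity
  -- the fixed point map
  have hΦ : ∀ H : BoundedContinuousFunction (Ioc 0 T × Torus d) (Option (Fin d) → ℝ),
      ∃ H' : BoundedContinuousFunction (Ioc 0 T × Torus d) (Option (Fin d) → ℝ),
        ∀ z j, H' z j = expWeight L z.1 * (conv j z.1 h₀ z.2 +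
          potential j (lowerOrderOf b c (unweight L H)) z.1 z.2) := by
    intro H
    refine exists_weighted L (V := fun j t x => conv j t h₀ x +
      potential j (lowerOrderOf b c (unweight L H)) t x) (K := A / 2 * n₀ + ‖H‖ / 2)
      (fun j => (hfreec j).add (h.continuousOn_potential hT (hN H) (hsq H) j)) (by positivity)
      fun j t ht x => ?_
    have h1 := mul_le_mul_of_nonneg_left (abs_add_le (conv j t h₀ x)
      (potential j (lowerOrderOf b c (unweight L H)) t x)) (expWeight_pos L ht.1).le
    have h2 := hcontr ‖H‖ _ (norm_nonneg _) (hsrc H) t ht j x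
    have h3 := hfree j t ht x
    rw [mul_add] at h1
    linarith
  choose Φ hΦ using hΦ
  have hlin : ∀ H H' : BoundedContinuousFunction (Ioc 0 T × Torus d) (Option (Fin d) → ℝ),
      ∀ j, ∀ t ∈ Ioc 0 T, ∀ x, potential j (lowerOrderOf b c (unweight L (H - H'))) t x =
        potential j (lowerOrderOf b c (unweight L H)) t x -
          potential j (lowerOrderOf b c (unweight L H')) t x := by
    intro H H' j t ht x
    rw [← h.potential_sub (hN H) (hN H') (hsq H) (hsq H') j ht.1 ht.2 x]
    have h1 : ∀ i s y, unweight L (H - H') i s y = unweight L H i s y - unweight L H' i s y := by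
      intro i s y
      unfold unweight
      split_ifs
      · simp [mul_sub]
      · simp
    congr 1
    ext s y
    rw [← lowerOrderOf_sub]
    simp only [lowerOrderOf, h1]
  have hdist : ∀ H H', dist (Φ H) (Φ H') ≤ (1 / 2 : ℝ≥0) * dist H H' := by
    intro H H'
    refine (BoundedContinuousFunction.dist_le (by positivity)).mpr fun z => ?_
    refine (dist_pi_le_iff (by positivity)).mpr fun j => ?_
    have h1 := hcontr ‖H - H'‖ _ (norm_nonneg _) (hsrc (H - H')) z.1 z.1.2 j z.2
    rw [hlin H H' j z.1 z.1.2 z.2] at h1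
    rw [Real.dist_eq, hΦ, hΦ, ← mul_sub, add_sub_add_left_eq_sub, abs_mul,
      abs_of_pos (expWeight_pos L z.1.2.1), dist_eq_norm]
    refine h1.trans (le_of_eq ?_)
    push_cast; ring
  have hcw : ContractingWith (1 / 2 : ℝ≥0) Φ :=
    ⟨by rw [← NNReal.coe_lt_coe]; norm_num, LipschitzWith.of_dist_le_mul hdist⟩
  -- The components of `H` are not assumed to be derivatives of one another. The space is that of
  -- all bounded continuous families on `(0, T]`, which is complete; the derivative structure is
  -- recovered later from the equation.
  set H := ContractingWith.fixedPoint Φ hcw with hH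
  have hfix : Φ H = H := hcw.fixedPoint_isFixedPt
  have hnorm : ‖H‖ ≤ A * n₀ := by
    -- The fixed point is the free evolution plus a potential of at most half its own norm, and that
    -- half is absorbed.
    have h1 : ‖H‖ ≤ A / 2 * n₀ + ‖H‖ / 2 := by
      refine (BoundedContinuousFunction.norm_le (by positivity)).mpr fun z => ?_
      refine (pi_norm_le_iff_of_nonneg (by positivity)).mpr fun j => ?_
      have h1 := hΦ H z j
      rw [hfix] at h1
      rw [h1, Real.norm_eq_abs, abs_mul, abs_of_pos (expWeight_pos L z.1.2.1)]
      have h2 := mul_le_mul_of_nonneg_left (abs_add_le (conv j z.1 h₀ z.2)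
        (potential j (lowerOrderOf b c (unweight L H)) z.1 z.2)) (expWeight_pos L z.1.2.1).le
      have h3 := hcontr ‖H‖ _ (norm_nonneg _) (hsrc H) z.1 z.1.2 j z.2
      have h4 := hfree j z.1 z.1.2 z.2
      rw [mul_add] at h2
      linarith
    linarith
  refine ⟨unweight L H, continuousOn_unweight L H, fun j t ht x => ?_, fun j t ht x => ?_⟩
  · refine (abs_unweight_le L H j ht x).trans ?_
    have h1 := inv_expWeight_le hL.le ht
    have h2 := inv_nonneg.mpr (expWeight_pos L ht.1).le
    calc ‖H‖ * (expWeight L t)⁻¹ ≤ (A * n₀) * (Real.exp (L * T) * t ^ (-(1 / 2) : ℝ)) := by gcongr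
      _ = _ := by ring
  · rw [unweight_apply L H j ht]
    have h1 := hΦ H (⟨t, ht⟩, x) j
    rw [hfix] at h1
    rw [h1, inv_mul_cancel_left₀ (expWeight_pos L ht.1).ne']

end

/-! ### First order jets and Hölder norms. -/

/-- The family `D` consists of a continuously differentiable function and its partial
derivatives. -/
structure IsJet (D : Option (Fin d) → Torus d → ℝ) : Prop where
  continuous : ∀ j, Continuous (D j)
  hasFDerivAt : ∀ x, HasFDerivAt (lift (D none)) (covector fun i => D (some i) (proj x)) x

lemma IsJet.contDiff {D : Option (Fin d) → Torus d → ℝ} (hD : IsJet D) :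
    ContDiff ℝ 1 (lift (D none)) :=
  contDiff_one_iff_hasFDerivAt.mpr ⟨_, continuous_covector.comp
    (continuous_pi fun i => (hD.continuous (some i)).comp continuous_proj), hD.hasFDerivAt⟩

lemma IsJet.pderiv {D : Option (Fin d) → Torus d → ℝ} (hD : IsJet D) (i : Fin d) :
    pderiv i (D none) = D (some i) := by
  ext x
  obtain ⟨x, rfl⟩ := proj_surjective x
  rw [pderiv_eq_of_hasFDerivAt (hD.hasFDerivAt x), covector_basisVec]

lemma IsJet.add {D D' : Option (Fin d) → Torus d → ℝ} (hD : IsJet D) (hD' : IsJet D') :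
    IsJet fun j x => D j x + D' j x :=
  ⟨fun j => (hD.continuous j).add (hD'.continuous j), fun x =>
    ((hD.hasFDerivAt x).add (hD'.hasFDerivAt x)).congr_fderiv (by
      ext y; simp [covector_apply, add_mul, Finset.sum_add_distrib])⟩

lemma IsJet.sub {D D' : Option (Fin d) → Torus d → ℝ} (hD : IsJet D) (hD' : IsJet D') :
    IsJet fun j x => D j x - D' j x :=
  ⟨fun j => (hD.continuous j).sub (hD'.continuous j), fun x =>
    ((hD.hasFDerivAt x).sub (hD'.hasFDerivAt x)).congr_fderiv (by rw [covector_sub]; rfl)⟩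

lemma isJet_of_contDiff {f : Torus d → ℝ} (hf : ContDiff ℝ 1 (lift f)) :
    IsJet fun j => j.elim f fun i => pderiv i f := by
  refine ⟨fun j => ?_, fun x => ?_⟩
  · cases j with
    | none => exact continuous_of_continuous_lift hf.continuous
    | some i => exact continuous_pderiv hf i
  · have h1 : HasFDerivAt (lift f) (fderiv ℝ (lift f) x) x :=
      ((hf.differentiable one_ne_zero) x).hasFDerivAt
    refine h1.congr_fderiv ?_
    ext y
    simp only [covector_apply, Option.elim]
    have h2 : y = ∑ i, y i • basisVec i := by
      ext k; simp [basisVec, Pi.single_apply]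
    conv_lhs => rw [h2]
    simp only [map_sum, map_smul, smul_eq_mul]
    exact Finset.sum_congr rfl fun i _ => by rw [pderiv_eq_of_hasFDerivAt h1, mul_comm]

lemma holderWith_of_norm_sub_le {E F : Type*} [NormedAddCommGroup E] [NormedAddCommGroup F]
    {f : E → F} {S θ : ℝ} (hS : 0 ≤ S) (hθ : 0 ≤ θ)
    (h : ∀ x x', ‖f x - f x'‖ ≤ S * ‖x - x'‖ ^ θ) : HolderWith S.toNNReal θ.toNNReal f := by
  intro x x'
  rw [edist_dist, edist_dist, dist_eq_norm, dist_eq_norm, Real.coe_toNNReal θ hθ,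
    ENNReal.ofReal_rpow_of_nonneg (norm_nonneg _) hθ]
  change _ ≤ ENNReal.ofReal S * _
  rw [← ENNReal.ofReal_mul hS]
  exact ENNReal.ofReal_le_ofReal (h x x')

lemma norm_iteratedFDeriv_one_sub_le {E : Type*} [NormedAddCommGroup E] [NormedSpace ℝ E]
    (f : E → ℝ) (x x' : E) :
    ‖iteratedFDeriv ℝ 1 f x - iteratedFDeriv ℝ 1 f x'‖ ≤ ‖fderiv ℝ f x - fderiv ℝ f x'‖ := by
  refine ContinuousMultilinearMap.opNorm_le_bound (norm_nonneg _) fun m => ?_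
  simpa using (fderiv ℝ f x - fderiv ℝ f x').le_opNorm (m 0)

/-- Hölder norms are controlled by the suprema and Hölder constants of a function and its
partial derivatives. -/
lemma IsJet.holderNorm_le {D : Option (Fin d) → Torus d → ℝ} (hD : IsJet D) {δ M S : ℝ}
    (hδ0 : 0 ≤ δ) (hδ2 : δ < 2) (hM0 : 0 ≤ M) (hS0 : 0 ≤ S)
    (hM : ∀ j, 2 * halfOrder j ≤ δ → ∀ x, |D j x| ≤ M)
    (hS : ∀ j θ, 0 ≤ θ → θ < 1 → 2 * halfOrder j + θ = δ →
      ∀ x x', |D j (proj x) - D j (proj x')| ≤ S * ‖x - x'‖ ^ θ) :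
    holderNorm δ (D none) ≤ ENNReal.ofReal ((1 + d) * (M + S)) := by
  have hd : (0 : ℝ) ≤ d := Nat.cast_nonneg d
  have h0 : ∀ x, ‖iteratedFDeriv ℝ 0 (lift (D none)) x‖ₑ ≤ ENNReal.ofReal M := fun x => by
    rw [← ofReal_norm, norm_iteratedFDeriv_zero]
    exact ENNReal.ofReal_le_ofReal (hM none (by simpa [halfOrder] using hδ0) (proj x))
  -- As `0 ≤ δ < 2`, the integer part is `0` or `1`. The constraint `0 ≤ θ < 1` in `hS` selects the
  -- derivatives of that order.
  rcases lt_or_ge δ 1 with h1 | h1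
  · have hfl : ⌊δ⌋₊ = 0 := Nat.floor_eq_zero.mpr h1
    rw [holderNorm, if_pos, hfl]
    · simp only [zero_add, Finset.range_one, Finset.sum_singleton, Nat.cast_zero, sub_zero]
      have h2 : (if (0 : ℝ) = δ then 0 else
          eHolderNorm δ.toNNReal (iteratedFDeriv ℝ 0 (lift (D none)))) ≤ ENNReal.ofReal S := by
        split_ifs
        · exact zero_le
        · refine (holderWith_of_norm_sub_le hS0 hδ0 fun x x' => ?_).eHolderNorm_le
          rw [iteratedFDeriv_zero_eq_comp, Function.comp_apply, Function.comp_apply, ← map_sub,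
            LinearIsometryEquiv.norm_map]
          exact hS none δ hδ0 h1 (by simp [halfOrder]) x x'
      calc _ ≤ ENNReal.ofReal M + ENNReal.ofReal S := add_le_add (iSup_le h0) h2
        _ = ENNReal.ofReal (M + S) := (ENNReal.ofReal_add hM0 hS0).symm
        _ ≤ _ := ENNReal.ofReal_le_ofReal (by nlinarith [mul_nonneg hd (add_nonneg hM0 hS0)])
    · rw [hfl]
      exact hD.contDiff.of_le (by simp)
  · have hfl : ⌊δ⌋₊ = 1 := (Nat.floor_eq_iff hδ0).mpr ⟨by simpa using h1, by norm_num; exact hδ2⟩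
    have hfd : fderiv ℝ (lift (D none)) = fun x => covector fun i => D (some i) (proj x) :=
      funext fun x => (hD.hasFDerivAt x).fderiv
    have hsup : ∀ x, ‖iteratedFDeriv ℝ 1 (lift (D none)) x‖ₑ ≤ ENNReal.ofReal (d * M) := fun x => by
      rw [← ofReal_norm, norm_iteratedFDeriv_one, hfd]
      refine ENNReal.ofReal_le_ofReal ((norm_covector_le _).trans ?_)
      refine (Finset.sum_le_sum fun i _ => hM (some i) (by simpa [halfOrder] using h1) _).trans ?_
      simp
    rw [holderNorm, if_pos, hfl]
    · simp only [Finset.sum_range_succ, Finset.sum_range_zero, zero_add, Nat.cast_one]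
      have h2 : (if (1 : ℝ) = δ then 0 else
          eHolderNorm (δ - 1).toNNReal (iteratedFDeriv ℝ 1 (lift (D none)))) ≤
            ENNReal.ofReal (d * S) := by
        split_ifs
        · exact zero_le
        · refine (holderWith_of_norm_sub_le (by positivity) (by linarith) fun x x' => ?_).eHolderNorm_le
          refine (norm_iteratedFDeriv_one_sub_le _ x x').trans ?_
          rw [hfd, covector_sub]
          refine (norm_covector_le _).trans ?_
          refine (Finset.sum_le_sum fun i _ => hS (some i) (δ - 1) (by linarith) (by linarith)
            (by simp [halfOrder]) x x').trans (le_of_eq ?_)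
          simp; ring
      calc _ ≤ ENNReal.ofReal M + ENNReal.ofReal (d * M) + ENNReal.ofReal (d * S) :=
            add_le_add (add_le_add (iSup_le h0) (iSup_le hsup)) h2
        _ = ENNReal.ofReal (M + d * M + d * S) := by
            rw [ENNReal.ofReal_add (by positivity) (by positivity),
              ENNReal.ofReal_add (by positivity) (by positivity)]
        _ ≤ _ := ENNReal.ofReal_le_ofReal (by nlinarith)
    · rw [hfl]
      exact hD.contDiff

lemma holderNorm_zero (δ : ℝ) : holderNorm δ (0 : Torus d → ℝ) = 0 := by
  have h0 : lift (0 : Torus d → ℝ) = fun _ => (0 : ℝ) := rfl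
  have h1 : ∀ n, iteratedFDeriv ℝ n (lift (0 : Torus d → ℝ)) = 0 := fun n => by
    rw [h0]; ext x; simp
  rw [holderNorm, if_pos (by rw [h0]; exact contDiff_const)]
  simp [h1]

lemma contDiff_of_holderNorm_one_lt_top {f : Torus d → ℝ} (h : holderNorm 1 f < ⊤) :
    ContDiff ℝ 1 (lift f) := by
  by_contra hf
  rw [holderNorm, if_neg] at h
  · simp at h
  · simpa using hf

/-- The `C¹` norm dominates the function and its partial derivatives. -/
lemma enorm_le_holderNorm_one {f : Torus d → ℝ} (j : Option (Fin d)) (x : Torus d) :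
    ‖j.elim f (fun i => pderiv i f) x‖ₑ ≤ holderNorm 1 f := by
  rcases eq_or_ne (holderNorm 1 f) ⊤ with h | h
  · rw [h]; exact le_top
  have hf := contDiff_of_holderNorm_one_lt_top (lt_top_iff_ne_top.mpr h)
  obtain ⟨x, rfl⟩ := proj_surjective x
  rw [holderNorm, if_pos (by simpa using hf)]
  refine le_trans ?_ le_self_add
  simp only [Nat.floor_one, Finset.sum_range_succ, Finset.sum_range_zero, zero_add]
  cases j with
  | none =>
    refine le_trans (le_trans (le_of_eq ?_)
      (le_iSup (fun x => ‖iteratedFDeriv ℝ 0 (lift f) x‖ₑ) x)) le_self_add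
    rw [← ofReal_norm, ← ofReal_norm, norm_iteratedFDeriv_zero]
    rfl
  | some i =>
    refine le_trans (le_trans ?_
      (le_iSup (fun x => ‖iteratedFDeriv ℝ 1 (lift f) x‖ₑ) x)) le_add_self
    rw [← ofReal_norm, ← ofReal_norm, norm_iteratedFDeriv_one]
    refine ENNReal.ofReal_le_ofReal ?_
    have h1 := congrFun (lift_pderiv hf i) x
    have h2 := (fderiv ℝ (lift f) x).le_opNorm (basisVec i)
    rw [← h1] at h2
    simpa [basisVec, lift] using h2

lemma rpow_le_max_one {t T e : ℝ} (ht : t ∈ Ioc 0 T) (he0 : 0 ≤ e) (he1 : e ≤ 1) :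
    t ^ e ≤ max 1 T :=
  calc t ^ e ≤ (max 1 T) ^ e := Real.rpow_le_rpow ht.1.le (ht.2.trans (le_max_right _ _)) he0
    _ ≤ (max 1 T) ^ (1 : ℝ) := Real.rpow_le_rpow_of_exponent_le (le_max_left _ _) he1
    _ = max 1 T := Real.rpow_one _

lemma rpow_le_add_of_mem_Icc {a s T : ℝ} (ha : 0 < a) (hs : s ∈ Icc a T) (e : ℝ) :
    s ^ e ≤ a ^ e + T ^ e := by
  have hs0 : 0 < s := ha.trans_le hs.1
  have hT : 0 < T := hs0.trans_le hs.2
  rcases le_total 0 e with he | he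
  · have := Real.rpow_le_rpow hs0.le hs.2 he
    have := Real.rpow_nonneg ha.le e
    linarith
  · have := Real.rpow_le_rpow_of_nonpos ha hs.1 he
    have := Real.rpow_nonneg hT.le e
    linarith

lemma krExponent_nonneg (d : ℕ) (p q : ℝ≥0∞) : 0 ≤ krExponent d p q := by
  unfold krExponent; positivity

/-! ### Hölder regularity and time integrability of potentials. -/

section
variable {T : ℝ} {p q : ℝ≥0∞} {β g : ℝ → Torus d → ℝ} {N δ : ℝ}

lemma Admissible.isJet_potential (h : Admissible T p q β) (hN : 0 ≤ N)
    (hg : IsSqrtSource T β N g) {t : ℝ} (ht : t ∈ Ioc 0 T) :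
    IsJet fun j => potential j g t := by
  refine ⟨fun j => ?_, h.hasFDerivAt_potential hN hg ht.1 ht.2⟩
  exact (h.continuousOn_potential (ht.1.trans_le ht.2) hN hg j).comp_continuous
    (f := fun x : Torus d => (t, x)) (by fun_prop) fun x => ⟨ht, mem_univ _⟩

/-- Bounds for the Hölder norms of potentials. -/
lemma Admissible.exists_holderNorm_potential_le (h : Admissible T p q β)
    (hδ : δ ∈ Ico 0 (2 - krExponent d p q)) : ∃ C : ℝ, 0 ≤ C ∧
      ∀ (N : ℝ) (g : ℝ → Torus d → ℝ), 0 ≤ N → IsSqrtSource T β N g → ∀ t ∈ Ioc 0 T,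
        holderNorm δ (potential none g t) ≤
          ENNReal.ofReal (C * N * t ^ (-((krExponent d p q + δ - 1) / 2))) := by
  have hδ2 : δ < 2 := by have := krExponent_nonneg d p q; linarith [hδ.2]
  choose C1 hC1 h1 using h.exists_potential_le
  have h2 : ∀ j : Option (Fin d), ∃ C : ℝ, 0 ≤ C ∧ ∀ θ, 0 ≤ θ → θ < 1 → 2 * halfOrder j + θ = δ →
      ∀ (N : ℝ) (g : ℝ → Torus d → ℝ), 0 ≤ N → IsSqrtSource T β N g → ∀ t, 0 < t → t ≤ T →
        ∀ x x', |potential j g t (proj x) - potential j g t (proj x')| ≤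
          C * N * t ^ ((1 - krExponent d p q) / 2 - halfOrder j - θ / 2) * ‖x - x'‖ ^ θ := by
    intro j
    -- Only indices whose order is the integer part of `δ` matter; for the others the claim is
    -- vacuous and the constant is `0`.
    by_cases hj : 0 ≤ δ - 2 * halfOrder j ∧ δ - 2 * halfOrder j < 1
    · obtain ⟨C, hC0, hC⟩ := h.exists_potential_sub_le j hj.1 hj.2.le (by linarith [hδ.2])
      refine ⟨C, hC0, fun θ _ _ hθ => ?_⟩
      obtain rfl : θ = δ - 2 * halfOrder j := by linarith
      exact hC
    · exact ⟨0, le_rfl, fun θ h0 h1 hθ => absurd ⟨by linarith, by linarith⟩ hj⟩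
  choose C2 hC2 h2 using h2
  refine ⟨(1 + d) * ((∑ j, C1 j) * max 1 T + ∑ j, C2 j), ?_, fun N g hN hg t ht => ?_⟩
  · have := Finset.sum_nonneg fun j (_ : j ∈ Finset.univ) => hC1 j
    have := Finset.sum_nonneg fun j (_ : j ∈ Finset.univ) => hC2 j
    positivity
  have ht0 := ht.1
  have hs1 : ∀ j, C1 j ≤ ∑ j, C1 j := fun j =>
    Finset.single_le_sum (fun i _ => hC1 i) (Finset.mem_univ j)
  have hs2 : ∀ j, C2 j ≤ ∑ j, C2 j := fun j =>
    Finset.single_le_sum (fun i _ => hC2 i) (Finset.mem_univ j)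
  have hS1 : 0 ≤ ∑ j, C1 j := Finset.sum_nonneg fun j _ => hC1 j
  have hS2 : 0 ≤ ∑ j, C2 j := Finset.sum_nonneg fun j _ => hC2 j
  set a := -((krExponent d p q + δ - 1) / 2) with ha
  refine ((h.isJet_potential hN hg ht).holderNorm_le (M := (∑ j, C1 j) * max 1 T * N * t ^ a)
    (S := (∑ j, C2 j) * N * t ^ a) hδ.1 hδ2 (by positivity) (by positivity)
    (fun j hj x => ?_) fun j θ hθ0 hθ1 hθ x x' => ?_).trans (le_of_eq (by congr 1; ring))
  · refine ((h1 j N g hN hg t ht.1 ht.2 x).2).trans ?_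
    -- Suprema of derivatives of order at most `δ` are less singular than the target; the spare
    -- power `t^{δ/2 - halfOrder j}` has exponent in `[0, 1]`.
    have h3 : t ^ ((1 - krExponent d p q) / 2 - halfOrder j) ≤ max 1 T * t ^ a := by
      have h4 := rpow_le_max_one ht (e := δ / 2 - halfOrder j) (by linarith)
        (by have := halfOrder_nonneg j; linarith)
      calc _ = t ^ (δ / 2 - halfOrder j) * t ^ a := by
            rw [← Real.rpow_add ht0]; congr 1; rw [ha]; ring
        _ ≤ _ := by gcongr
    calc _ ≤ (∑ j, C1 j) * N * (max 1 T * t ^ a) := by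
          gcongr
          exact hs1 j
      _ = _ := by ring
  · refine (h2 j θ hθ0 hθ1 hθ N g hN hg t ht.1 ht.2 x x').trans ?_
    have h3 : (1 - krExponent d p q) / 2 - halfOrder j - θ / 2 = a := by rw [ha]; linarith
    rw [h3]
    gcongr
    exact hs2 j

lemma weightedSup_potential_le {C : ℝ}
    (hb : ∀ t ∈ Ioc 0 T, holderNorm δ (potential none g t) ≤
      ENNReal.ofReal (C * N * t ^ (-((krExponent d p q + δ - 1) / 2)))) :
    weightedSup T ((krExponent d p q + δ - 1) / 2) δ (potential none g) ≤
      ENNReal.ofReal (C * N) := by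
  refine iSup₂_le fun t ht => ?_
  rcases ht.1.eq_or_lt with h0 | h0
  · have h1 : potential none g t = (0 : Torus d → ℝ) := by
      rw [← h0]; ext x; exact potential_zero none g x
    rw [h1, holderNorm_zero, mul_zero]
    exact zero_le
  · calc _ ≤ ENNReal.ofReal (t ^ ((krExponent d p q + δ - 1) / 2)) *
          ENNReal.ofReal (C * N * t ^ (-((krExponent d p q + δ - 1) / 2))) := by
          gcongr
          exact hb t ⟨h0, ht.2⟩
      _ = ENNReal.ofReal (C * N) := by
          rw [← ENNReal.ofReal_mul (by positivity), mul_left_comm, ← Real.rpow_add h0]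
          simp

/-- Uniform continuity on the compact set `[t/2, T] × 𝕋^d`, which keeps away from the singular
initial time. -/
lemma eventually_forall_abs_sub_lt {F : ℝ → Torus d → ℝ}
    (hF : ContinuousOn (fun z : ℝ × Torus d => F z.1 z.2) (Ioc 0 T ×ˢ univ)) {t ε : ℝ}
    (ht : t ∈ Ioc 0 T) (hε : 0 < ε) : ∀ᶠ s in 𝓝[Ioc 0 T] t, ∀ x, |F s x - F t x| < ε := by
  have h1 : Icc (t / 2) T ⊆ Ioc 0 T := fun s hs => ⟨(half_pos ht.1).trans_le hs.1, hs.2⟩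
  have h2 := (isCompact_Icc.prod isCompact_univ).uniformContinuousOn_of_continuous
    (hF.mono (prod_mono h1 subset_rfl))
  obtain ⟨η, hη, h3⟩ := Metric.uniformContinuousOn_iff.mp h2 ε hε
  have h4 : ∀ᶠ s in 𝓝[Ioc 0 T] t, s ∈ Ioc 0 T := eventually_mem_nhdsWithin
  have h5 : ∀ᶠ s in 𝓝[Ioc 0 T] t, dist s t < min η (t / 2) :=
    nhdsWithin_le_nhds (Metric.ball_mem_nhds t (lt_min hη (half_pos ht.1)))
  filter_upwards [h4, h5] with s hs hs' x
  have h6 := abs_lt.mp (lt_of_lt_of_le hs' (min_le_right _ _))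
  refine h3 (s, x) ⟨⟨by linarith [h6.1], hs.2⟩, mem_univ _⟩ (t, x)
    ⟨⟨by linarith [ht.1], ht.2⟩, mem_univ _⟩ ?_
  rw [Prod.dist_eq, dist_self, max_eq_left dist_nonneg]
  exact lt_of_lt_of_le hs' (min_le_left _ _)

/-- Interpolation again: increments in time are uniformly small in supremum norm and bounded in a
slightly stronger Hölder seminorm, hence small in the intermediate one. -/
lemma Admissible.eventually_holder_sub_le (h : Admissible T p q β) (hN : 0 ≤ N)
    (hg : IsSqrtSource T β N g) (j : Option (Fin d)) {t θ ε : ℝ} (ht : t ∈ Ioc 0 T) (hθ0 : 0 ≤ θ)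
    (hθ1 : θ < 1) (hθ : 2 * halfOrder j + θ < 2 - krExponent d p q) (hε : 0 < ε) :
    ∀ᶠ s in 𝓝[Ioc 0 T] t, ∀ x x', |(potential j g s (proj x) - potential j g t (proj x)) -
      (potential j g s (proj x') - potential j g t (proj x'))| ≤ ε * ‖x - x'‖ ^ θ := by
  -- The strict inequalities leave room for an exponent `θ' > θ` that is still admissible. The
  -- interpolation parameter is `θ/θ'`.
  obtain ⟨θ', hθθ', hθ'⟩ := exists_between
    (lt_min hθ1 (show θ < 2 - krExponent d p q - 2 * halfOrder j by linarith))
  have hθ'0 : 0 < θ' := hθ0.trans_lt hθθ'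
  obtain ⟨C, hC0, hC⟩ := h.exists_potential_sub_le j hθ'0.le (hθ'.le.trans (min_le_left _ _))
    (by linarith [min_le_right 1 (2 - krExponent d p q - 2 * halfOrder j)])
  set e := (1 - krExponent d p q) / 2 - halfOrder j - θ' / 2 with he
  have ht2 : 0 < t / 2 := half_pos ht.1
  have hT : 0 < T := ht.1.trans_le ht.2
  set K := 2 * (C * N * ((t / 2) ^ e + T ^ e)) with hK
  have hK0 : 0 ≤ K := by positivity
  have hr0 : 0 ≤ θ / θ' := by positivity
  have hr1 : θ / θ' < 1 := (div_lt_one hθ'0).mpr hθθ'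
  have h1 : Tendsto (fun η : ℝ => (2 * η) ^ (1 - θ / θ') * K ^ (θ / θ')) (𝓝[>] 0) (𝓝 0) := by
    have h2 : ContinuousAt (fun η : ℝ => (2 * η) ^ (1 - θ / θ') * K ^ (θ / θ')) 0 :=
      ContinuousAt.mul (ContinuousAt.rpow_const (by fun_prop) (Or.inr (by linarith)))
        continuousAt_const
    have h3 := h2.tendsto
    rw [mul_zero, Real.zero_rpow (by linarith), zero_mul] at h3
    exact h3.mono_left nhdsWithin_le_nhds
  obtain ⟨η, hη1, hη0⟩ := ((h1.eventually (gt_mem_nhds hε)).and self_mem_nhdsWithin).exists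
  have hη0 : 0 < η := hη0
  have h4 := eventually_forall_abs_sub_lt (h.continuousOn_potential hT hN hg j) ht hη0
  have h5 : ∀ᶠ s in 𝓝[Ioc 0 T] t, t / 2 < s :=
    nhdsWithin_le_nhds (lt_mem_nhds (half_lt_self ht.1))
  filter_upwards [h4, h5, eventually_mem_nhdsWithin] with s hs1 hs2 hs3 x x'
  have hb : ∀ r ∈ Icc (t / 2) T, |potential j g r (proj x) - potential j g r (proj x')| ≤
      C * N * ((t / 2) ^ e + T ^ e) * ‖x - x'‖ ^ θ' := fun r hr => by
    refine (hC N g hN hg r (ht2.trans_le hr.1) hr.2 x x').trans ?_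
    gcongr
    exact rpow_le_add_of_mem_Icc ht2 hr e
  set D := (potential j g s (proj x) - potential j g t (proj x)) -
      (potential j g s (proj x') - potential j g t (proj x')) with hD
  have h6 : |D| ≤ 2 * η := by
    have h7 := abs_lt.mp (hs1 (proj x))
    have h8 := abs_lt.mp (hs1 (proj x'))
    rw [abs_le]
    constructor <;> linarith [h7.1, h7.2, h8.1, h8.2]
  have h9 : |D| ≤ K * ‖x - x'‖ ^ θ' := by
    have h7 := abs_le.mp (hb s ⟨hs2.le, hs3.2⟩)
    have h8 := abs_le.mp (hb t ⟨by linarith [ht.1], ht.2⟩)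
    rw [abs_le]
    have h10 : K * ‖x - x'‖ ^ θ' = 2 * (C * N * ((t / 2) ^ e + T ^ e) * ‖x - x'‖ ^ θ') := by
      rw [hK]; ring
    constructor <;> linarith [h7.1, h7.2, h8.1, h8.2]
  refine (le_mul_rpow_of_le_of_le (abs_nonneg D) hK0 (by positivity) hr0 hr1.le h6 h9).trans ?_
  rw [← Real.rpow_mul (norm_nonneg _), mul_div_cancel₀ _ hθ'0.ne']
  gcongr

/-- Potentials depend continuously on positive times, with respect to Hölder norms. -/
lemma Admissible.tendsto_holderNorm_potential_sub (h : Admissible T p q β) (hN : 0 ≤ N)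
    (hg : IsSqrtSource T β N g) (hδ : δ ∈ Ico 0 (2 - krExponent d p q)) {t : ℝ}
    (ht : t ∈ Ioc 0 T) :
    Tendsto (fun s => holderNorm δ (potential none g s - potential none g t)) (𝓝[Ioc 0 T] t)
      (𝓝 0) := by
  have hδ2 : δ < 2 := by have := krExponent_nonneg d p q; linarith [hδ.2]
  refine ENNReal.tendsto_nhds_zero.mpr fun ε hε => ?_
  obtain ⟨r, hr0, hr⟩ := ENNReal.lt_iff_exists_nnreal_btwn.mp hε
  have hr0 : 0 < (r : ℝ) := by exact_mod_cast hr0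
  have hd : (0 : ℝ) < 1 + d := by positivity
  set η : ℝ := r / (2 * (1 + d)) with hη
  have hη0 : 0 < η := by positivity
  have h1 : ∀ᶠ s in 𝓝[Ioc 0 T] t, ∀ j x, |potential j g s x - potential j g t x| < η :=
    eventually_all.mpr fun j =>
      eventually_forall_abs_sub_lt (h.continuousOn_potential (ht.1.trans_le ht.2) hN hg j) ht hη0
  have h2 : ∀ᶠ s in 𝓝[Ioc 0 T] t, ∀ j θ, 0 ≤ θ → θ < 1 → 2 * halfOrder j + θ = δ →
      ∀ x x', |(potential j g s (proj x) - potential j g t (proj x)) -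
        (potential j g s (proj x') - potential j g t (proj x'))| ≤ η * ‖x - x'‖ ^ θ := by
    refine eventually_all.mpr fun j => ?_
    by_cases hj : 0 ≤ δ - 2 * halfOrder j ∧ δ - 2 * halfOrder j < 1
    · filter_upwards [h.eventually_holder_sub_le hN hg j ht hj.1 hj.2 (by linarith [hδ.2]) hη0]
        with s hs θ _ _ hθ
      obtain rfl : θ = δ - 2 * halfOrder j := by linarith
      exact hs
    · exact Eventually.of_forall fun s θ h0 h1 hθ => absurd ⟨by linarith, by linarith⟩ hj
  filter_upwards [h1, h2, eventually_mem_nhdsWithin] with s hs1 hs2 hs3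
  have hJ := (h.isJet_potential hN hg hs3).sub (h.isJet_potential hN hg ht)
  refine (hJ.holderNorm_le hδ.1 hδ2 hη0.le hη0.le (fun j _ x => (hs1 j x).le) hs2).trans ?_
  have h3 : (1 + d : ℝ) * (η + η) = r := by rw [hη]; field_simp; ring
  rw [h3, ENNReal.ofReal_coe_nnreal]
  exact hr.le

lemma Admissible.memLrHolder_potential (h : Admissible T p q β) (hT : 0 < T) (hN : 0 ≤ N)
    (hg : IsSqrtSource T β N g) (hδ : δ ∈ Ico 0 (2 - krExponent d p q)) {r : ℝ≥0∞}
    (hr : ∀ K : ℝ, eLpNorm (fun t : ℝ => K * t ^ (-((krExponent d p q + δ - 1) / 2))) r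
      (volume.restrict (Ioc 0 T)) < ⊤) :
    MemLrHolder T r δ (potential none g) := by
  obtain ⟨C, hC0, hC⟩ := h.exists_holderNorm_potential_le hδ
  have hb := hC N g hN hg
  have hr' : (volume.restrict (Icc 0 T) : Measure ℝ) = volume.restrict (Ioc 0 T) :=
    Measure.restrict_congr_set Ioc_ae_eq_Icc.symm
  have hTm : T ∈ Ioc 0 T := ⟨hT, le_rfl⟩
  -- The approximants are the potential evaluated at simple functions of time that converge to the
  -- identity within `(0, T]`. Continuity of positive times into `C^δ` gives their convergence.
  refine ⟨⟨fun n => (SimpleFunc.approxOn id measurable_id (Ioc 0 T) T hTm n).map (potential none g),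
    fun n t => ?_, ?_⟩, ?_⟩
  · exact (hb _ (SimpleFunc.approxOn_mem measurable_id hTm n t)).trans_lt ENNReal.ofReal_lt_top
  · rw [hr']
    filter_upwards [ae_restrict_mem measurableSet_Ioc] with t ht
    have h1 : Tendsto (fun n => SimpleFunc.approxOn id measurable_id (Ioc 0 T) T hTm n t) atTop
        (𝓝[Ioc 0 T] t) :=
      tendsto_nhdsWithin_iff.mpr
        ⟨SimpleFunc.tendsto_approxOn measurable_id hTm (subset_closure ht),
          Eventually.of_forall fun n => SimpleFunc.approxOn_mem measurable_id hTm n t⟩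
    exact (h.tendsto_holderNorm_potential_sub hN hg hδ ht).comp h1
  · rw [hr']
    refine (eLpNorm_mono_enorm_ae ?_).trans_lt (hr (C * N))
    filter_upwards [ae_restrict_mem measurableSet_Ioc] with t ht
    rw [enorm_eq_self]
    exact (hb t ht).trans (Real.ofReal_le_enorm _)

lemma eLpNorm_top_rpow_lt_top {a : ℝ} (ha : a ≤ 0) (K : ℝ) :
    eLpNorm (fun t : ℝ => K * t ^ (-a)) ∞ (volume.restrict (Ioc 0 T)) < ⊤ := by
  refine (eLpNorm_mono_ae (g := fun _ : ℝ => |K| * T ^ (-a)) ?_).trans_lt (memLp_const _).2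
  filter_upwards [ae_restrict_mem measurableSet_Ioc] with t ht
  have h0 := ht.1.le
  rw [norm_mul, norm_mul, Real.norm_eq_abs K, Real.norm_eq_abs |K|, abs_abs,
    Real.norm_of_nonneg (Real.rpow_nonneg h0 _),
    Real.norm_of_nonneg (Real.rpow_nonneg (h0.trans ht.2) _)]
  gcongr
  · linarith
  · exact ht.2

lemma eLpNorm_two_rpow_lt_top {a : ℝ} (hT : 0 ≤ T) (ha : a < 1 / 2) (K : ℝ) :
    eLpNorm (fun t : ℝ => K * t ^ (-a)) 2 (volume.restrict (Ioc 0 T)) < ⊤ := by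
  have hm : Measurable fun t : ℝ => K * t ^ (-a) := by fun_prop
  refine ((memLp_two_iff_integrable_sq hm.aestronglyMeasurable).mpr ?_).2
  have h1 : IntegrableOn (fun t : ℝ => K ^ 2 * t ^ (-(2 * a))) (Ioc 0 T) volume := by
    have h2 := intervalIntegral.intervalIntegrable_rpow' (a := 0) (b := T) (r := -(2 * a))
      (by linarith)
    rw [intervalIntegrable_iff_integrableOn_Ioc_of_le hT] at h2
    exact h2.const_mul _
  refine h1.congr ?_
  filter_upwards [ae_restrict_mem measurableSet_Ioc] with t ht
  rw [mul_pow, ← Real.rpow_natCast (t ^ (-a)), ← Real.rpow_mul ht.1.le]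
  congr 2
  push_cast; ring

end

/-! ### From mild to weak solutions. -/

section
variable {T : ℝ}

lemma ae_cylinder_mem_Ioc (d : ℕ) (T : ℝ) : ∀ᵐ z ∂(cylinder d T), z.1 ∈ Ioc 0 T := by
  rw [cylinder, Measure.restrict_congr_set Ioc_ae_eq_Icc.symm]
  exact Measure.quasiMeasurePreserving_fst.ae (ae_restrict_mem measurableSet_Ioc)

lemma integrable_integral_mul {F : ℝ → Torus d → ℝ}
    (hF : Integrable (fun z : ℝ × Torus d => F z.1 z.2) (cylinder d T)) {φ : Torus d → ℝ}
    (hφ : Continuous φ) {t : ℝ} (ht : t ≤ T) :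
    Integrable (fun s => ∫ x, F s x * φ x) (volume.restrict (Ioo 0 t)) := by
  obtain ⟨M, -, hM⟩ := exists_abs_le_of_continuous hφ
  refine Integrable.integral_prod_left (f := fun z : ℝ × Torus d => F z.1 z.2 * φ z.2) ?_
  exact (hF.mono_measure (Ioo_prod_le_cylinder ht)).mul_bdd (g := fun z : ℝ × Torus d => φ z.2)
    (c := M) (hφ.comp continuous_snd).aestronglyMeasurable (Eventually.of_forall fun z => hM _)

lemma intervalIntegral_eq_integral_Ioo {f : ℝ → ℝ} {t : ℝ} (ht : 0 ≤ t) :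
    ∫ s in (0 : ℝ)..t, f s = ∫ s in Ioo 0 t, f s := by
  rw [intervalIntegral.integral_of_le ht, integral_Ioc_eq_integral_Ioo]

lemma integral_add_add {α : Type*} [MeasurableSpace α] {μ : Measure α} {f g k : α → ℝ}
    (hf : Integrable f μ) (hg : Integrable g μ) (hk : Integrable k μ) :
    ∫ x, (f x + g x + k x) ∂μ = (∫ x, f x ∂μ) + (∫ x, g x ∂μ) + ∫ x, k x ∂μ := by
  rw [← integral_add hf hg]
  exact integral_add (hf.add hg) hk

lemma integral_sub_sub {α : Type*} [MeasurableSpace α] {μ : Measure α} {f g k : α → ℝ}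
    (hf : Integrable f μ) (hg : Integrable g μ) (hk : Integrable k μ) :
    ∫ x, (f x - g x - k x) ∂μ = (∫ x, f x ∂μ) - (∫ x, g x ∂μ) - ∫ x, k x ∂μ := by
  rw [← integral_sub hf hg]
  exact integral_sub (hf.sub hg) hk

lemma isJet_conv {f : Torus d → ℝ} (hf : Integrable f volume) {t : ℝ} (ht : 0 < t) :
    IsJet fun j => conv j t f :=
  ⟨fun j => continuous_conv j ht hf, hasFDerivAt_conv ht hf⟩

end

section
variable {T : ℝ} {p q : ℝ≥0∞} {b : ℝ → Torus d → EuclideanSpace ℝ (Fin d)} {c : ℝ → Torus d → ℝ}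
  {h₀ : Torus d → ℝ} {V : Option (Fin d) → ℝ → Torus d → ℝ} {N : ℝ}

/-- A solution of the mild formulation is a weak solution. -/
lemma isWeakSolution_of_mild (ha : Admissible T p q (envelope b c)) (hT : 0 < T) (hN : 0 ≤ N)
    (hh₀ : Integrable h₀ volume)
    (hVc : ∀ j, ContinuousOn (fun z : ℝ × Torus d => V j z.1 z.2) (Ioc 0 T ×ˢ univ))
    (hVb : ∀ j, ∀ t ∈ Ioc 0 T, ∀ x, |V j t x| ≤ N * t ^ (-(1 / 2) : ℝ))
    (hg : IsSqrtSource T (envelope b c) N (lowerOrderOf b c V))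
    (hV : ∀ j, ∀ t ∈ Ioc 0 T, ∀ x,
      V j t x = conv j t h₀ x + potential j (lowerOrderOf b c V) t x) :
    IsWeakSolution T b c h₀
      fun t x => heat t h₀ x + potential none (lowerOrderOf b c V) t x := by
  set g := lowerOrderOf b c V with hgdef
  set h : ℝ → Torus d → ℝ := fun t x => heat t h₀ x + potential none g t x with hh
  -- The free evolution and the potential are each a function with its partial derivatives, so the
  -- fixed point equation makes `V` one as well.
  have hJ : ∀ t ∈ Ioc 0 T, IsJet fun j => V j t := fun t ht => by
    have h1 := (isJet_conv hh₀ ht.1).add (ha.isJet_potential hN hg ht)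
    have h2 : (fun j => V j t) = fun j x => conv j t h₀ x + potential j g t x := by
      ext j x; exact hV j t ht x
    rwa [h2]
  have hhV : ∀ t ∈ Ioc 0 T, h t = V none t := fun t ht => by
    ext x
    rw [hV none t ht x, hh]
    simp only [heat_eq_conv ht.1 hh₀.aestronglyMeasurable]
  have hh0 : h 0 = h₀ := by
    ext x; simp only [hh, heat_zero, potential_zero, add_zero]
  have hlo : ∀ t ∈ Ioc 0 T, ∀ x, lowerOrder b c h t x = g t x := fun t ht x => by
    rw [lowerOrder_eq, hgdef, lowerOrderOf, lowerOrderOf]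
    refine Finset.sum_congr rfl fun j _ => ?_
    cases j with
    | none => simp only [jet, hhV t ht]
    | some i => simp only [jet, hhV t ht, (hJ t ht).pderiv i]
  have hgi := ha.integrable_source hT hN hg
  have hint : Integrable (fun z : ℝ × Torus d => h z.1 z.2) (cylinder d T) := by
    have h1 : Integrable (fun t : ℝ => N * t ^ (-(1 / 2) : ℝ)) (volume.restrict (Icc 0 T)) := by
      have h2 := intervalIntegral.intervalIntegrable_rpow' (a := 0) (b := T) (r := -(1 / 2))
        (by norm_num)
      rw [intervalIntegrable_iff_integrableOn_Ioc_of_le hT.le,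
        ← integrableOn_Icc_iff_integrableOn_Ioc] at h2
      exact h2.const_mul N
    have h3 : Integrable (fun z : ℝ × Torus d => V none z.1 z.2) (cylinder d T) := by
      refine Integrable.mono' (h1.comp_fst volume) ?_ ?_
      · have h4 : cylinder d T = (volume.prod volume).restrict (Ioc 0 T ×ˢ univ) := by
          rw [cylinder, ← Measure.prod_restrict, Measure.restrict_univ,
            Measure.restrict_congr_set Ioc_ae_eq_Icc.symm]
        change AEStronglyMeasurable _ (cylinder d T)
        rw [h4]
        exact (hVc none).aestronglyMeasurable (measurableSet_Ioc.prod MeasurableSet.univ)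
      · filter_upwards [ae_cylinder_mem_Ioc d T] with z hz
        exact hVb none z.1 hz z.2
    refine h3.congr ?_
    filter_upwards [ae_cylinder_mem_Ioc d T] with z hz
    rw [hhV z.1 hz]
  refine ⟨fun t ht => ?_, fun t ht => ?_, hint, ?_, fun φ hφ t ht => ?_⟩
  · rw [hhV t ht]; exact (hJ t ht).contDiff
  · rcases ht.1.eq_or_lt with h0 | h0
    · rw [← h0, hh0]; exact hh₀
    · rw [hhV t ⟨h0, ht.2⟩]
      exact continuous_integrable_torus ((hJ t ⟨h0, ht.2⟩).continuous none)
  · refine hgi.congr ?_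
    filter_upwards [ae_cylinder_mem_Ioc d T] with z hz
    rw [hlo z.1 hz]
  · rcases ht.1.eq_or_lt with h0 | h0
    · rw [← h0, hh0]; simp
    have hc := hφ.continuous
    have hl := hφ.continuous_laplacian
    have hsum : ∀ s, 0 < s → s ≤ T → ∀ ψ : Torus d → ℝ, Continuous ψ → ∫ x, h s x * ψ x =
        (∫ x, conv none s h₀ x * ψ x) + ∫ x, potential none g s x * ψ x := by
      intro s hs hsT ψ hψ
      rw [← integral_add]
      · refine integral_congr_ae (Eventually.of_forall fun x => ?_)
        simp only [hh, heat_eq_conv hs hh₀.aestronglyMeasurable, add_mul]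
      · exact continuous_integrable_torus ((continuous_conv none hs hh₀).mul hψ)
      · exact continuous_integrable_torus
          (((ha.isJet_potential hN hg ⟨hs, hsT⟩).continuous none).mul hψ)
    obtain ⟨h1, h2, h3⟩ := ha.integral_potential_mul_smooth hN hg h0 ht.2 hφ
    have h4 := integrable_integral_mul hint hl ht.2
    -- The free part inherits integrability as the difference of the pairings of `h` and of the
    -- potential.
    have h5 : Integrable (fun s => ∫ x, conv none s h₀ x * laplacian φ x)
        (volume.restrict (Ioo 0 t)) := by
      refine (h4.sub h1).congr ?_
      filter_upwards [ae_restrict_mem measurableSet_Ioo] with s hs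
      simp only [Pi.sub_apply]
      rw [hsum s hs.1 (hs.2.le.trans ht.2) _ hl, add_sub_cancel_right]
    have h6 : ∫ s in Ioo 0 t, ((∫ x, h s x * laplacian φ x) + ∫ x, lowerOrder b c h s x * φ x) =
        ∫ s in Ioo 0 t, (((∫ x, conv none s h₀ x * laplacian φ x) +
          ∫ x, potential none g s x * laplacian φ x) + ∫ x, g s x * φ x) := by
      refine setIntegral_congr_fun measurableSet_Ioo fun s hs => ?_
      simp only [hsum s hs.1 (hs.2.le.trans ht.2) _ hl, hlo s ⟨hs.1, hs.2.le.trans ht.2⟩]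
    rw [intervalIntegral_eq_integral_Ioo ht.1, h6, integral_add_add h5 h1 h2,
      hsum t h0 ht.2 φ hc, h3, integral_conv_mul_smooth hh₀ hφ h0, integral_Ioc_eq_integral_Ioo]
    ring

end

/-! ### Uniqueness of structured solutions. -/

section
variable {T : ℝ} {p q : ℝ≥0∞} {b : ℝ → Torus d → EuclideanSpace ℝ (Fin d)} {c : ℝ → Torus d → ℝ}
  {h₀ : Torus d → ℝ} {h v h' v' : ℝ → Torus d → ℝ} {γ : ℝ}

lemma holderNorm_lt_top_of_weightedSup {a δ : ℝ} (hv : weightedSup T a δ v < ⊤) {t : ℝ}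
    (ht : t ∈ Ioc 0 T) : holderNorm δ (v t) < ⊤ := by
  have h1 := (le_iSup₂ (f := fun t (_ : t ∈ Icc 0 T) =>
    ENNReal.ofReal (t ^ a) * holderNorm δ (v t)) t ⟨ht.1.le, ht.2⟩).trans_lt hv
  have h2 : ENNReal.ofReal (t ^ a) ≠ 0 := by
    have := Real.rpow_pos_of_pos ht.1 a
    simpa using this
  refine lt_top_iff_ne_top.mpr fun h3 => ?_
  rw [h3, ENNReal.mul_top h2] at h1
  exact lt_irrefl _ h1

lemma isJet_of_weightedSup {a : ℝ} (hv : weightedSup T a 1 v < ⊤) {t : ℝ} (ht : t ∈ Ioc 0 T) :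
    IsJet fun j => jet v j t := by
  have h1 := isJet_of_contDiff
    (contDiff_of_holderNorm_one_lt_top (holderNorm_lt_top_of_weightedSup hv ht))
  have h2 : (fun j => jet v j t) = fun j => j.elim (v t) fun i => pderiv i (v t) := by
    ext j x; cases j <;> rfl
  rwa [h2]

/-- Since `a ≤ 1/2`, the structured bound `t^{-a}` is at most a multiple of the square root
singularity, for which the potential estimates are set up. -/
lemma abs_jet_le_of_weightedSup {a : ℝ} (ha : a ≤ 1 / 2) (ha0 : 0 ≤ a)
    (hv : weightedSup T a 1 v < ⊤) (j : Option (Fin d)) {t : ℝ} (ht : t ∈ Ioc 0 T) (x : Torus d) :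
    |jet v j t x| ≤ (weightedSup T a 1 v).toReal * max 1 T * t ^ (-(1 / 2) : ℝ) := by
  have ht0 := ht.1
  have h1 : ENNReal.ofReal (t ^ a) * ‖jet v j t x‖ₑ ≤ weightedSup T a 1 v := by
    refine le_trans ?_ (le_iSup₂ (f := fun t (_ : t ∈ Icc 0 T) =>
      ENNReal.ofReal (t ^ a) * holderNorm 1 (v t)) t ⟨ht.1.le, ht.2⟩)
    gcongr
    have h2 := enorm_le_holderNorm_one (f := v t) j x
    cases j <;> exact h2
  have h2 := ENNReal.toReal_mono hv.ne h1
  rw [ENNReal.toReal_mul, ENNReal.toReal_ofReal (by positivity), toReal_enorm,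
    Real.norm_eq_abs] at h2
  calc |jet v j t x| = t ^ (-a) * (t ^ a * |jet v j t x|) := by
        rw [← mul_assoc, ← Real.rpow_add ht0]; simp
    _ ≤ (t ^ (1 / 2 - a) * t ^ (-(1 / 2) : ℝ)) * (weightedSup T a 1 v).toReal := by
        rw [← Real.rpow_add ht0]
        have h3 : 1 / 2 - a + -(1 / 2) = -a := by ring
        rw [h3]
        gcongr
    _ ≤ (max 1 T * t ^ (-(1 / 2) : ℝ)) * (weightedSup T a 1 v).toReal := by
        gcongr
        exact rpow_le_max_one ht (by linarith) (by linarith)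
    _ = _ := by ring

/-- The underlying function determines its partial derivatives. This upgrades identities between
functions to identities between gradients. -/
lemma IsJet.congr {D D' : Option (Fin d) → Torus d → ℝ} (hD : IsJet D) (hD' : IsJet D')
    (h : D none = D' none) : D = D' := by
  ext j : 1
  cases j with
  | none => exact h
  | some i => rw [← hD.pderiv i, ← hD'.pderiv i, h]

/-- Uniqueness of structured solutions. -/
lemma IsStructuredSolution.unique (ha : Admissible T p q (envelope b c)) (hT : 0 < T)
    (hγ0 : 0 ≤ γ) (hγ1 : γ ≤ 1)
    (hs : IsStructuredSolution T γ b c h₀ h v) (hs' : IsStructuredSolution T γ b c h₀ h' v') :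
    ∀ t ∈ Icc 0 T, h' t = h t ∧ v' t = v t := by
  set W : Option (Fin d) → ℝ → Torus d → ℝ := fun j t x => jet v' j t x - jet v j t x with hW
  have hdiff : ∀ t ∈ Icc 0 T, ∀ x, h' t x - h t x = v' t x - v t x := fun t ht x => by
    rw [hs.decomp t ht, hs'.decomp t ht]; ring
  have hWJ : ∀ t ∈ Ioc 0 T, IsJet fun j => W j t := fun t ht =>
    (isJet_of_weightedSup hs'.finite ht).sub (isJet_of_weightedSup hs.finite ht)
  set G := lowerOrderOf b c W with hG
  -- The free evolution cancels in `h' - h`, so its gradient is that of `v' - v`, and the lower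
  -- order terms differ by the one built from `W`.
  have hlo : ∀ t ∈ Ioc 0 T, ∀ x, lowerOrder b c h' t x - lowerOrder b c h t x = G t x := by
    intro t ht x
    have h1 := (isJet_of_contDiff (hs'.weakSolution.contDiff t ht)).sub
      (isJet_of_contDiff (hs.weakSolution.contDiff t ht))
    have h2 := h1.congr (hWJ t ht) (funext fun y => hdiff t ⟨ht.1.le, ht.2⟩ y)
    rw [lowerOrder_eq, lowerOrder_eq, ← lowerOrderOf_sub, hG, lowerOrderOf, lowerOrderOf]
    refine Finset.sum_congr rfl fun j _ => ?_
    have h3 := congrFun (congrFun h2 j) x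
    rw [← h3]
    cases j <;> rfl
  set M := ((weightedSup T (γ / 2) 1 v').toReal + (weightedSup T (γ / 2) 1 v).toReal) * max 1 T
    with hM
  have hM0 : 0 ≤ M := by positivity
  have hWb : ∀ j, ∀ t ∈ Ioc 0 T, ∀ x, |W j t x| ≤ M * t ^ (-(1 / 2) : ℝ) := by
    intro j t ht x
    have h1 := abs_jet_le_of_weightedSup (by linarith) (by linarith) hs'.finite j ht x
    have h2 := abs_jet_le_of_weightedSup (by linarith) (by linarith) hs.finite j ht x
    refine (abs_sub _ _).trans ?_
    rw [hM]
    linarith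
  have hGm : AEStronglyMeasurable (fun z : ℝ × Torus d => G z.1 z.2) (cylinder d T) := by
    refine (hs'.weakSolution.integrable_lowerOrder.sub
      hs.weakSolution.integrable_lowerOrder).aestronglyMeasurable.congr ?_
    filter_upwards [ae_cylinder_mem_Ioc d T] with z hz
    exact hlo z.1 hz z.2
  have hGs : IsSqrtSource T (envelope b c) M G :=
    ⟨hGm, fun s hs x => abs_lowerOrderOf_le fun j => hWb j s hs x⟩
  -- the difference is a potential
  have hz : ∀ t ∈ Icc 0 T, (fun x => v' t x - v t x - potential none G t x) = 0 := by
    refine eq_zero_of_weak_heat hT.le (z := fun t x => v' t x - v t x - potential none G t x)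
      ((hs'.continuous.sub hs.continuous).sub (ha.continuousOn_potential_none hT hM0 hGs))
      fun φ hφ t ht => ?_
    rcases ht.1.eq_or_lt with h0 | h0
    · simp [← h0, hs.initial, hs'.initial, potential_zero]
    have hc := hφ.continuous
    have hl := hφ.continuous_laplacian
    have hmul : ∀ {f ψ : Torus d → ℝ}, Integrable f volume → Continuous ψ →
        Integrable (fun x => f x * ψ x) volume := fun {f ψ} hf hψ => by
      obtain ⟨K, -, hK⟩ := exists_abs_le_of_continuous hψ
      exact hf.mul_bdd hψ.aestronglyMeasurable (Eventually.of_forall hK)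
    have hsplit : ∀ s ∈ Ioc 0 T, ∀ ψ : Torus d → ℝ, Continuous ψ →
        ∫ x, (v' s x - v s x - potential none G s x) * ψ x =
          ((∫ x, h' s x * ψ x) - ∫ x, h s x * ψ x) - ∫ x, potential none G s x * ψ x := by
      intro s hs1 ψ hψ
      have hs2 : s ∈ Icc 0 T := ⟨hs1.1.le, hs1.2⟩
      have i1 := hmul (hs'.weakSolution.integrable_slice s hs2) hψ
      have i2 := hmul (hs.weakSolution.integrable_slice s hs2) hψ
      have i3 := hmul (continuous_integrable_torus
        ((ha.isJet_potential hM0 hGs hs1).continuous none)) hψ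
      rw [← integral_sub_sub i1 i2 i3]
      refine integral_congr_ae (Eventually.of_forall fun x => ?_)
      simp only [← hdiff s hs2 x]
      ring
    obtain ⟨k1, k2, k3⟩ := ha.integral_potential_mul_smooth hM0 hGs h0 ht.2 hφ
    have a1 := integrable_integral_mul hs'.weakSolution.integrable hl ht.2
    have a2 := integrable_integral_mul hs.weakSolution.integrable hl ht.2
    have b1 := integrable_integral_mul hs'.weakSolution.integrable_lowerOrder hc ht.2
    have b2 := integrable_integral_mul hs.weakSolution.integrable_lowerOrder hc ht.2
    have e1 : ∫ s in Ioo 0 t, ∫ x, G s x * φ x =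
        (∫ s in Ioo 0 t, ∫ x, lowerOrder b c h' s x * φ x) -
          ∫ s in Ioo 0 t, ∫ x, lowerOrder b c h s x * φ x := by
      rw [← integral_sub b1 b2]
      refine integral_congr_ae ?_
      have j1 := (hs'.weakSolution.integrable_lowerOrder.mono_measure
        (Ioo_prod_le_cylinder ht.2)).prod_right_ae
      have j2 := (hs.weakSolution.integrable_lowerOrder.mono_measure
        (Ioo_prod_le_cylinder ht.2)).prod_right_ae
      filter_upwards [j1, j2, ae_restrict_mem measurableSet_Ioo] with s hs1 hs2 hs3
      rw [← integral_sub (hmul hs1 hc) (hmul hs2 hc)]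
      refine integral_congr_ae (Eventually.of_forall fun x => ?_)
      simp only [← hlo s ⟨hs3.1, hs3.2.le.trans ht.2⟩ x, sub_mul]
    have e2 : ∫ s in Ioo 0 t, ∫ x, (v' s x - v s x - potential none G s x) * laplacian φ x =
        ((∫ s in Ioo 0 t, ∫ x, h' s x * laplacian φ x) -
          ∫ s in Ioo 0 t, ∫ x, h s x * laplacian φ x) -
            ∫ s in Ioo 0 t, ∫ x, potential none G s x * laplacian φ x := by
      rw [← integral_sub_sub a1 a2 k1]
      refine setIntegral_congr_fun measurableSet_Ioo fun s hs1 => ?_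
      exact hsplit s ⟨hs1.1, hs1.2.le.trans ht.2⟩ _ hl
    have w1 := hs'.weakSolution.weak φ hφ t ht
    have w2 := hs.weakSolution.weak φ hφ t ht
    rw [intervalIntegral_eq_integral_Ioo ht.1, integral_add a1 b1] at w1
    rw [intervalIntegral_eq_integral_Ioo ht.1, integral_add a2 b2] at w2
    rw [intervalIntegral_eq_integral_Ioo ht.1, e2, hsplit t ⟨h0, ht.2⟩ φ hc, w1, w2, k3, e1]
    ring
  -- Equality of `v' - v` with its potential passes to gradients, giving the homogeneous fixed point
  -- equation for all components.
  have hfix : ∀ j, ∀ t ∈ Ioc 0 T, ∀ x, W j t x = potential j G t x := by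
    intro j t ht x
    have h1 := (hWJ t ht).congr (ha.isJet_potential hM0 hGs ht) (funext fun y => by
      have h2 := congrFun (hz t ⟨ht.1.le, ht.2⟩) y
      exact sub_eq_zero.mp h2)
    exact congrFun (congrFun h1 j) x
  have hW0 := eq_zero_of_eq_potential ha hM0 hGm hWb hfix none
  have hv : ∀ t ∈ Icc 0 T, v' t = v t := by
    intro t ht
    ext x
    rcases ht.1.eq_or_lt with h0 | h0
    · rw [← h0, hs.initial, hs'.initial]
    · exact sub_eq_zero.mp (hW0 t ⟨h0, ht.2⟩ x)
  refine fun t ht => ⟨?_, hv t ht⟩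
  ext x
  rw [hs.decomp t ht, hs'.decomp t ht, hv t ht]

end

end ParabolicTorus

end

/-! ### Assembly of the four statements. -/

theorem mainTheorem12 (d : ℕ) (hd : 1 ≤ d) (T : ℝ) (hT : 0 < T)
    (p q : ℝ≥0∞) (hp : 2 < p) (hq : 2 < q) (hγ : krExponent d p q < 1)
    (b : ℝ → Torus d → EuclideanSpace ℝ (Fin d)) (c : ℝ → Torus d → ℝ)
    (hb : MemLqLp T q p b) (hc : MemLqLp T q p c) :
    ∃ (C : ℝ≥0) (K : ℝ → ℝ≥0), ∀ h₀ : Torus d → ℝ, MemLp h₀ ∞ volume →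
      ∃ h v : ℝ → Torus d → ℝ,
        IsStructuredSolution T (krExponent d p q) b c h₀ h v ∧
        weightedSup T (krExponent d p q / 2) 1 v ≤ C * eLpNorm h₀ ∞ volume ∧
        (∀ h' v' : ℝ → Torus d → ℝ,
          IsStructuredSolution T (krExponent d p q) b c h₀ h' v' →
            ∀ t ∈ Set.Icc 0 T, h' t = h t ∧ v' t = v t) ∧
        (∀ δ ∈ Set.Ico 0 (2 - krExponent d p q),
          weightedSup T ((krExponent d p q + δ - 1) / 2) δ v ≤ K δ * eLpNorm h₀ ∞ volume) ∧
        (∀ δ ∈ Set.Icc 0 (1 - krExponent d p q), MemLrHolder T ∞ δ v) ∧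
        (∀ δ ∈ Set.Ico 0 (2 - krExponent d p q), MemLrHolder T 2 δ v) := by
  have ha := admissible_envelope hp hq hγ hb hc
  have hγ0 := krExponent_nonneg d p q
  obtain ⟨C₀, hC₀, hmild⟩ := exists_mild_solution hT hp hq hγ hb hc
  -- The constants must be defined for every real `δ`; outside the admissible range the value `0` is
  -- used.
  have hK : ∀ δ : ℝ, ∃ A : ℝ, 0 ≤ A ∧ (δ ∈ Ico 0 (2 - krExponent d p q) →
      ∀ (N : ℝ) (g : ℝ → Torus d → ℝ), 0 ≤ N → IsSqrtSource T (envelope b c) N g →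
        ∀ t ∈ Ioc 0 T, holderNorm δ (potential none g t) ≤
          ENNReal.ofReal (A * N * t ^ (-((krExponent d p q + δ - 1) / 2)))) := by
    intro δ
    by_cases hδ : δ ∈ Ico 0 (2 - krExponent d p q)
    · obtain ⟨A, hA0, hA⟩ := ha.exists_holderNorm_potential_le hδ
      exact ⟨A, hA0, fun _ => hA⟩
    · exact ⟨0, le_rfl, fun h => absurd h hδ⟩
  choose A hA0 hA using hK
  refine ⟨(A 1 * C₀).toNNReal, fun δ => (A δ * C₀).toNNReal, fun h₀ hh₀ => ?_⟩
  obtain ⟨V, hVc, hVb, hV⟩ := hmild h₀ hh₀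
  set N := C₀ * (eLpNorm h₀ ∞ volume).toReal with hN
  have hN0 : 0 ≤ N := by positivity
  have hg : IsSqrtSource T (envelope b c) N (lowerOrderOf b c V) :=
    isSource_lowerOrderOf hb hc hVc hVb
  have hsup : ∀ δ ∈ Ico 0 (2 - krExponent d p q),
      weightedSup T ((krExponent d p q + δ - 1) / 2) δ (potential none (lowerOrderOf b c V)) ≤
        (A δ * C₀).toNNReal * eLpNorm h₀ ∞ volume := by
    intro δ hδ
    refine (weightedSup_potential_le (hA δ hδ N _ hN0 hg)).trans (le_of_eq ?_)
    rw [hN, ← mul_assoc, ENNReal.ofReal_mul (mul_nonneg (hA0 δ) hC₀),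
      ENNReal.ofReal_toReal hh₀.2.ne]
    rfl
  have hsup1 : weightedSup T (krExponent d p q / 2) 1 (potential none (lowerOrderOf b c V)) ≤
      (A 1 * C₀).toNNReal * eLpNorm h₀ ∞ volume := by
    -- `δ = 1` is admissible because `γ < 1`, and the weight exponent becomes `γ/2`.
    have h1 := hsup 1 ⟨zero_le_one, by linarith⟩
    rwa [add_sub_cancel_right] at h1
  have hsol : IsStructuredSolution T (krExponent d p q) b c h₀
      (fun t x => heat t h₀ x + potential none (lowerOrderOf b c V) t x)
      (potential none (lowerOrderOf b c V)) :=
    ⟨isWeakSolution_of_mild ha hT hN0 (hh₀.integrable le_top) hVc hVb hg hV, fun _ _ _ => rfl,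
      ha.continuousOn_potential_none hT hN0 hg, potential_zero none _,
      hsup1.trans_lt (ENNReal.mul_lt_top ENNReal.coe_lt_top hh₀.2)⟩
  refine ⟨_, _, hsol, hsup1, fun h' v' h => hsol.unique ha hT hγ0 hγ.le h, hsup,
    fun δ hδ => ?_, fun δ hδ => ?_⟩
  -- `δ ≤ 1 - γ` means that the norm is bounded by a nonnegative power of `t`.
  · exact ha.memLrHolder_potential hT hN0 hg ⟨hδ.1, by linarith [hδ.2]⟩
      (eLpNorm_top_rpow_lt_top (by linarith [hδ.2]))
  -- `δ < 2 - γ` means that the power of `t` exceeds `-1/2`, so its square is integrable.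
  · exact ha.memLrHolder_potential hT hN0 hg hδ
      (eLpNorm_two_rpow_lt_top hT.le (by linarith [hδ.2]))
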